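/- **Setting.** A Block MDP consists of a finite latent state space $\mathcal S$, a finite action space $\mathcal A$, a (possibly infinite, measurable) observation space $\mathcal X$ partitioned into blocks $\{\mathcal X_s\}_{s\in\mathcal S}$ by a true decoding function $f$ ($\mathcal X_s=f^{-1}(s)$), an initial state $s_1$, transition probabilities $p_h(s'|s,a)$, $h\in[H]$, emission distributions $q(\cdot|s)$ carried by $\mathcal X_s$, and deterministic rewards $r(h,s,a)\in[0,1]$. In an episode the agent sees $x_h\sim q(\cdot|s_h)$ for $h\in[H+1]$, chooses $a_h\sim\phi(h,x_h)$ and receives $r(h,s_h,a_h)$ for $h\in[H]$; $V_1^\phi$ is the expected total reward, and $\phi$ is $\varepsilon$-optimal if $V_1^\psi-V_1^\phi\le\varepsilon$ for all policies $\psi$. An MDP is the case $\mathcal X=\mathcal S$, $x_h=s_h$. *Oracle.* An unsupervised learning oracle $\mathcal{ULO}$ with error function $g$ (where $\lim_{n\to\infty}g(n,\delta)=0$ for each $\delta\in(0,1)$) is a, possibly randomized, procedure which for every distribution $\mu$ on $\mathcal S$, from $n$ i.i.d. samples of $\sum_s\mu(s)q(\cdot|s)$, finds with probability at least $1-\delta$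 a function $\hat f:\mathcal X\to\mathcal S$ such that $\mathbb P_{s\sim\mu,\,x\sim q(\cdot|s)}(\hat f(x)=\alpha(s))\ge 1-g(n,\delta)$ for some permutation $\alpha$ of $\mathcal S$. Put $g^{-1}(\epsilon,\delta)=\min\{N: g(n,\delta)<\epsilon\ \text{for all } n>N\}$. *Tabular algorithm.* $\mathscr A$ is $(\varepsilon,\delta)$-correct if on every MDP with state space $\mathcal S$, action space $\mathcal A$ and horizon $H$ (and any initial state), after $K$ episodes, in each of which it proposes a policy and receives a trajectory (states, actions, rewards) of it, it outputs a policy that is $\varepsilon$-optimal with probability at least $1-\delta$. $K=K(\varepsilon,\delta)$ is its sample complexity. *Algorithm.* Inputs: $\varepsilon,\delta\in(0,1)$, $\mathcal{ULO}$, $\mathscr A$, arbitrary initial decoding functions, and parameters $B\ge1$, $\epsilon,\delta_1,\delta_2\in(0,1)$. Let $N=\lceil\log(2/\delta)/2\rceil$, $L=\lceil\frac{9H^2}{2\varepsilon^2}\log(2N/\delta)\rceil$ and $J=(H+1)|\mathcal S|+1$. For $n=1,\dots,N$, start afresh: restart $\mathscr A$, called with accuracy $\varepsilon/4$ and failure probability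 $\delta_2$; let $\Pi$ be an empty list of policies and let all label standard sets $\mathcal D_{h,s}$ be undefined. For $k=1,\dots,K$, obtain $\pi^k$ from $\mathscr A$, call $\mathrm{TSR}(\pi^k,k)$ and give the returned trajectory to $\mathscr A$; then take the output $\pi^{K+1}$ of $\mathscr A$, call $\mathrm{TSR}(\pi^{K+1},K+1)$, and set $\phi^n=\pi^{K+1}\circ f_{[H+1]}$ with the resulting decoding functions $f_{[H+1]}$, where $(\pi\circ f_{[H+1]})(h,x)=\pi(h,f_h(x))$. Finally run each $\phi^n$ for $L$ episodes and output one with the largest average total reward. $\mathrm{TSR}(\pi,k)$ repeats for $i=1,\dots,J$, with $f_{[H+1]}$ the present decoding functions: (1) add $\pi\circ f_{[H+1]}$ to $\Pi$; (2) generate $((k-1)J+i)B$ training trajectories, each with a policy drawn uniformly from $\Pi$, and $B$ test trajectories with $\pi\circ f_{[H+1]}$; (3) for each level $h$ apply $\mathcal{ULO}$ with confidence $\delta_1$ to the level-$h$ training observations, obtaining $\tilde f_h$; (4) FixLabel: for each defined $\mathcal D_{h,s}$ in turn, if some label $s'$ is assigned by $\tilde f_h$ to more than $3/5$ of $\mathcal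 D_{h,s}$, swap the labels $s$ and $s'$ in the output of $\tilde f_h$; the results are the new decoding functions $f_h$; (5) for each $h$ and $s$ with $\mathcal D_{h,s}$ undefined, let $\mathcal D_{h,s}$ be the (multi)set of level-$h$ test observations $x$ with $f_h(x)=s$, provided that it has at least $3\epsilon B\log(1/\delta_1)$ members. After the $J$ iterations it runs $\pi\circ f_{[H+1]}$ once and returns the resulting trajectory, with each observation $x_h$ replaced by $f_h(x_h)$, and $f_{[H+1]}$. The list $\Pi$, the sets $\mathcal D_{h,s}$ and the decoding functions are kept between calls within the same $n$. **Theorem.** For all polynomials $p_g$ in three and $p_K$ in five variables there are a polynomial $P$ and a choice of the parameters $B,\epsilon,\delta_1,\delta_2$ as functions of $|\mathcal S|,|\mathcal A|,H,\varepsilon,\delta$ alone such that the following holds. For every Block MDP, every unsupervised learning oracle for it with $g^{-1}(\epsilon,\delta_1)\le p_g(|\mathcal S|,1/\epsilon,\log(1/\delta_1))$ for all $\epsilon,\delta_1\in(0,1)$, every algorithm $\mathscr A$ that for all $\varepsilon,\delta_2\in(0,1)$ is $(\varepsilon,\delta_2)$-correct with sample complexity at most $p_K(|\mathcal S|,|\mathcal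 A|,H,1/\varepsilon,\log(1/\delta_2))$, and all $\varepsilon,\delta\in(0,1)$, the algorithm above outputs, with probability at least $1-\delta$, an $\varepsilon$-optimal policy for the Block MDP, and it always uses at most $P(|\mathcal S|,|\mathcal A|,H,1/\varepsilon,\log(1/\delta))$ trajectories. In particular there is no dependence on the size of $\mathcal X$. -/

import Mathlib

open MeasureTheory Filter Topology
open scoped ENNReal

noncomputable section

namespace BlockMDP

/-! ### Markov decision processes, policies, trajectories -/

/-- A finite-horizon MDP with levels `0, …, H` (actions are taken at levels `0, …, H - 1`),
level-dependent transition probabilities, deterministic rewards in `[0, 1]` and a fixed initial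
state. -/
structure MDP (S A : Type) (H : ℕ) where
  init : S
  p : Fin H → S → A → PMF S
  r : Fin H → S → A → ℝ
  r_mem : ∀ h s a, r h s a ∈ Set.Icc (0 : ℝ) 1

/-- A Block MDP: an MDP on the latent states together with emission distributions `q s` on the
observation space `X`. The blocks are the fibres `f ⁻¹' {s}` of the true decoding function `f`;
they partition `X`, and `q s` is carried by the block of `s`. (Blocks and emissions are the same at
all levels, so the true decoding function of every level is `f`.) -/
structure BMDP (S A X : Type) [MeasurableSpace S] [MeasurableSpace X] (H : ℕ)
    extends MDP S A H where
  q : S → Measure X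
  q_prob : ∀ s, IsProbabilityMeasure (q s)
  f : X → S
  measurable_f : Measurable f
  q_block : ∀ s, q s (f ⁻¹' {s}) = 1

/-- An MDP is a Block MDP whose observations are the states themselves. -/
def MDP.toBMDP {S A : Type} [MeasurableSpace S] [DiscreteMeasurableSpace S] {H : ℕ}
    (M : MDP S A H) : BMDP S A S H where
  toMDP := M
  q s := Measure.dirac s
  q_prob _ := inferInstance
  f := id
  measurable_f := measurable_id
  q_block s := by simp

/-- A (randomized, memoryless, level-dependent) policy on an observation space `X`. -/
structure Policy (X A : Type) [MeasurableSpace X] (H : ℕ) where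
  act : Fin H → X → PMF A
  measurable_act : ∀ h a, Measurable fun x => act h x a

/-- What the agent sees in an episode: observations at levels `0, …, H`, and the actions taken and
the rewards received at levels `0, …, H - 1`. -/
abbrev Trajectory (X A : Type) (H : ℕ) : Type :=
  (Fin (H + 1) → X) × (Fin H → A) × (Fin H → ℝ)

section Semantics

variable {S A X : Type} [Fintype S] [MeasurableSpace S] [Fintype A] [MeasurableSpace A]
  [MeasurableSpace X] {H : ℕ}

open Classical in
/-- The law of the trajectory of an episode in which the policy `φ` is followed: the latent states
`s`, the observations `x` and the actions `a` have the joint law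
`1[s₀ = init] ∏ₕ q(dxₕ | sₕ) ∏ₕ φ(aₕ | h, xₕ) ∏ₕ pₕ(sₕ₊₁ | sₕ, aₕ)`,
and the states are then summed out. -/
def BMDP.trajLaw (M : BMDP S A X H) (φ : Policy X A H) : Measure (Trajectory X A H) :=
  ∑ s : Fin (H + 1) → S, ∑ a : Fin H → A,
    (if s 0 = M.init then ∏ h : Fin H, M.p h (s h.castSucc) (a h) (s h.succ) else 0) •
      ((Measure.pi fun h => M.q (s h)).withDensity
        fun x => ∏ h : Fin H, φ.act h (x h.castSucc) (a h)).map
          fun x => (x, a, fun h => M.r h (s h.castSucc) (a h))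

/-- The value of a policy: its expected total reward. -/
def BMDP.value (M : BMDP S A X H) (φ : Policy X A H) : ℝ :=
  ∫ τ, ∑ h, τ.2.2 h ∂(M.trajLaw φ)

/-- `φ` is `ε`-optimal: no policy has a value exceeding that of `φ` by more than `ε`. -/
def BMDP.IsEpsOptimal (M : BMDP S A X H) (ε : ℝ) (φ : Policy X A H) : Prop :=
  ∀ ψ : Policy X A H, M.value ψ ≤ M.value φ + ε

/-- The law of a trajectory obtained by drawing a policy uniformly from the list `Φ` and then
following it for an episode. -/
def BMDP.unifLaw (M : BMDP S A X H) (Φ : List (Policy X A H)) : Measure (Trajectory X A H) :=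
  (Φ.length : ℝ≥0∞)⁻¹ • (Φ.map M.trajLaw).sum

end Semantics

/-! ### Procedures that interact with an unknown environment -/

/-- The seeds that supply internal randomness are uniform on `[0, 1]`. -/
abbrev Seed : Type := unitInterval

/-- A procedure with result in `R` that can draw `n` independent seeds, and that can generate `n`
independent trajectories of the environment, each with a policy drawn uniformly from a
nonempty list. The environment is accessible through these trajectories only. -/
inductive Interaction (X A : Type) [MeasurableSpace X] (H : ℕ) (R : Type) : Type
  | done (result : R) : Interaction X A H R
  | draw (n : ℕ) (next : (Fin n → Seed) → Interaction X A H R) : Interaction X A H R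
  | play (Φ : List (Policy X A H)) (nonempty : Φ ≠ []) (n : ℕ)
      (next : (Fin n → Trajectory X A H) → Interaction X A H R) : Interaction X A H R

namespace Interaction

variable {S A X : Type} [MeasurableSpace X] {H : ℕ} {R Q : Type}

/-- Sequential composition. -/
def andThen : Interaction X A H R → (R → Interaction X A H Q) → Interaction X A H Q
  | done r, k => k r
  | draw n next, k => draw n fun ω => (next ω).andThen k
  | play Φ hΦ n next, k => play Φ hΦ n fun τ => (next τ).andThen k

instance : Monad (Interaction X A H) where
  pure := done
  bind := andThen

/-- Draw `n` seeds. -/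
def seeds (n : ℕ) : Interaction X A H (Fin n → Seed) := draw n done

/-- Generate `n` trajectories with a policy drawn uniformly from `φ :: Φ` for each of them. -/
def sampleUnif (φ : Policy X A H) (Φ : List (Policy X A H)) (n : ℕ) :
    Interaction X A H (Fin n → Trajectory X A H) :=
  play (φ :: Φ) (List.cons_ne_nil φ Φ) n done

/-- Generate `n` trajectories with the policy `φ`. -/
def sample (φ : Policy X A H) (n : ℕ) : Interaction X A H (Fin n → Trajectory X A H) :=
  sampleUnif φ [] n

/-- Carry out `n` procedures one after the other and collect the results. -/
def collect : (n : ℕ) → (Fin n → Interaction X A H R) → Interaction X A H (Fin n → R)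
  | 0, _ => pure Fin.elim0
  | n + 1, c => do
      let v ← collect n fun i => c i.castSucc
      let y ← c (Fin.last n)
      pure (Fin.snoc (α := fun _ => R) v y)

open Classical in
/-- The probability that a procedure, carried out in the environment `M`, has its result in `E`. -/
def prob [Fintype S] [MeasurableSpace S] [Fintype A] [MeasurableSpace A] (M : BMDP S A X H)
    (E : Set R) : Interaction X A H R → ℝ≥0∞
  | done r => if r ∈ E then 1 else 0
  | draw n next => ∫⁻ ω : Fin n → Seed, prob M E (next ω)
  | play Φ _ n next => ∫⁻ τ, prob M E (next τ) ∂(Measure.pi fun _ : Fin n => M.unifLaw Φ)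

/-- The procedure never generates more than `T` trajectories. -/
def UsesAtMost : Interaction X A H R → ℕ → Prop
  | done _, _ => True
  | draw _ next, T => ∀ ω, (next ω).UsesAtMost T
  | play _ _ n next, T => n ≤ T ∧ ∀ τ, (next τ).UsesAtMost (T - n)

end Interaction

/-! ### The two components: tabular RL algorithm and unsupervised learning oracle -/

/-- An episodic tabular RL algorithm. It runs for `K` episodes; `propose k ω τ` is the policy that
it proposes after having received the `k` trajectories `τ`, where `ω` is its internal randomness.
The policy proposed after all `K` episodes is its output. -/
structure TabularAlg (S A : Type) [MeasurableSpace S] [MeasurableSpace A] (H : ℕ) where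
  K : ℕ
  propose : (k : ℕ) → Seed → (Fin k → Trajectory S A H) → Policy S A H
  measurable_propose : ∀ k h s a,
    Measurable fun z : Seed × (Fin k → Trajectory S A H) => (propose k z.1 z.2).act h s a

namespace TabularAlg

variable {S A : Type} [MeasurableSpace S] [MeasurableSpace A] {H : ℕ}

/-- The first `k` episodes of the algorithm. -/
def episodes (𝒜 : TabularAlg S A H) (ω : Seed) :
    (k : ℕ) → Interaction S A H (Fin k → Trajectory S A H)
  | 0 => pure Fin.elim0
  | k + 1 => do
      let past ← 𝒜.episodes ω k
      let τ ← Interaction.sample (𝒜.propose k ω past) 1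
      pure (Fin.snoc (α := fun _ => Trajectory S A H) past (τ 0))

/-- A complete run of the algorithm; the result is its output policy. -/
def run (𝒜 : TabularAlg S A H) : Interaction S A H (Policy S A H) := do
  let ω ← Interaction.seeds 1
  let past ← 𝒜.episodes (ω 0) 𝒜.K
  pure (𝒜.propose 𝒜.K (ω 0) past)

/-- On every MDP (with every initial state), the algorithm outputs an `ε`-optimal policy with
probability at least `1 - δ`. -/
def IsCorrect [Fintype S] [DiscreteMeasurableSpace S] [Fintype A] (𝒜 : TabularAlg S A H)
    (ε δ : ℝ) : Prop :=
  ∀ M : MDP S A H,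
    ENNReal.ofReal (1 - δ) ≤ 𝒜.run.prob M.toBMDP {π | M.toBMDP.IsEpsOptimal ε π}

end TabularAlg

/-- An unsupervised learning procedure: `learn δ n ω D` is the decoding function that it returns
for the confidence parameter `δ` and the `n` observations `D`, where `ω` is its internal
randomness. -/
structure Learner (S X : Type) [MeasurableSpace S] [MeasurableSpace X] where
  learn : ℝ → (n : ℕ) → Seed → (Fin n → X) → X → S
  measurable_learn : ∀ δ n,
    Measurable fun z : Seed × (Fin n → X) × X => learn δ n z.1 z.2.1 z.2.2

/-- The unsupervised learning oracle property with error function `g`, for the emission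
distributions `q`: `g n δ → 0` as `n → ∞`, and for every distribution `μ` on the states, from `n`
independent samples of `∑ₛ μ(s) q(· | s)`, with probability at least `1 - δ` the learner finds a
decoding function `f̂` with `ℙ_{s ∼ μ, x ∼ q(· | s)} (f̂(x) = α(s)) ≥ 1 - g n δ` for some
permutation `α`. -/
def Learner.IsOracle {S X : Type} [Fintype S] [MeasurableSpace S] [MeasurableSpace X]
    (U : Learner S X) (q : S → Measure X) (g : ℕ → ℝ → ℝ) : Prop :=
  ∀ δ : ℝ, 0 < δ → δ < 1 →
    Tendsto (fun n => g n δ) atTop (𝓝 0) ∧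
    ∀ (n : ℕ) (μ : PMF S),
      ENNReal.ofReal (1 - δ) ≤
        ((volume : Measure Seed).prod (Measure.pi fun _ : Fin n => ∑ s, μ s • q s))
          {z | ∃ α : Equiv.Perm S,
            ENNReal.ofReal (1 - g n δ) ≤ ∑ s, μ s * q s {x | U.learn δ n z.1 z.2 x = α s}}

/-- `g⁻¹(ϵ, δ) = min {N | g n δ < ϵ for all n > N}`. -/
def gInv (g : ℕ → ℝ → ℝ) (ϵ δ : ℝ) : ℕ := sInf {N : ℕ | ∀ n, N < n → g n δ < ϵ}

/-! ### The algorithm -/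

/-- A decoding function for one level. -/
abbrev Decoder (S X : Type) [MeasurableSpace S] [MeasurableSpace X] : Type :=
  {f : X → S // Measurable f}

/-- The internal parameters: batch size `B`, accuracy `ϵ` and confidence `δ₁` of the trajectory
sampling routine, and the failure probability `δ₂` with which the tabular algorithm is called. -/
structure Params where
  B : ℕ
  ϵ : ℝ
  δ₁ : ℝ
  δ₂ : ℝ

/-- The parameters are in their admissible ranges. -/
def Params.Valid (c : Params) : Prop :=
  0 < c.B ∧ c.ϵ ∈ Set.Ioo (0 : ℝ) 1 ∧ c.δ₁ ∈ Set.Ioo (0 : ℝ) 1 ∧ c.δ₂ ∈ Set.Ioo (0 : ℝ) 1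

/-- A data set of observations, as a batch `points` and the set `kept` of the indices of those
members of the batch that belong to the data set (so repeated observations count repeatedly). -/
structure DataSet (X : Type) (B : ℕ) where
  points : Fin B → X
  kept : Finset (Fin B)

/-- The label standard data: for each level and label, a data set if the label is confirmed. -/
abbrev Standard (S X : Type) (H B : ℕ) : Type := Fin (H + 1) → S → Option (DataSet X B)

/-- What the trajectory sampling routine keeps in memory between iterations and calls: the policies
`Π` generated so far, the label standard data `𝒵` and the present decoding functions. -/
structure Memory (S A X : Type) [MeasurableSpace S] [MeasurableSpace X] (H B : ℕ) where
  policies : List (Policy X A H)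
  standard : Standard S X H B
  decoders : Fin (H + 1) → Decoder S X

section Algorithm

variable {S A X : Type} [Fintype S] [MeasurableSpace S] [DiscreteMeasurableSpace S]
  [MeasurableSpace A] [MeasurableSpace X] {H : ℕ}

/-- The policy `π ∘ f`: decode the observation with `f`, then act as `π`. -/
def Policy.comp (π : Policy S A H) (f : Fin (H + 1) → Decoder S X) : Policy X A H where
  act h x := π.act h ((f h.castSucc).1 x)
  measurable_act h a := (π.measurable_act h a).comp (f h.castSucc).2

/-- The trajectory on the latent states obtained from an observed one by decoding. -/
def decode (f : Fin (H + 1) → Decoder S X) (τ : Trajectory X A H) : Trajectory S A H :=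
  (fun h => (f h).1 (τ.1 h), τ.2)

/-- The decoding function returned by the learner. -/
def Learner.decoder (U : Learner S X) (δ : ℝ) (n : ℕ) (ω : Seed) (D : Fin n → X) : Decoder S X :=
  ⟨U.learn δ n ω D, (U.measurable_learn δ n).comp
    (measurable_const.prodMk (measurable_const.prodMk measurable_id))⟩

open Classical in
/-- Swap the labels `s` and `s'` in the output of `f`. -/
def swapLabels (s s' : S) (f : Decoder S X) : Decoder S X :=
  ⟨fun x => Equiv.swap s s' (f.1 x), (Measurable.of_discrete (f := Equiv.swap s s')).comp f.2⟩

open Classical in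
/-- More than `3/5` of the points of the data set `D` are mapped to `s'` by `f`. -/
def IsMajority {B : ℕ} (f : Decoder S X) (D : DataSet X B) (s' : S) : Prop :=
  (3 / 5 : ℝ) * D.kept.card < ((D.kept.filter fun j => f.1 (D.points j) = s').card : ℝ)

open Classical in
/-- Match the label `s` of `f` against the standard data set of this label, if there is one. -/
def fixOne {B : ℕ} (Z : S → Option (DataSet X B)) (f : Decoder S X) (s : S) : Decoder S X :=
  match Z s with
  | none => f
  | some D => if hs : ∃ s', IsMajority f D s' then swapLabels s hs.choose f else f

/-- `FixLabel`: at every level, go through the confirmed labels (in an arbitrary order) and match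
them one after the other. -/
def fixLabel {B : ℕ} (f : Fin (H + 1) → Decoder S X) (Z : Standard S X H B) :
    Fin (H + 1) → Decoder S X :=
  fun h => (Finset.univ : Finset S).toList.foldl (fixOne (Z h)) (f h)

open Classical in
/-- The update of the label standard data with the test data `D` and the decoding functions `f`:
a label `s` that is not yet confirmed at level `h` is confirmed if at least
`3 ϵ B log(1/δ₁)` of the test observations at level `h` are decoded to `s`. -/
def updateStandard (c : Params) (f : Fin (H + 1) → Decoder S X) (D : Fin c.B → Trajectory X A H)
    (Z : Standard S X H c.B) : Standard S X H c.B := fun h s =>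
  let Dhs : DataSet X c.B :=
    ⟨fun j => (D j).1 h, Finset.univ.filter fun j => (f h).1 ((D j).1 h) = s⟩
  match Z h s with
  | some D' => some D'
  | none => if 3 * c.ϵ * c.B * Real.log (c.δ₁⁻¹) ≤ (Dhs.kept.card : ℝ) then some Dhs else none

/-- The number `J = (H + 1) |S| + 1` of iterations of the trajectory sampling routine. -/
def numIter (S : Type) [Fintype S] (H : ℕ) : ℕ := (H + 1) * Fintype.card S + 1

/-- Iteration `i + 1` of the trajectory sampling routine in episode `k + 1`. -/
def tsrStep (c : Params) (U : Learner S X) (k i : ℕ) (π : Policy S A H)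
    (m : Memory S A X H c.B) : Interaction X A H (Memory S A X H c.B) := do
  let φ : Policy X A H := π.comp m.decoders
  let D ← Interaction.sampleUnif φ m.policies ((k * numIter S H + (i + 1)) * c.B)
  let D'' ← Interaction.sample φ c.B
  let ω ← Interaction.seeds (H + 1)
  let f : Fin (H + 1) → Decoder S X :=
    fixLabel (fun h => U.decoder c.δ₁ _ (ω h) fun j => (D j).1 h) m.standard
  pure ⟨φ :: m.policies, updateStandard c f D'' m.standard, f⟩

/-- The first `j` iterations of the trajectory sampling routine in episode `k + 1`. -/
def tsrLoop (c : Params) (U : Learner S X) (k : ℕ) (π : Policy S A H)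
    (m : Memory S A X H c.B) : ℕ → Interaction X A H (Memory S A X H c.B)
  | 0 => pure m
  | j + 1 => do
      let m' ← tsrLoop c U k π m j
      tsrStep c U k j π m'

/-- The trajectory sampling routine `TSR` in episode `k + 1`: after `J` iterations, run `π ∘ f` with
the decoding functions `f` obtained, and return the decoded trajectory. -/
def tsr (c : Params) (U : Learner S X) (k : ℕ) (π : Policy S A H) (m : Memory S A X H c.B) :
    Interaction X A H (Trajectory S A H × Memory S A X H c.B) := do
  let m' ← tsrLoop c U k π m (numIter S H)
  let τ ← Interaction.sample (π.comp m'.decoders) 1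
  pure (decode m'.decoders (τ 0), m')

/-- The first `k` episodes of an outer iteration: the tabular algorithm proposes policies and
receives the trajectories produced by `TSR`. At the beginning there are no policies in `Π`, no
confirmed labels, and some initial decoding functions `f₀`. -/
def simEpisodes (c : Params) (U : Learner S X) (𝒜 : TabularAlg S A H)
    (f₀ : Fin (H + 1) → Decoder S X) (ω : Seed) :
    (k : ℕ) → Interaction X A H ((Fin k → Trajectory S A H) × Memory S A X H c.B)
  | 0 => pure (Fin.elim0, ⟨[], fun _ _ => none, f₀⟩)
  | k + 1 => do
      let (past, m) ← simEpisodes c U 𝒜 f₀ ω k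
      let (τ, m') ← tsr c U k (𝒜.propose k ω past) m
      pure (Fin.snoc (α := fun _ => Trajectory S A H) past τ, m')

/-- An outer iteration: simulate the tabular algorithm from a fresh start, take its output policy,
finalize the decoding functions with a last call of `TSR`, and compose. -/
def outerIter (c : Params) (U : Learner S X) (𝒜 : TabularAlg S A H)
    (f₀ : Fin (H + 1) → Decoder S X) : Interaction X A H (Policy X A H) := do
  let ω ← Interaction.seeds 1
  let (past, m) ← simEpisodes c U 𝒜 f₀ (ω 0) 𝒜.K
  let π : Policy S A H := 𝒜.propose 𝒜.K (ω 0) past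
  let (_, m') ← tsr c U 𝒜.K π m
  pure (π.comp m'.decoders)

/-- Run `φ` for `L` episodes and return the average total reward per episode. -/
def evaluate (φ : Policy X A H) (L : ℕ) : Interaction X A H ℝ := do
  let τ ← Interaction.sample φ L
  pure ((∑ j, ∑ h, (τ j).2.2 h) / L)

/-- The number `N = ⌈log(2/δ)/2⌉` of outer iterations. -/
def numOuter (δ : ℝ) : ℕ := ⌈Real.log (2 / δ) / 2⌉₊

/-- The number `L = ⌈9H²/(2ε²) log(2N/δ)⌉` of evaluation episodes. -/
def numEval (H : ℕ) (ε δ : ℝ) : ℕ :=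
  ⌈9 * (H : ℝ) ^ 2 / (2 * ε ^ 2) * Real.log (2 * numOuter δ / δ)⌉₊

/-- The unified framework. The tabular algorithm is called with accuracy `ε / 4` and failure
probability `δ₂`. The result is the set of the policies with the best empirical value among the `N`
candidates; any of them may be output. -/
def framework (c : Params) (U : Learner S X) (𝒜 : ℝ → ℝ → TabularAlg S A H)
    (f₀ : Fin (H + 1) → Decoder S X) (ε δ : ℝ) : Interaction X A H (Set (Policy X A H)) := do
  let φ ← Interaction.collect (numOuter δ) fun _ => outerIter c U (𝒜 (ε / 4) c.δ₂) f₀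
  let V ← Interaction.collect (numOuter δ) fun n => evaluate (φ n) (numEval H ε δ)
  pure {ψ | ∃ n, ψ = φ n ∧ ∀ n', V n' ≤ V n}

end Algorithm

end BlockMDP

end

set_option linter.unusedSectionVars false

noncomputable section

namespace BlockMDP

/-! ### Product measures, Hoeffding bounds, mixtures -/

section Probability

open ProbabilityTheory

/-! Notation: θ = `c.threshold` = 3ϵ log(1/δ₁), k = |S|, and T bounds the number of iterations of
the sampling routine in one outer iteration, hence also the size of Π.

Decoding. The observations of a level under any policy or list of policies follow a mixture of the
emission laws (`BMDP.isMixture_unifLaw`), so the oracle applies to the training data. Accuracy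
θ²/(20T) for the uniform mixture of at most T policies gives error θ²/20 under each single one.
Hence a state that some listed policy visits with probability at least θ/2 is decoded to one fixed
label up to probability θ/10 (`GoodStep.error_le`). Nothing is claimed about rarely visited states.

Labels. Each oracle call names the states anew, and a majority vote on the standard data sets
restores the names. The delicate point is that a data set is reused while the later mixtures have
been chosen depending on it, and the oracle's guarantee concerns the emission laws and not these
particular points. The method of types resolves this: the laws of n samples from all mixtures are
dominated by one finite measure of mass at most (n+1)^k (`universalLaw`). Tonelli, Hoeffding and
Markov then show that fresh test points are likely to be good for all mixtures simultaneously
(`GoodPoints`, `measure_not_goodPoints_le`); the batch size is such that exp(-Bθ²/200) beats the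
polynomial of degree k.

Progress. A good iteration confirms a new label, or else the current policy is unlikely to meet a
state with an unconfirmed label (`Invariant.step`). There are only (H+1)k labels, so J iterations
suffice by the pigeonhole principle (`Adequate.le_prob_tsrLoop_numIter`).

Simulation. Up to probability of order Hkθ, a decoded trajectory is one of the latent MDP with its
states renamed by permutations α. The confirmed labels determine α only partially, and depend on the
history. Therefore all α that match the confirmed labels are followed at once: `potential` subtracts
the conditional failure probabilities of the tabular algorithm on all these relabelled MDPs, and
does not decrease in expectation (`Adequate.potential_le_expect_tsr`). This union bound over
(k!)^(H+1) MDPs is paid for by δ₂, at a polynomial cost in log(1/δ₂).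

Conclusion. An outer iteration succeeds with probability at least 9/10 (`Adequate.le_prob_outerIter`
with `Params.Tuned.outerFailure_le`); repetition and empirical evaluation give confidence 1-δ
(`le_prob_framework`). The parameters are fixed without circularity in the order δ₂, the bound on K,
T, then θ and δ₁, the oracle's sample size, and last B = b².

Measurability. Functions of the result of a procedure need not be measurable, so
`Interaction.expect` is an iterated lower integral. Only lower bounds and superadditivity are used
for it; trajectory laws of finite MDPs have finite support, which supplies measurability where
equalities are needed. -/

theorem lintegral_pi_prod {ι : Type*} [Fintype ι] {Ω : ι → Type*} [∀ i, MeasurableSpace (Ω i)]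
    (μ : ∀ i, Measure (Ω i)) [∀ i, IsProbabilityMeasure (μ i)] (f : ∀ i, Ω i → ℝ≥0∞)
    (hf : ∀ i, Measurable (f i)) :
    ∫⁻ x, ∏ i, f i (x i) ∂(Measure.pi μ) = ∏ i, ∫⁻ x, f i x ∂(μ i) := by
  have h := lintegral_prod_eq_prod_lintegral_of_indepFun Finset.univ
    (fun i (x : ∀ i, Ω i) => f i (x i)) (iIndepFun_pi (μ := μ) fun i => (hf i).aemeasurable)
    fun i => (hf i).comp (measurable_pi_apply i)
  rw [h]
  refine Finset.prod_congr rfl fun i _ => ?_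
  rw [← (measurePreserving_eval μ i).lintegral_comp (hf i)]

theorem hoeffding_ge {Y : Type*} [MeasurableSpace Y] (ν : Measure Y) [IsProbabilityMeasure ν]
    {f : Y → ℝ} (hf : Measurable f) {a b : ℝ} (hb : ∀ᵐ y ∂ν, f y ∈ Set.Icc a b) (n : ℕ) {t : ℝ}
    (ht : 0 ≤ t) :
    (Measure.pi fun _ : Fin n => ν) {y | n * (∫ y, f y ∂ν) + n * t ≤ ∑ j, f (y j)} ≤
      ENNReal.ofReal (Real.exp (-(2 * n * t ^ 2 / (b - a) ^ 2))) := by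
  have hind : iIndepFun (fun (j : Fin n) (y : Fin n → Y) => f (y j) - ∫ y, f y ∂ν)
      (Measure.pi fun _ : Fin n => ν) :=
    iIndepFun_pi (X := fun _ y => f y - ∫ y, f y ∂ν) fun _ => (hf.sub_const _).aemeasurable
  have hsub : ∀ j : Fin n, HasSubgaussianMGF (fun y : Fin n → Y => f (y j) - ∫ y, f y ∂ν)
      ((‖b - a‖₊ / 2) ^ 2) (Measure.pi fun _ : Fin n => ν) := by
    intro j
    have h := hasSubgaussianMGF_of_mem_Icc hf.aemeasurable hb
    have hmp := measurePreserving_eval (fun _ : Fin n => ν) j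
    have h2 : HasSubgaussianMGF (fun y => f y - ∫ y, f y ∂ν) ((‖b - a‖₊ / 2) ^ 2)
      ((Measure.pi fun _ : Fin n => ν).map (Function.eval j)) := by rw [hmp.map_eq]; exact h
    exact HasSubgaussianMGF.of_map hmp.measurable.aemeasurable h2
  have key := HasSubgaussianMGF.measure_sum_ge_le_of_iIndepFun hind (s := Finset.univ)
    (fun j _ => hsub j) (ε := n * t) (by positivity)
  rw [Measure.real, ← ENNReal.le_ofReal_iff_toReal_le (measure_ne_top _ _) (Real.exp_nonneg _)] at key
  refine le_trans (measure_mono ?_) (key.trans (ENNReal.ofReal_le_ofReal ?_))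
  · intro y hy
    simp only [Set.mem_ofPred_eq, Finset.sum_sub_distrib, Finset.sum_const, Finset.card_univ,
      Fintype.card_fin, nsmul_eq_mul] at hy ⊢
    linarith
  · apply Real.exp_le_exp.2
    simp only [Finset.sum_const, Finset.card_univ, Fintype.card_fin, nsmul_eq_mul]
    push_cast
    rw [Real.norm_eq_abs, div_pow, sq_abs]
    apply le_of_eq
    -- If n = 0 or a = b, both exponents are 0 by the convention for division by zero, and the bound
    -- is trivial.
    rcases Nat.eq_zero_or_pos n with rfl | hn
    · simp
    by_cases hab : b - a = 0
    · simp [hab]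
    have : (n : ℝ) ≠ 0 := by positivity
    field_simp

theorem hoeffding_le {Y : Type*} [MeasurableSpace Y] (ν : Measure Y) [IsProbabilityMeasure ν]
    {f : Y → ℝ} (hf : Measurable f) {a b : ℝ} (hb : ∀ᵐ y ∂ν, f y ∈ Set.Icc a b) (n : ℕ) {t : ℝ}
    (ht : 0 ≤ t) :
    (Measure.pi fun _ : Fin n => ν) {y | ∑ j, f (y j) ≤ n * (∫ y, f y ∂ν) - n * t} ≤
      ENNReal.ofReal (Real.exp (-(2 * n * t ^ 2 / (b - a) ^ 2))) := by
  have h := hoeffding_ge ν hf.neg (a := -b) (b := -a)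
    (by filter_upwards [hb] with y hy; exact ⟨neg_le_neg hy.2, neg_le_neg hy.1⟩) n ht
  have e : (-a - -b) ^ 2 = (b - a) ^ 2 := by ring
  rw [e] at h
  refine le_trans (measure_mono ?_) h
  intro y hy
  simp only [Set.mem_ofPred_eq, Pi.neg_apply, integral_neg, Finset.sum_neg_distrib] at hy ⊢
  linarith

open Classical in
theorem sum_indicator_eq_card {Y : Type*} {n : ℕ} (E : Set Y) (y : Fin n → Y) :
    ∑ j, E.indicator (fun _ => (1 : ℝ)) (y j) =
      ((Finset.univ.filter fun j => y j ∈ E).card : ℝ) := by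
  simp [Set.indicator_apply]

open Classical in
theorem hoeffding_card_ge {Y : Type*} [MeasurableSpace Y] (ν : Measure Y) [IsProbabilityMeasure ν]
    {E : Set Y} (hE : MeasurableSet E) (n : ℕ) {p u t : ℝ} (ht : 0 ≤ t)
    (hp : ν E ≤ ENNReal.ofReal p) (hp0 : 0 ≤ p) (hu : p + t ≤ u) :
    (Measure.pi fun _ : Fin n => ν)
        {y | n * u ≤ ((Finset.univ.filter fun j => y j ∈ E).card : ℝ)} ≤
      ENNReal.ofReal (Real.exp (-(2 * n * t ^ 2))) := by
  have h := hoeffding_ge ν (f := E.indicator fun _ => (1 : ℝ)) (a := 0) (b := 1)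
    (measurable_const.indicator hE)
    (ae_of_all _ fun y => by by_cases hy : y ∈ E <;> simp [hy]) n ht
  rw [integral_indicator hE] at h
  simp only [sum_indicator_eq_card, integral_const, smul_eq_mul, mul_one, sub_zero, one_pow,
    div_one, MeasurableSet.univ, measureReal_restrict_apply, Set.univ_inter] at h
  refine le_trans (measure_mono fun y hy => ?_) h
  simp only [Set.mem_ofPred_eq] at hy ⊢
  have : ν.real E ≤ p := ENNReal.toReal_le_of_le_ofReal hp0 hp
  refine le_trans ?_ hy
  rw [← mul_add]
  gcongr
  linarith

open Classical in
theorem hoeffding_card_le {Y : Type*} [MeasurableSpace Y] (ν : Measure Y) [IsProbabilityMeasure ν]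
    {E : Set Y} (hE : MeasurableSet E) (n : ℕ) {p u t : ℝ} (ht : 0 ≤ t)
    (hp : ENNReal.ofReal p ≤ ν E) (hu : u ≤ p - t) :
    (Measure.pi fun _ : Fin n => ν)
        {y | ((Finset.univ.filter fun j => y j ∈ E).card : ℝ) ≤ n * u} ≤
      ENNReal.ofReal (Real.exp (-(2 * n * t ^ 2))) := by
  have h := hoeffding_le ν (f := E.indicator fun _ => (1 : ℝ)) (a := 0) (b := 1)
    (measurable_const.indicator hE)
    (ae_of_all _ fun y => by by_cases hy : y ∈ E <;> simp [hy]) n ht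
  rw [integral_indicator hE] at h
  simp only [sum_indicator_eq_card, integral_const, smul_eq_mul, mul_one, sub_zero, one_pow,
    div_one, MeasurableSet.univ, measureReal_restrict_apply, Set.univ_inter] at h
  refine le_trans (measure_mono fun y hy => ?_) h
  simp only [Set.mem_ofPred_eq] at hy ⊢
  have : p ≤ ν.real E := (ENNReal.ofReal_le_iff_le_toReal (measure_ne_top _ _)).1 hp
  refine le_trans hy ?_
  rw [← mul_sub]
  gcongr
  linarith

variable {S X : Type*} [Fintype S] [MeasurableSpace X]

theorem pi_mixture (q : S → Measure X) [∀ s, IsProbabilityMeasure (q s)] (n : ℕ) (μ : S → ℝ≥0∞)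
    (hμ : ∑ s, μ s = 1) :
    Measure.pi (fun _ : Fin n => ∑ s, μ s • q s) =
      ∑ s : Fin n → S, (∏ j, μ (s j)) • Measure.pi fun j => q (s j) := by
  have : IsProbabilityMeasure (∑ s, μ s • q s) := ⟨by simp [hμ]⟩
  classical
  refine Measure.pi_eq fun E _ => ?_
  simp only [Measure.coe_finsetSum, Finset.sum_apply, Measure.smul_apply, Measure.pi_pi,
    smul_eq_mul]
  rw [Finset.prod_univ_sum, Fintype.piFinset_univ]
  exact Finset.sum_congr rfl fun s _ => by rw [Finset.prod_mul_distrib]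

open Classical in
/-- The sequences with the same empirical distribution as `s`. -/
def typeClass {n : ℕ} (s : Fin n → S) : Finset (Fin n → S) :=
  Finset.univ.filter fun s' => ∀ x, (Finset.univ.filter fun j => s' j = x).card =
    (Finset.univ.filter fun j => s j = x).card

/-- A finite measure that dominates the laws of `n` independent samples of all mixtures of `q`. -/
def universalLaw (q : S → Measure X) (n : ℕ) : Measure (Fin n → X) :=
  ∑ s : Fin n → S, ((typeClass s).card : ℝ≥0∞)⁻¹ • Measure.pi fun j => q (s j)

/-- The product depends only on the empirical distribution of `s`, so it is constant on the type
class; the sum over all sequences is 1. -/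
theorem prod_le_inv_typeClass (n : ℕ) (μ : S → ℝ≥0∞) (hμ : ∑ s, μ s = 1) (s : Fin n → S) :
    ∏ j, μ (s j) ≤ ((typeClass s).card : ℝ≥0∞)⁻¹ := by
  classical
  have h1 : ∀ s' ∈ typeClass s, ∏ j, μ (s' j) = ∏ j, μ (s j) := by
    intro s' hs'
    rw [← Finset.prod_fiberwise' Finset.univ s' μ, ← Finset.prod_fiberwise' Finset.univ s μ]
    refine Finset.prod_congr rfl fun x _ => ?_
    simp only [typeClass, Finset.mem_filter, Finset.mem_univ, true_and] at hs'
    have := hs' x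
    rw [Finset.prod_const, Finset.prod_const]
    convert! rfl using 2
    convert! this.symm
  have h2 : ((typeClass s).card : ℝ≥0∞) * ∏ j, μ (s j) ≤ 1 := by
    calc ((typeClass s).card : ℝ≥0∞) * ∏ j, μ (s j) = ∑ s' ∈ typeClass s, ∏ j, μ (s' j) := by
          rw [Finset.sum_congr rfl h1, Finset.sum_const, nsmul_eq_mul]
      _ ≤ ∑ s' : Fin n → S, ∏ j, μ (s' j) :=
          Finset.sum_le_sum_of_subset (Finset.subset_univ _)
      _ = ∏ _j : Fin n, ∑ x, μ x := by
          rw [Finset.prod_univ_sum, Fintype.piFinset_univ]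
      _ = 1 := by simp [hμ]
  rw [ENNReal.le_inv_iff_mul_le, mul_comm]
  exact h2

/-- The right side does not involve the weights. An estimate for it therefore holds for weights that
have been chosen adaptively. -/
theorem pi_mixture_le_universalLaw (q : S → Measure X) [∀ s, IsProbabilityMeasure (q s)] (n : ℕ)
    (μ : S → ℝ≥0∞) (hμ : ∑ s, μ s = 1) :
    Measure.pi (fun _ : Fin n => ∑ s, μ s • q s) ≤ universalLaw q n := by
  rw [pi_mixture q n μ hμ, universalLaw]
  refine Finset.sum_le_sum fun s _ => ?_
  intro E
  simp only [Measure.smul_apply, smul_eq_mul]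
  gcongr
  exact prod_le_inv_typeClass n μ hμ s

/-- Each type class contributes mass 1, and a type is a vector of |S| counts between 0 and n. -/
theorem universalLaw_univ_le (q : S → Measure X) [∀ s, IsProbabilityMeasure (q s)] (n : ℕ) :
    universalLaw q n Set.univ ≤ ((n : ℝ≥0∞) + 1) ^ Fintype.card S := by
  classical
  let ty : (Fin n → S) → S → Fin (n + 1) := fun s x =>
    ⟨(Finset.univ.filter fun j => s j = x).card,
      Nat.lt_succ_of_le ((Finset.card_le_univ _).trans (by simp))⟩
  have hcls : ∀ s, typeClass s = Finset.univ.filter fun s' => ty s' = ty s := by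
    intro s; ext s'
    simp only [typeClass, Finset.mem_filter, Finset.mem_univ, true_and, ty, funext_iff,
      Fin.mk.injEq]
  simp only [universalLaw, Measure.coe_finsetSum, Finset.sum_apply, Measure.smul_apply,
    measure_univ, smul_eq_mul, mul_one]
  rw [← Finset.sum_fiberwise Finset.univ ty]
  calc _ ≤ ∑ _c : S → Fin (n + 1), (1 : ℝ≥0∞) := by
        refine Finset.sum_le_sum fun c _ => ?_
        have : ∀ s ∈ Finset.univ.filter (fun s => ty s = c), ((typeClass s).card : ℝ≥0∞)⁻¹ =
            ((Finset.univ.filter fun s => ty s = c).card : ℝ≥0∞)⁻¹ := by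
          intro s hs
          rw [hcls s, (Finset.mem_filter.1 hs).2]
        rw [Finset.sum_congr rfl this, Finset.sum_const, nsmul_eq_mul]
        exact ENNReal.mul_inv_le_one _
    _ = ((n : ℝ≥0∞) + 1) ^ Fintype.card S := by simp

instance (q : S → Measure X) [∀ s, IsProbabilityMeasure (q s)] (n : ℕ) :
    IsFiniteMeasure (universalLaw q n) :=
  ⟨(universalLaw_univ_le q n).trans_lt (by finiteness)⟩

theorem aemeasurable_of_finite_support {Y : Type*} [MeasurableSpace Y]
    [MeasurableSingletonClass Y] (μ : Measure Y) {F : Set Y} (hF : F.Finite)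
    (h : μ Fᶜ = 0) (u : Y → ℝ≥0∞) : AEMeasurable u μ := by
  classical
  refine ⟨F.indicator u, ?_, ?_⟩
  · refine (measurable_const (a := (0 : ℝ≥0∞))).measurable_of_countable_ne
      (hF.countable.mono fun y hy => ?_)
    by_contra hyF
    exact hy (by simp [hyF])
  · filter_upwards [compl_mem_ae_iff.2 h] with y hy
    rw [compl_compl] at hy
    simp [hy]

end Probability

/-! ### Path sums and the law of a trajectory -/

section PathSum

variable {S A : Type} [Fintype S] [Fintype A]

/-- The total weight of all paths, with weight `ι` of the first state, weights `w` of the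
transitions and weight `v` of the last state. -/
def pathSum {n : ℕ} (ι : S → ℝ≥0∞) (w : Fin n → S → A → S → ℝ≥0∞) (v : S → ℝ≥0∞) : ℝ≥0∞ :=
  ∑ s : Fin (n + 1) → S, ∑ a : Fin n → A,
    ι (s 0) * (∏ h, w h (s h.castSucc) (a h) (s h.succ)) * v (s (Fin.last n))

theorem pathSum_zero (ι : S → ℝ≥0∞) (w : Fin 0 → S → A → S → ℝ≥0∞) (v : S → ℝ≥0∞) :
    pathSum ι w v = ∑ s, ι s * v s := by
  simp only [pathSum, Finset.univ_eq_empty, Finset.prod_empty, mul_one, Fintype.sum_unique]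
  exact Fintype.sum_equiv (Equiv.funUnique (Fin 1) S) _ _ fun s => rfl

theorem pathSum_succ {n : ℕ} (ι : S → ℝ≥0∞) (w : Fin (n + 1) → S → A → S → ℝ≥0∞)
    (v : S → ℝ≥0∞) :
    pathSum ι w v =
      pathSum (fun s' => ∑ s, ∑ a, ι s * w 0 s a s') (fun h => w h.succ) v := by
  simp only [pathSum]
  rw [← (Fin.consEquiv fun _ : Fin (n + 2) => S).sum_comp, Fintype.sum_prod_type,
    Finset.sum_comm]
  refine Finset.sum_congr rfl fun s _ => ?_
  have h : ∀ x : S, (∑ a : Fin (n + 1) → A,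
      ι ((Fin.consEquiv fun _ : Fin (n + 2) => S) (x, s) 0) *
        (∏ h, w h ((Fin.consEquiv fun _ : Fin (n + 2) => S) (x, s) h.castSucc) (a h)
          ((Fin.consEquiv fun _ : Fin (n + 2) => S) (x, s) h.succ)) *
        v ((Fin.consEquiv fun _ : Fin (n + 2) => S) (x, s) (Fin.last (n + 1)))) =
      ∑ a : Fin n → A, ∑ a0 : A, ι x * w 0 x a0 (s 0) *
        ((∏ h : Fin n, w h.succ (s h.castSucc) (a h) (s h.succ)) * v (s (Fin.last n))) := by
    intro x
    rw [← (Fin.consEquiv fun _ : Fin (n + 1) => A).sum_comp, Fintype.sum_prod_type,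
      Finset.sum_comm]
    refine Finset.sum_congr rfl fun a _ => Finset.sum_congr rfl fun a0 _ => ?_
    rw [Fin.prod_univ_succ]
    simp only [Fin.consEquiv_apply, Fin.cons_zero, Fin.castSucc_zero, Fin.cons_succ,
      ← Fin.succ_castSucc, ← Fin.succ_last]
    ring
  rw [Finset.sum_congr rfl fun x _ => h x, Finset.sum_comm]
  refine Finset.sum_congr rfl fun a _ => ?_
  simp_rw [← Finset.sum_mul]
  ring

theorem pathSum_of_stochastic {n : ℕ} (ι : S → ℝ≥0∞) (w : Fin n → S → A → S → ℝ≥0∞)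
    (hw : ∀ h s, ∑ a, ∑ s', w h s a s' = 1) : pathSum ι w (fun _ => 1) = ∑ s, ι s := by
  induction n generalizing ι with
  | zero => simp [pathSum_zero]
  | succ n ih =>
    rw [pathSum_succ, ih _ _ fun h s => hw h.succ s, Finset.sum_comm]
    refine Finset.sum_congr rfl fun s _ => ?_
    rw [Finset.sum_comm]
    simp_rw [← Finset.mul_sum]
    rw [hw 0 s, mul_one]

/-- If the weights are stochastic except at one level, where the outgoing weight of the state `s`
is `e s`, then the path sum is the mean of `e` over the distribution of the state at this level. -/
theorem exists_level_weight {n : ℕ} (ι : S → ℝ≥0∞) (w : Fin n → S → A → S → ℝ≥0∞)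
    (hw : ∀ h s, ∑ a, ∑ s', w h s a s' = 1) (h₀ : Fin (n + 1)) :
    ∃ μ : S → ℝ≥0∞, ∀ (w' : Fin n → S → A → S → ℝ≥0∞) (v e : S → ℝ≥0∞),
      (∀ h : Fin n, h.castSucc ≠ h₀ → w' h = w h) →
      (∀ h : Fin n, h.castSucc = h₀ → ∀ s, ∑ a, ∑ s', w' h s a s' = e s) →
      (Fin.last n ≠ h₀ → v = fun _ => 1) → (Fin.last n = h₀ → v = e) →
      pathSum ι w' v = ∑ s, μ s * e s := by
  induction n generalizing ι with
  | zero =>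
    refine ⟨ι, fun w' v e _ _ _ h4 => ?_⟩
    rw [pathSum_zero, h4 (Subsingleton.elim (α := Fin 1) _ _)]
  | succ n ih =>
    refine Fin.cases ?_ (fun h₁ => ?_) h₀
    · refine ⟨ι, fun w' v e h1 h2 h3 _ => ?_⟩
      rw [pathSum_succ, h3 (by simp [Fin.ext_iff]),
        pathSum_of_stochastic _ _ fun h s => ?_, Finset.sum_comm]
      · refine Finset.sum_congr rfl fun s _ => ?_
        rw [Finset.sum_comm]
        simp_rw [← Finset.mul_sum]
        rw [h2 0 (by simp) s]
      · rw [h1 h.succ (Fin.succ_ne_zero h.castSucc)]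
        exact hw h.succ s
    · obtain ⟨μ, hμ⟩ := ih (fun s' => ∑ s, ∑ a, ι s * w 0 s a s') (fun h => w h.succ)
        (fun h s => hw h.succ s) h₁
      refine ⟨μ, fun w' v e h1 h2 h3 h4 => ?_⟩
      rw [pathSum_succ, h1 0 (Fin.succ_ne_zero h₁).symm]
      refine hμ _ v e (fun h hh => h1 h.succ ?_) (fun h hh => h2 h.succ ?_) (fun hh => h3 ?_)
        fun hh => h4 ?_
      · rw [← Fin.succ_castSucc]; exact fun hc => hh (Fin.succ_injective _ hc)
      · rw [← Fin.succ_castSucc, hh]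
      · rw [← Fin.succ_last]; exact fun hc => hh (Fin.succ_injective _ hc)
      · rw [← Fin.succ_last, hh]

end PathSum

section Law

variable {S A X : Type} [Fintype S] [MeasurableSpace S] [Fintype A] [MeasurableSpace A]
  [MeasurableSpace X] {H : ℕ}

attribute [instance] BMDP.q_prob

open Classical in
/-- The weight of the latent part of a trajectory that is due to the environment. -/
def MDP.weight (M : MDP S A H) (s : Fin (H + 1) → S) (a : Fin H → A) : ℝ≥0∞ :=
  if s 0 = M.init then ∏ h : Fin H, M.p h (s h.castSucc) (a h) (s h.succ) else 0

/-- The rewards along a path of latent states and actions. -/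
def MDP.rewards (M : MDP S A H) (s : Fin (H + 1) → S) (a : Fin H → A) : Fin H → ℝ :=
  fun h => M.r h (s h.castSucc) (a h)

theorem Policy.measurable_prod_act (φ : Policy X A H) (a : Fin H → A) :
    Measurable fun x : Fin (H + 1) → X => ∏ h : Fin H, φ.act h (x h.castSucc) (a h) :=
  Finset.measurable_prod _ fun h _ => (φ.measurable_act h (a h)).comp (measurable_pi_apply _)

theorem measurable_trajectory_mk (a : Fin H → A) (r : Fin H → ℝ) :
    Measurable fun x : Fin (H + 1) → X => ((x, a, r) : Trajectory X A H) :=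
  measurable_id.prodMk measurable_const

theorem BMDP.trajLaw_apply (M : BMDP S A X H) (φ : Policy X A H) {E : Set (Trajectory X A H)}
    (hE : MeasurableSet E) :
    M.trajLaw φ E = ∑ s : Fin (H + 1) → S, ∑ a : Fin H → A, M.weight s a *
      ∫⁻ x, E.indicator (fun _ => 1) (x, a, M.rewards s a) *
        ∏ h : Fin H, φ.act h (x h.castSucc) (a h) ∂(Measure.pi fun h => M.q (s h)) := by
  simp only [BMDP.trajLaw, Measure.coe_finsetSum, Finset.sum_apply, Measure.smul_apply,
    smul_eq_mul, ← MDP.weight.eq_1]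
  refine Finset.sum_congr rfl fun s _ => Finset.sum_congr rfl fun a _ => ?_
  have hm := measurable_trajectory_mk (X := X) a (M.rewards s a)
  have e : (fun x : Fin (H + 1) → X => ((x, a, fun h => M.r h (s h.castSucc) (a h)) :
      Trajectory X A H)) = fun x => (x, a, M.rewards s a) := rfl
  rw [e, Measure.map_apply hm hE, withDensity_apply _ (hm hE), ← lintegral_indicator (hm hE)]
  congr 1
  refine lintegral_congr fun x => ?_
  by_cases hx : (x, a, M.rewards s a) ∈ E <;> simp [hx]

theorem BMDP.lintegral_trajLaw (M : BMDP S A X H) (φ : Policy X A H)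
    {F : Trajectory X A H → ℝ≥0∞} (hF : Measurable F) :
    ∫⁻ τ, F τ ∂(M.trajLaw φ) = ∑ s : Fin (H + 1) → S, ∑ a : Fin H → A, M.weight s a *
      ∫⁻ x, (∏ h : Fin H, φ.act h (x h.castSucc) (a h)) * F (x, a, M.rewards s a)
        ∂(Measure.pi fun h => M.q (s h)) := by
  simp only [BMDP.trajLaw, lintegral_finsetSum_measure, lintegral_smul_measure,
    smul_eq_mul, ← MDP.weight.eq_1]
  refine Finset.sum_congr rfl fun s _ => Finset.sum_congr rfl fun a _ => ?_
  have hm := measurable_trajectory_mk (X := X) a (M.rewards s a)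
  have e : (fun x : Fin (H + 1) → X => ((x, a, fun h => M.r h (s h.castSucc) (a h)) :
      Trajectory X A H)) = fun x => (x, a, M.rewards s a) := rfl
  have hFm : Measurable fun x : Fin (H + 1) → X => F (x, a, M.rewards s a) := hF.comp hm
  rw [e, lintegral_map hF hm, lintegral_withDensity_eq_lintegral_mul _ (φ.measurable_prod_act a)
    hFm]
  rfl

/-- The probability of the action `a` in the latent state `s` under the policy `φ`. -/
def BMDP.latentAct (M : BMDP S A X H) (φ : Policy X A H) (h : Fin H) (s : S) (a : A) : ℝ≥0∞ :=
  ∫⁻ x, φ.act h x a ∂(M.q s)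

theorem PMF.sum_apply_eq_one {A : Type} [Fintype A] (p : PMF A) : ∑ a, p a = 1 := by
  have h := p.tsum_coe
  rwa [tsum_fintype] at h

theorem BMDP.sum_latentAct (M : BMDP S A X H) (φ : Policy X A H) (h : Fin H) (s : S) :
    ∑ a, M.latentAct φ h s a = 1 := by
  simp only [BMDP.latentAct]
  rw [← lintegral_finsetSum _ fun a _ => φ.measurable_act h a]
  simp [PMF.sum_apply_eq_one]

open Classical in
/-- For a product function of the observations, the integral over the trajectories is a path
sum. -/
theorem BMDP.lintegral_trajLaw_prod (M : BMDP S A X H) (φ : Policy X A H)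
    (u : Fin (H + 1) → X → ℝ≥0∞) (hu : ∀ h, Measurable (u h)) :
    ∫⁻ τ, ∏ h, u h (τ.1 h) ∂(M.trajLaw φ) =
      pathSum (fun s => if s = M.init then 1 else 0)
        (fun h s a s' => M.p h s a s' *
          ∫⁻ x, φ.act h x a * u h.castSucc x ∂(M.q s))
        (fun s => ∫⁻ x, u (Fin.last H) x ∂(M.q s)) := by
  have hmeas : Measurable fun τ : Trajectory X A H => ∏ h, u h (τ.1 h) :=
    Finset.measurable_prod _ fun h _ =>
      (hu h).comp ((measurable_pi_apply h).comp measurable_fst)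
  rw [M.lintegral_trajLaw φ hmeas, pathSum]
  refine Finset.sum_congr rfl fun s _ => Finset.sum_congr rfl fun a _ => ?_
  have h1 : ∀ x : Fin (H + 1) → X, (∏ h : Fin H, φ.act h (x h.castSucc) (a h)) *
      ∏ h, u h (x h) = ∏ h : Fin (H + 1),
        (Fin.lastCases (motive := fun _ => X → ℝ≥0∞) (u (Fin.last H))
          (fun h x => φ.act h x (a h) * u h.castSucc x) h) (x h) := by
    intro x
    rw [Fin.prod_univ_castSucc (n := H), Fin.prod_univ_castSucc (n := H)]
    simp only [Fin.lastCases_castSucc, Fin.lastCases_last, Finset.prod_mul_distrib]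
    ring
  rw [lintegral_congr h1, lintegral_pi_prod]
  · rw [Fin.prod_univ_castSucc]
    simp only [Fin.lastCases_castSucc, Fin.lastCases_last, Finset.prod_mul_distrib, MDP.weight]
    split_ifs <;> simp [mul_assoc]
  · intro h
    refine Fin.lastCases ?_ (fun h => ?_) h
    · simpa using hu _
    · simp only [Fin.lastCases_castSucc]
      exact (φ.measurable_act h (a h)).mul (hu h.castSucc)

theorem BMDP.ae_f_eq (M : BMDP S A X H) [MeasurableSingletonClass S] (s : S) :
    ∀ᵐ x ∂(M.q s), M.f x = s :=
  (mem_ae_iff_prob_eq_one (M.measurable_f (measurableSet_singleton s))).2 (M.q_block s)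

open Classical in
theorem BMDP.q_fiber (M : BMDP S A X H) [MeasurableSingletonClass S] (s t : S) (E : Set X) :
    M.q s ({x | M.f x = t} ∩ E) = if s = t then M.q s E else 0 := by
  split_ifs with h
  · subst h
    refine measure_congr ?_
    filter_upwards [M.ae_f_eq s] with x hx
    exact propext ⟨fun h => h.2, fun h => ⟨hx, h⟩⟩
  · refine measure_mono_null (fun x hx => ?_) (ae_iff.1 (M.ae_f_eq s))
    exact fun hc => h (hc.symm.trans hx.1)

/-- The law of the observation at each level is a mixture of the emission distributions, in which
the weight of a latent state is the probability of its block. -/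
def BMDP.IsMixture (M : BMDP S A X H) (P : Measure (Trajectory X A H)) : Prop :=
  ∀ (h : Fin (H + 1)) (E : Set X), MeasurableSet E →
    P {τ | τ.1 h ∈ E} = ∑ s, P {τ | M.f (τ.1 h) = s} * M.q s E

theorem measurable_level (h : Fin (H + 1)) : Measurable fun τ : Trajectory X A H => τ.1 h :=
  (measurable_pi_apply h).comp measurable_fst

/-- A single μ has to serve all events `E`. This is why `exists_level_weight` fixes μ before the
modified weights. -/
theorem BMDP.exists_level_mixture (M : BMDP S A X H) (φ : Policy X A H) (h₀ : Fin (H + 1)) :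
    ∃ μ : S → ℝ≥0∞, ∀ E, MeasurableSet E → M.trajLaw φ {τ | τ.1 h₀ ∈ E} = ∑ s, μ s * M.q s E := by
  classical
  obtain ⟨μ, hμ⟩ := exists_level_weight (fun s => if s = M.init then 1 else 0)
    (fun h s a s' => M.p h s a s' * M.latentAct φ h s a) (fun h s => by
      simp_rw [← Finset.sum_mul, PMF.sum_apply_eq_one, one_mul]
      exact M.sum_latentAct φ h s) h₀
  refine ⟨μ, fun E hE => ?_⟩
  -- With test functions equal to 1 off the level h₀, the path weights stay stochastic everywhere
  -- else, and the outgoing weight at h₀ becomes q(E | s).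
  let u : Fin (H + 1) → X → ℝ≥0∞ := fun h => if h = h₀ then E.indicator 1 else 1
  have hu : ∀ h, Measurable (u h) := fun h => by
    by_cases hh : h = h₀
    · simpa [u, hh] using measurable_one.indicator hE
    · simpa [u, hh] using measurable_one
  have h1 : M.trajLaw φ {τ | τ.1 h₀ ∈ E} = ∫⁻ τ, ∏ h, u h (τ.1 h) ∂(M.trajLaw φ) := by
    have hpre : MeasurableSet {τ : Trajectory X A H | τ.1 h₀ ∈ E} := measurable_level h₀ hE
    rw [← lintegral_indicator_one hpre]
    refine lintegral_congr fun τ => ?_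
    rw [Finset.prod_eq_single h₀ (fun h _ hh => by simp [u, hh]) (by simp)]
    simp only [u, if_true]
    rfl
  rw [h1, M.lintegral_trajLaw_prod φ u hu]
  refine hμ _ _ _ (fun h hh => ?_) (fun h hh s => ?_) (fun hh => ?_) fun hh => ?_
  · funext s a s'
    simp [u, hh, BMDP.latentAct]
  · simp_rw [← Finset.sum_mul, PMF.sum_apply_eq_one, one_mul]
    rw [← lintegral_finsetSum _ (f := fun a x => φ.act h x a * u h.castSucc x)
      fun a _ => (φ.measurable_act h a).mul (hu _)]
    simp_rw [← Finset.sum_mul, PMF.sum_apply_eq_one, one_mul]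
    simp [u, hh, lintegral_indicator_one hE]
  · funext s
    simp [u, hh]
  · funext s
    simp [u, hh, lintegral_indicator_one hE]

instance BMDP.isProbabilityMeasure_trajLaw (M : BMDP S A X H) (φ : Policy X A H) :
    IsProbabilityMeasure (M.trajLaw φ) := by
  classical
  constructor
  have h := M.lintegral_trajLaw_prod φ (fun _ _ => 1) fun _ => measurable_const
  simp only [Finset.prod_const_one, lintegral_one, mul_one, measure_univ] at h
  rw [h, pathSum_of_stochastic _ _ fun h s => ?_]
  · simp
  · simp_rw [← Finset.sum_mul, PMF.sum_apply_eq_one, one_mul]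
    exact M.sum_latentAct φ h s

/-- The weights are identified by testing the mixture on the blocks, to which the emission laws give
mass 0 or 1. -/
theorem BMDP.isMixture_trajLaw [MeasurableSingletonClass S] (M : BMDP S A X H)
    (φ : Policy X A H) : M.IsMixture (M.trajLaw φ) := by
  classical
  intro h E hE
  obtain ⟨μ, hμ⟩ := M.exists_level_mixture φ h
  rw [hμ E hE]
  refine Finset.sum_congr rfl fun s _ => ?_
  have h1 := hμ {x | M.f x = s} (M.measurable_f (measurableSet_singleton s))
  have h2 : ∀ t, M.q t {x | M.f x = s} = if t = s then 1 else 0 := fun t => by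
    have := M.q_fiber t s Set.univ
    simpa using this
  simp only [h2, mul_ite, mul_one, mul_zero, Finset.sum_ite_eq', Finset.mem_univ, if_true] at h1
  rw [← h1]
  rfl

theorem BMDP.isProbabilityMeasure_unifLaw (M : BMDP S A X H) {Φ : List (Policy X A H)}
    (hΦ : Φ ≠ []) : IsProbabilityMeasure (M.unifLaw Φ) := by
  constructor
  have h : ∀ Ψ : List (Policy X A H), (Ψ.map M.trajLaw).sum Set.univ = Ψ.length := by
    intro Ψ
    induction Ψ with
    | nil => simp
    | cons φ Ψ ih => simp [ih, add_comm]
  rw [BMDP.unifLaw, Measure.smul_apply, h, smul_eq_mul, ENNReal.inv_mul_cancel] <;> simp [hΦ]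

theorem BMDP.unifLaw_singleton (M : BMDP S A X H) (φ : Policy X A H) :
    M.unifLaw [φ] = M.trajLaw φ := by
  simp [BMDP.unifLaw]

theorem BMDP.isMixture_unifLaw [MeasurableSingletonClass S] (M : BMDP S A X H)
    (Φ : List (Policy X A H)) : M.IsMixture (M.unifLaw Φ) := by
  have h : ∀ Ψ : List (Policy X A H), M.IsMixture (Ψ.map M.trajLaw).sum := by
    intro Ψ
    induction Ψ with
    | nil => intro h E _; simp
    | cons φ Ψ ih =>
      intro h E hE
      simp only [List.map_cons, List.sum_cons, Measure.add_apply, ih h E hE,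
        M.isMixture_trajLaw φ h E hE, add_mul, Finset.sum_add_distrib]
  intro l E hE
  simp only [BMDP.unifLaw, Measure.smul_apply, smul_eq_mul, h Φ l E hE, Finset.mul_sum, mul_assoc]

/-- The price of training on a uniform mixture: an error bound grows by the number of policies when
it is applied to one of them. -/
theorem BMDP.trajLaw_le_unifLaw (M : BMDP S A X H) {Φ : List (Policy X A H)} {φ : Policy X A H}
    (hφ : φ ∈ Φ) : M.trajLaw φ ≤ (Φ.length : ℝ≥0∞) • M.unifLaw Φ := by
  have h : ∀ Ψ : List (Policy X A H), φ ∈ Ψ → M.trajLaw φ ≤ (Ψ.map M.trajLaw).sum := by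
    intro Ψ hΨ
    induction Ψ with
    | nil => simp at hΨ
    | cons ψ Ψ ih =>
      rw [List.map_cons, List.sum_cons]
      rcases List.mem_cons.1 hΨ with rfl | h'
      · exact Measure.le_add_right le_rfl
      · exact Measure.le_add_left (ih h')
  have hne : Φ ≠ [] := List.ne_nil_of_mem hφ
  rw [BMDP.unifLaw, smul_smul, ENNReal.mul_inv_cancel (by simp [hne]) (by simp), one_smul]
  exact h Φ hφ

/-- Two policies that act alike on the observations in `G` produce the same law of the trajectories
with observations in `G`. -/
theorem BMDP.trajLaw_inter_congr (M : BMDP S A X H) (φ ψ : Policy X A H)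
    {G : Set (Fin (H + 1) → X)} (hG : MeasurableSet G)
    (h : ∀ x ∈ G, ∀ l a, φ.act l (x l.castSucc) a = ψ.act l (x l.castSucc) a)
    {E : Set (Trajectory X A H)} (hE : MeasurableSet E) :
    M.trajLaw φ (E ∩ {τ | τ.1 ∈ G}) = M.trajLaw ψ (E ∩ {τ | τ.1 ∈ G}) := by
  have hm : MeasurableSet (E ∩ {τ : Trajectory X A H | τ.1 ∈ G}) := hE.inter (measurable_fst hG)
  rw [M.trajLaw_apply φ hm, M.trajLaw_apply ψ hm]
  refine Finset.sum_congr rfl fun s _ => Finset.sum_congr rfl fun a _ => ?_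
  congr 1
  refine lintegral_congr fun x => ?_
  by_cases hx : x ∈ G
  · congr 1
    exact Finset.prod_congr rfl fun l _ => h x hx l (a l)
  · have : ((x, a, M.rewards s a) : Trajectory X A H) ∉ E ∩ {τ : Trajectory X A H | τ.1 ∈ G} :=
      fun hc => hx hc.2
    simp [Set.indicator_of_notMem this]

theorem BMDP.restrict_trajLaw_congr (M : BMDP S A X H) (φ ψ : Policy X A H)
    {G : Set (Fin (H + 1) → X)} (hG : MeasurableSet G)
    (h : ∀ x ∈ G, ∀ l a, φ.act l (x l.castSucc) a = ψ.act l (x l.castSucc) a) :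
    (M.trajLaw φ).restrict {τ | τ.1 ∈ G} = (M.trajLaw ψ).restrict {τ | τ.1 ∈ G} := by
  ext E hE
  rw [Measure.restrict_apply hE, Measure.restrict_apply hE,
    M.trajLaw_inter_congr φ ψ hG h hE]

end Law

/-! ### Expectations of interactive procedures -/

namespace Interaction

variable {S A X : Type} [Fintype S] [MeasurableSpace S] [Fintype A] [MeasurableSpace A]
  [MeasurableSpace X] {H : ℕ} {R Q : Type}

/-- The (lower) expectation of a function of the result of a procedure. -/
def expect (M : BMDP S A X H) (F : R → ℝ≥0∞) : Interaction X A H R → ℝ≥0∞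
  | done r => F r
  | draw n next => ∫⁻ ω : Fin n → Seed, expect M F (next ω)
  | play Φ _ n next => ∫⁻ τ, expect M F (next τ) ∂(Measure.pi fun _ : Fin n => M.unifLaw Φ)

variable (M : BMDP S A X H)

theorem prob_eq_expect (E : Set R) (c : Interaction X A H R) :
    prob M E c = expect M (E.indicator 1) c := by
  classical
  induction c with
  | done r => simp [prob, expect, Set.indicator_apply]
  | draw n next ih => simp only [prob, expect, ih]
  | play Φ h n next ih => simp only [prob, expect, ih]

theorem expect_bind (F : Q → ℝ≥0∞) (c : Interaction X A H R) (k : R → Interaction X A H Q) :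
    expect M F (c >>= k) = expect M (fun r => expect M F (k r)) c := by
  change expect M F (c.andThen k) = _
  induction c with
  | done r => rfl
  | draw n next ih => simp only [andThen, expect, ih]
  | play Φ h n next ih => simp only [andThen, expect, ih]

theorem expect_pure (F : R → ℝ≥0∞) (r : R) :
    expect M F (pure r : Interaction X A H R) = F r := rfl

theorem expect_seeds (F : (Fin n → Seed) → ℝ≥0∞) :
    expect M F (seeds n : Interaction X A H _) = ∫⁻ ω, F ω := rfl

theorem expect_sampleUnif (φ : Policy X A H) (Φ : List (Policy X A H)) (n : ℕ)
    (F : (Fin n → Trajectory X A H) → ℝ≥0∞) :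
    expect M F (sampleUnif φ Φ n) =
      ∫⁻ τ, F τ ∂(Measure.pi fun _ : Fin n => M.unifLaw (φ :: Φ)) := rfl

theorem expect_sample (φ : Policy X A H) (n : ℕ) (F : (Fin n → Trajectory X A H) → ℝ≥0∞) :
    expect M F (sample φ n) = ∫⁻ τ, F τ ∂(Measure.pi fun _ : Fin n => M.trajLaw φ) := by
  rw [sample, expect_sampleUnif, M.unifLaw_singleton]

theorem expect_mono {F G : R → ℝ≥0∞} (h : ∀ r, F r ≤ G r) (c : Interaction X A H R) :
    expect M F c ≤ expect M G c := by
  induction c with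
  | done r => exact h r
  | draw n next ih => exact lintegral_mono ih
  | play Φ hΦ n next ih => exact lintegral_mono ih

theorem prob_mono {E E' : Set R} (h : E ⊆ E') (c : Interaction X A H R) :
    prob M E c ≤ prob M E' c := by
  rw [prob_eq_expect, prob_eq_expect]
  exact expect_mono M (fun r => Set.indicator_le_indicator_of_subset h (fun _ => zero_le) r) c

/-- Lower integrals are only superadditive and superhomogeneous for non-measurable functions. This
is the direction that lower bounds for success probabilities need. -/
theorem add_mul_expect_le (a b : ℝ≥0∞) (F : R → ℝ≥0∞)
    (c : Interaction X A H R) : a + b * expect M F c ≤ expect M (fun r => a + b * F r) c := by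
  induction c with
  | done r => exact le_rfl
  | draw n next ih =>
    refine le_trans ?_ (lintegral_mono ih)
    rw [lintegral_add_left measurable_const, lintegral_const, measure_univ, mul_one]
    gcongr
    exact lintegral_const_mul_le _ _
  | play Φ hΦ n next ih =>
    have := M.isProbabilityMeasure_unifLaw hΦ
    refine le_trans ?_ (lintegral_mono ih)
    rw [lintegral_add_left measurable_const, lintegral_const, measure_univ, mul_one]
    gcongr
    exact lintegral_const_mul_le _ _

theorem le_expect_of_forall {v : ℝ≥0∞} {F : R → ℝ≥0∞} (h : ∀ r, v ≤ F r)
    (c : Interaction X A H R) : v ≤ expect M F c := by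
  have h1 := add_mul_expect_le M v 0 (fun _ => 0) c
  simp only [zero_mul, add_zero] at h1
  exact h1.trans (expect_mono M h c)

theorem mul_prob_le_expect {v : ℝ≥0∞} {E : Set R} {F : R → ℝ≥0∞} (h : ∀ r ∈ E, v ≤ F r)
    (c : Interaction X A H R) : v * prob M E c ≤ expect M F c := by
  rw [prob_eq_expect]
  have h1 := add_mul_expect_le M 0 v (E.indicator 1) c
  simp only [zero_add] at h1
  refine h1.trans (expect_mono M (fun r => ?_) c)
  by_cases hr : r ∈ E
  · simpa [hr] using h r hr
  · simp [hr]

theorem one_sub_add_le_mul (ξ ζ : ℝ≥0∞) : 1 - (ξ + ζ) ≤ (1 - ξ) * (1 - ζ) := by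
  rcases le_total 1 ζ with h | h
  · rw [tsub_eq_zero_of_le (h.trans le_add_self)]; exact zero_le
  · rw [mul_comm, add_comm, ← tsub_tsub]
    have h1 : (1 - ζ) * (1 - ξ) = (1 - ζ) - (1 - ζ) * ξ := by
      rw [ENNReal.mul_sub (fun _ _ => by finiteness), mul_one]
    rw [h1]
    gcongr
    exact mul_le_of_le_one_left zero_le tsub_le_self

/-- If an event has probability at least `1 - ξ` and implies that the second part has an expectation
of at least `1 - ζ`, then the composition has an expectation of at least `1 - (ξ + ζ)`. -/
theorem le_expect_bind {ξ ζ : ℝ≥0∞} {E : Set R} {F : Q → ℝ≥0∞} {c : Interaction X A H R}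
    {k : R → Interaction X A H Q} (hc : 1 - ξ ≤ prob M E c)
    (hk : ∀ r ∈ E, 1 - ζ ≤ expect M F (k r)) : 1 - (ξ + ζ) ≤ expect M F (c >>= k) := by
  rw [expect_bind]
  refine le_trans ?_ (mul_prob_le_expect M hk c)
  refine le_trans ?_ (mul_le_mul_right hc _)
  rw [mul_comm]
  exact one_sub_add_le_mul ξ ζ

theorem le_prob_bind {ξ ζ : ℝ≥0∞} {E : Set R} {E' : Set Q} {c : Interaction X A H R}
    {k : R → Interaction X A H Q} (hc : 1 - ξ ≤ prob M E c)
    (hk : ∀ r ∈ E, 1 - ζ ≤ prob M E' (k r)) : 1 - (ξ + ζ) ≤ prob M E' (c >>= k) := by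
  rw [prob_eq_expect]
  exact le_expect_bind M hc fun r hr => by rw [← prob_eq_expect]; exact hk r hr

theorem UsesAtMost.mono {c : Interaction X A H R} {T T' : ℕ} (hc : c.UsesAtMost T)
    (h : T ≤ T') : c.UsesAtMost T' := by
  induction c generalizing T T' with
  | done r => trivial
  | draw n next ih => exact fun ω => ih ω (hc ω) h
  | play Φ hΦ n next ih =>
    exact ⟨hc.1.trans h, fun τ => ih τ (hc.2 τ) (Nat.sub_le_sub_right h n)⟩

theorem usesAtMost_bind {c : Interaction X A H R} {k : R → Interaction X A H Q} {T₁ T₂ : ℕ}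
    (hc : c.UsesAtMost T₁) (hk : ∀ r, (k r).UsesAtMost T₂) : (c >>= k).UsesAtMost (T₁ + T₂) := by
  change (c.andThen k).UsesAtMost _
  induction c generalizing T₁ with
  | done r => exact (hk r).mono (Nat.le_add_left _ _)
  | draw n next ih => exact fun ω => ih ω (hc ω)
  | play Φ hΦ n next ih =>
    refine ⟨hc.1.trans (Nat.le_add_right _ _), fun τ => ?_⟩
    have := ih τ (hc.2 τ)
    rwa [← Nat.sub_add_comm hc.1] at this

theorem usesAtMost_pure (r : R) : (pure r : Interaction X A H R).UsesAtMost 0 := trivial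

theorem usesAtMost_seeds (n : ℕ) : (seeds n : Interaction X A H _).UsesAtMost 0 := fun _ => trivial

theorem usesAtMost_sampleUnif (φ : Policy X A H) (Φ : List (Policy X A H)) (n : ℕ) :
    (sampleUnif φ Φ n).UsesAtMost n := ⟨le_rfl, fun _ => trivial⟩

theorem usesAtMost_sample (φ : Policy X A H) (n : ℕ) : (sample φ n).UsesAtMost n :=
  ⟨le_rfl, fun _ => trivial⟩

theorem usesAtMost_collect {T : ℕ} : ∀ (n : ℕ) (c : Fin n → Interaction X A H R),
    (∀ i, (c i).UsesAtMost T) → (collect n c).UsesAtMost (n * T)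
  | 0, _, _ => trivial
  | n + 1, c, hc => by
    rw [Nat.succ_mul]
    exact usesAtMost_bind (usesAtMost_collect n _ fun i => hc i.castSucc) fun v =>
      usesAtMost_bind (T₂ := 0) (hc (Fin.last n)) fun y => trivial

/-- Independent repetition: the probability that all attempts fail decays geometrically. -/
theorem prob_collect_exists {E : Set R} {ρ : ℝ≥0∞} (hρ : ρ ≤ 1) (c : Interaction X A H R)
    (hc : 1 - ρ ≤ prob M E c) :
    ∀ n : ℕ, 1 - ρ ^ n ≤ prob M {v : Fin n → R | ∃ i, v i ∈ E} (collect n fun _ => c)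
  | 0 => by simp
  | n + 1 => by
    have ih := prob_collect_exists hρ c hc n
    rw [prob_eq_expect] at ih
    -- After an earlier success the left side is 1, which is attained; otherwise it is 1 - ρ, the
    -- guarantee for one fresh attempt. Averaging over `v` gives the recursion (1 - ρ) + ρ(1 - ρ^n)
    -- = 1 - ρ^(n+1).
    have hstep : ∀ v : Fin n → R, (1 - ρ) + ρ * {v : Fin n → R | ∃ i, v i ∈ E}.indicator 1 v ≤
        expect M ({v : Fin (n + 1) → R | ∃ i, v i ∈ E}.indicator 1)
          (c >>= fun y => pure (Fin.snoc (α := fun _ => R) v y)) := by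
      intro v
      rw [expect_bind]
      by_cases hv : v ∈ {v : Fin n → R | ∃ i, v i ∈ E}
      · simp only [Set.indicator_of_mem hv, Pi.one_apply, mul_one]
        rw [tsub_add_cancel_of_le hρ]
        refine le_expect_of_forall M (fun y => ?_) c
        obtain ⟨i, hi⟩ := hv
        rw [expect_pure, Set.indicator_of_mem]
        · rfl
        · exact ⟨i.castSucc, by simpa using hi⟩
      · rw [Set.indicator_of_notMem hv, mul_zero, add_zero]
        refine hc.trans ?_
        rw [prob_eq_expect]
        refine expect_mono M (fun y => ?_) c
        by_cases hy : y ∈ E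
        · rw [expect_pure, Set.indicator_of_mem hy, Set.indicator_of_mem]
          · rfl
          · exact ⟨Fin.last n, by simpa using hy⟩
        · simp [hy]
    rw [prob_eq_expect, collect, expect_bind]
    refine le_trans ?_ ((add_mul_expect_le M (1 - ρ) ρ _ _).trans (expect_mono M hstep _))
    calc 1 - ρ ^ (n + 1) = (1 - ρ) + ρ * (1 - ρ ^ n) := by
          have hn : ρ ^ n ≤ 1 := pow_le_one' hρ n
          have hρt : ρ ≠ ⊤ := (hρ.trans_lt ENNReal.one_lt_top).ne
          have h1 : ρ * ρ ^ n ≤ ρ := mul_le_of_le_one_right zero_le hn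
          rw [ENNReal.mul_sub (fun _ _ => hρt), mul_one, pow_succ, mul_comm]
          have hfin : ρ * ρ ^ n ≠ ⊤ := ENNReal.mul_ne_top hρt (ENNReal.pow_ne_top hρt)
          rw [← ENNReal.add_sub_cancel_right (a := (1 - ρ) + (ρ - ρ * ρ ^ n)) hfin, add_assoc,
            tsub_add_cancel_of_le h1, tsub_add_cancel_of_le hρ]
      _ ≤ _ := by gcongr

/-- The union bound for procedures that are carried out one after the other. -/
theorem prob_collect_forall {b : ℝ≥0∞} : ∀ (n : ℕ) (c : Fin n → Interaction X A H R)
    (E : Fin n → Set R), (∀ i, 1 - b ≤ prob M (E i) (c i)) →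
    1 - n * b ≤ prob M {v : Fin n → R | ∀ i, v i ∈ E i} (collect n c)
  | 0, c, E, _ => by simp [collect, prob_eq_expect, expect_pure]
  | n + 1, c, E, hc => by
    have ih := prob_collect_forall n (fun i => c i.castSucc) (fun i => E i.castSucc)
      fun i => hc i.castSucc
    rw [collect, Nat.cast_succ, add_mul, one_mul]
    refine le_prob_bind M ih fun v hv => ?_
    rw [← add_zero b]
    refine le_prob_bind M (hc (Fin.last n)) fun y hy => ?_
    rw [prob_eq_expect, expect_pure, Set.indicator_of_mem]
    · simp
    · intro i
      refine Fin.lastCases ?_ (fun i => ?_) i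
      · simpa using hy
      · simpa using hv i

end Interaction

/-! ### Values, and the simulation of an MDP with permuted states -/

section Values

variable {S A X : Type} [Fintype S] [MeasurableSpace S] [Fintype A] [MeasurableSpace A]
  [MeasurableSpace X] {H : ℕ}

theorem BMDP.lintegral_prod_act (M : BMDP S A X H) (φ : Policy X A H) (s : Fin (H + 1) → S)
    (a : Fin H → A) :
    ∫⁻ x, ∏ h : Fin H, φ.act h (x h.castSucc) (a h) ∂(Measure.pi fun h => M.q (s h)) =
      ∏ h : Fin H, M.latentAct φ h (s h.castSucc) (a h) := by
  have h1 : ∀ x : Fin (H + 1) → X, (∏ h : Fin H, φ.act h (x h.castSucc) (a h)) =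
      ∏ h : Fin (H + 1), (Fin.lastCases (motive := fun _ => X → ℝ≥0∞) (fun _ => 1)
          (fun h x => φ.act h x (a h)) h) (x h) := by
    intro x
    rw [Fin.prod_univ_castSucc (n := H)]
    simp only [Fin.lastCases_castSucc, Fin.lastCases_last, mul_one]
  rw [lintegral_congr h1, lintegral_pi_prod]
  · rw [Fin.prod_univ_castSucc]
    simp [BMDP.latentAct]
  · intro h
    refine Fin.lastCases ?_ (fun h => ?_) h
    · simp
    · simpa using φ.measurable_act h (a h)

theorem BMDP.ae_rewards (M : BMDP S A X H) (φ : Policy X A H) :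
    ∀ᵐ τ ∂(M.trajLaw φ), ∀ h, τ.2.2 h ∈ Set.Icc (0 : ℝ) 1 := by
  have hm : MeasurableSet {τ : Trajectory X A H | ∀ h, τ.2.2 h ∈ Set.Icc (0 : ℝ) 1} := by
    have : {τ : Trajectory X A H | ∀ h, τ.2.2 h ∈ Set.Icc (0 : ℝ) 1} =
        ⋂ h, (fun τ : Trajectory X A H => τ.2.2 h) ⁻¹' Set.Icc (0 : ℝ) 1 := by ext; simp
    rw [this]
    exact MeasurableSet.iInter fun h =>
      ((measurable_pi_apply h).comp (measurable_snd.comp measurable_snd)) measurableSet_Icc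
  rw [ae_iff]
  change M.trajLaw φ {τ : Trajectory X A H | ∀ h, τ.2.2 h ∈ Set.Icc (0 : ℝ) 1}ᶜ = 0
  rw [M.trajLaw_apply φ hm.compl]
  refine Finset.sum_eq_zero fun s _ => Finset.sum_eq_zero fun a _ => ?_
  have : ∀ x : Fin (H + 1) → X, ((x, a, M.rewards s a) : Trajectory X A H) ∉
      {τ : Trajectory X A H | ∀ h, τ.2.2 h ∈ Set.Icc (0 : ℝ) 1}ᶜ :=
    fun x hx => hx fun h => M.r_mem _ _ _
  simp only [Set.indicator_of_notMem (this _), zero_mul, lintegral_zero, mul_zero]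

theorem measurable_totalReward : Measurable fun τ : Trajectory X A H => ∑ h, τ.2.2 h :=
  Finset.measurable_sum _ fun h _ =>
    (measurable_pi_apply h).comp (measurable_snd.comp measurable_snd)

theorem BMDP.ae_totalReward (M : BMDP S A X H) (φ : Policy X A H) :
    ∀ᵐ τ ∂(M.trajLaw φ), ∑ h, τ.2.2 h ∈ Set.Icc (0 : ℝ) H := by
  filter_upwards [M.ae_rewards φ] with τ hτ
  refine ⟨Finset.sum_nonneg fun h _ => (hτ h).1, ?_⟩
  calc ∑ h, τ.2.2 h ≤ ∑ _h : Fin H, (1 : ℝ) := Finset.sum_le_sum fun h _ => (hτ h).2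
    _ = H := by simp

theorem BMDP.integrable_totalReward (M : BMDP S A X H) (φ : Policy X A H) :
    Integrable (fun τ => ∑ h, τ.2.2 h) (M.trajLaw φ) :=
  Integrable.of_mem_Icc 0 H measurable_totalReward.aemeasurable (M.ae_totalReward φ)

/-- Given the latent path, the observations are independent, so a memoryless policy enters only
through its latent action probabilities. Values can thus be compared across observation spaces. -/
theorem BMDP.value_eq (M : BMDP S A X H) (φ : Policy X A H) :
    M.value φ = (∑ s : Fin (H + 1) → S, ∑ a : Fin H → A, M.weight s a *
      ((∏ h : Fin H, M.latentAct φ h (s h.castSucc) (a h)) *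
        ENNReal.ofReal (∑ h, M.rewards s a h))).toReal := by
  rw [BMDP.value, integral_eq_lintegral_of_nonneg_ae
    ((M.ae_totalReward φ).mono fun τ h => h.1) measurable_totalReward.aestronglyMeasurable,
    M.lintegral_trajLaw φ measurable_totalReward.ennreal_ofReal]
  congr 1
  refine Finset.sum_congr rfl fun s _ => Finset.sum_congr rfl fun a _ => ?_
  dsimp only
  rw [lintegral_mul_const _ (φ.measurable_prod_act a), M.lintegral_prod_act]

/-- The values of two policies that act alike on the observations in `G` differ at most by `H` times
the probability of the complement of `G`. -/
theorem BMDP.value_le_of_agree (M : BMDP S A X H) (φ ψ : Policy X A H)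
    {G : Set (Fin (H + 1) → X)} (hG : MeasurableSet G)
    (h : ∀ x ∈ G, ∀ l a, φ.act l (x l.castSucc) a = ψ.act l (x l.castSucc) a) {b : ℝ}
    (hb : 0 ≤ b) (hGb : M.trajLaw ψ {τ | τ.1 ∉ G} ≤ ENNReal.ofReal b) :
    M.value ψ ≤ M.value φ + H * b := by
  have hG' : MeasurableSet {τ : Trajectory X A H | τ.1 ∈ G} := measurable_fst hG
  have e1 : M.value ψ = ∫ τ in {τ | τ.1 ∈ G}, ∑ h, τ.2.2 h ∂(M.trajLaw ψ) +
      ∫ τ in {τ | τ.1 ∈ G}ᶜ, ∑ h, τ.2.2 h ∂(M.trajLaw ψ) :=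
    (integral_add_compl hG' (M.integrable_totalReward ψ)).symm
  have e2 : M.value φ = ∫ τ in {τ | τ.1 ∈ G}, ∑ h, τ.2.2 h ∂(M.trajLaw φ) +
      ∫ τ in {τ | τ.1 ∈ G}ᶜ, ∑ h, τ.2.2 h ∂(M.trajLaw φ) :=
    (integral_add_compl hG' (M.integrable_totalReward φ)).symm
  rw [M.restrict_trajLaw_congr φ ψ hG h] at e2
  have h1 : 0 ≤ ∫ τ in {τ | τ.1 ∈ G}ᶜ, ∑ h, τ.2.2 h ∂(M.trajLaw φ) :=
    integral_nonneg_of_ae ((ae_restrict_of_ae (M.ae_totalReward φ)).mono fun τ h => h.1)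
  have h2 : ∫ τ in {τ | τ.1 ∈ G}ᶜ, ∑ h, τ.2.2 h ∂(M.trajLaw ψ) ≤ H * b := by
    calc ∫ τ in {τ | τ.1 ∈ G}ᶜ, ∑ h, τ.2.2 h ∂(M.trajLaw ψ)
        ≤ ∫ _τ in {τ : Trajectory X A H | τ.1 ∈ G}ᶜ, (H : ℝ) ∂(M.trajLaw ψ) :=
          integral_mono_ae (M.integrable_totalReward ψ).integrableOn (integrable_const _)
            ((ae_restrict_of_ae (M.ae_totalReward ψ)).mono fun τ h => h.2)
      _ = (M.trajLaw ψ).real {τ | τ.1 ∈ G}ᶜ * H := by simp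
      _ ≤ b * H := by
          gcongr
          exact ENNReal.toReal_le_of_le_ofReal hb hGb
      _ = H * b := mul_comm _ _
  linarith

end Values

section Relabel

variable {S A X : Type} [Fintype S] [MeasurableSpace S] [DiscreteMeasurableSpace S] [Fintype A]
  [MeasurableSpace A] [MeasurableSpace X] {H : ℕ}

/-- The MDP with permuted states. -/
def MDP.relabel (M : MDP S A H) (α : Fin (H + 1) → Equiv.Perm S) : MDP S A H where
  init := α 0 M.init
  p h s a := (M.p h ((α h.castSucc).symm s) a).map (α h.succ)
  r h s a := M.r h ((α h.castSucc).symm s) a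
  r_mem h _ a := M.r_mem h _ a

/-- The true decoding function, followed by a permutation of the states. -/
def BMDP.trueDecoder (M : BMDP S A X H) (α : Fin (H + 1) → Equiv.Perm S) :
    Fin (H + 1) → Decoder S X :=
  fun h => ⟨fun x => α h (M.f x), (Measurable.of_discrete (f := α h)).comp M.measurable_f⟩

theorem PMF.map_equiv_apply {B : Type} (p : PMF B) (e : Equiv.Perm B) (s : B) :
    (p.map e) (e s) = p s := by
  classical
  rw [PMF.map_apply, tsum_eq_single s]
  · simp
  · intro t ht
    rw [if_neg fun h => ht (e.injective h).symm]

theorem MDP.weight_relabel (M : MDP S A H) (α : Fin (H + 1) → Equiv.Perm S)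
    (s : Fin (H + 1) → S) (a : Fin H → A) :
    (M.relabel α).weight (fun h => α h (s h)) a = M.weight s a := by
  simp only [MDP.weight, MDP.relabel, PMF.map_equiv_apply, Equiv.symm_apply_apply]
  by_cases h : s 0 = M.init
  · simp [h]
  · simp [h, (α 0).injective.ne h]

theorem MDP.rewards_relabel (M : MDP S A H) (α : Fin (H + 1) → Equiv.Perm S)
    (s : Fin (H + 1) → S) (a : Fin H → A) :
    (M.relabel α).rewards (fun h => α h (s h)) a = M.rewards s a := by
  funext h
  simp [MDP.rewards, MDP.relabel]

theorem sum_relabel {β : Type*} [AddCommMonoid β] (α : Fin (H + 1) → Equiv.Perm S)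
    (F : (Fin (H + 1) → S) → β) : 
    ∑ s, F s = ∑ s : Fin (H + 1) → S, F fun h => α h (s h) :=
  ((Equiv.piCongrRight α).sum_comp F).symm

theorem BMDP.lintegral_latent (M : BMDP S A X H) (s : Fin (H + 1) → S)
    (F : (Fin (H + 1) → S) → ℝ≥0∞) :
    ∫⁻ x, F (fun h => M.f (x h)) ∂(Measure.pi fun h => M.q (s h)) = F s := by
  have h1 : ∀ᵐ x ∂(Measure.pi fun h => M.q (s h)), ∀ h, M.f (x h) = s h := by
    rw [ae_all_iff]
    intro h
    exact (Measure.quasiMeasurePreserving_eval (fun h => M.q (s h)) h).ae (M.ae_f_eq (s h))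
  rw [lintegral_congr_ae (g := fun _ => F s)
    (h1.mono fun x hx => by simp only [funext hx])]
  simp

theorem BMDP.latentAct_comp_trueDecoder (M : BMDP S A X H) (α : Fin (H + 1) → Equiv.Perm S)
    (π : Policy S A H) (h : Fin H) (s : S) (a : A) :
    M.latentAct (π.comp (M.trueDecoder α)) h s a = π.act h (α h.castSucc s) a := by
  rw [BMDP.latentAct, lintegral_congr_ae (g := fun _ => π.act h (α h.castSucc s) a)]
  · simp
  · filter_upwards [M.ae_f_eq s] with x hx
    simp [Policy.comp, BMDP.trueDecoder, hx]

theorem MDP.latentAct_toBMDP (M : MDP S A H) (π : Policy S A H) (h : Fin H) (s : S) (a : A) :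
    M.toBMDP.latentAct π h s a = π.act h s a := by
  simp [BMDP.latentAct, MDP.toBMDP]

theorem BMDP.value_relabel (M : BMDP S A X H) (α : Fin (H + 1) → Equiv.Perm S)
    (π : Policy S A H) (φ : Policy X A H)
    (hφ : ∀ h s a, M.latentAct φ h s a = π.act h (α h.castSucc s) a) :
    (M.toMDP.relabel α).toBMDP.value π = M.value φ := by
  rw [BMDP.value_eq, BMDP.value_eq, sum_relabel α]
  congr 1
  refine Finset.sum_congr rfl fun s _ => Finset.sum_congr rfl fun a _ => ?_
  simp only [MDP.latentAct_toBMDP, hφ]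
  change (M.toMDP.relabel α).weight (fun h => α h (s h)) a * (_ * ENNReal.ofReal
    (∑ h, (M.toMDP.relabel α).rewards (fun h => α h (s h)) a h)) = _
  rw [MDP.weight_relabel, MDP.rewards_relabel]

/-- Competing with policies on the observations costs nothing: averaging ψ over each emission law
yields a policy on the states with the same latent action probabilities, hence the same value. -/
theorem BMDP.le_value_comp_trueDecoder (M : BMDP S A X H) (α : Fin (H + 1) → Equiv.Perm S)
    (π : Policy S A H) {ε : ℝ} (hπ : (M.toMDP.relabel α).toBMDP.IsEpsOptimal ε π) :
    M.IsEpsOptimal ε (π.comp (M.trueDecoder α)) := by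
  intro ψ
  let π' : Policy S A H :=
    { act := fun h s => PMF.ofFintype (fun a => M.latentAct ψ h ((α h.castSucc).symm s) a)
        (M.sum_latentAct ψ h _)
      measurable_act := fun h a => Measurable.of_discrete }
  have h1 := hπ π'
  rwa [M.value_relabel α π' ψ (fun h s a => by simp [π']),
    M.value_relabel α π _ (M.latentAct_comp_trueDecoder α π)] at h1

theorem measurable_decode (f : Fin (H + 1) → Decoder S X) :
    Measurable (decode (A := A) f) := by
  refine Measurable.prodMk (measurable_pi_lambda _ fun h => ?_) measurable_snd
  exact (f h).2.comp (measurable_level h)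

theorem BMDP.map_decode_trajLaw (M : BMDP S A X H) (α : Fin (H + 1) → Equiv.Perm S)
    (π : Policy S A H) :
    (M.trajLaw (π.comp (M.trueDecoder α))).map (decode (M.trueDecoder α)) =
      (M.toMDP.relabel α).toBMDP.trajLaw π := by
  ext E hE
  have hm := measurable_decode (A := A) (M.trueDecoder α)
  rw [Measure.map_apply hm hE, BMDP.trajLaw_apply _ _ (hm hE), BMDP.trajLaw_apply _ _ hE,
    sum_relabel α (fun s => ∑ a, (M.toMDP.relabel α).toBMDP.weight s a * _)]
  refine Finset.sum_congr rfl fun s _ => Finset.sum_congr rfl fun a _ => ?_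
  change _ = (M.toMDP.relabel α).weight (fun h => α h (s h)) a *
    ∫⁻ x, E.indicator (fun _ => 1) (x, a, (M.toMDP.relabel α).rewards (fun h => α h (s h)) a) * _
      ∂_
  rw [MDP.weight_relabel, MDP.rewards_relabel]
  congr 1
  have h1 := M.lintegral_latent s fun t =>
    E.indicator (fun _ => (1 : ℝ≥0∞)) (fun h => α h (t h), a, M.rewards s a) *
      ∏ h : Fin H, π.act h (α h.castSucc (t h.castSucc)) (a h)
  have h2 := (M.toMDP.relabel α).toBMDP.lintegral_latent (fun h => α h (s h)) fun t =>
    E.indicator (fun _ => (1 : ℝ≥0∞)) (t, a, M.rewards s a) *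
      ∏ h : Fin H, π.act h (t h.castSucc) (a h)
  exact h1.trans h2.symm

/-- Rewards are determined by the states and actions, so the law has finite support even though the
reward coordinates are real. -/
theorem BMDP.aemeasurable_trajLaw [MeasurableSingletonClass A] [MeasurableSingletonClass X] [Finite X]
    (M : BMDP S A X H) (π : Policy X A H) (u : Trajectory X A H → ℝ≥0∞) :
    AEMeasurable u (M.trajLaw π) := by
  let Fs : Set (Trajectory X A H) :=
    Set.range fun z : (Fin (H + 1) → X) × (Fin (H + 1) → S) × (Fin H → A) =>
      (z.1, z.2.2, M.rewards z.2.1 z.2.2)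
  have hFs : Fs.Finite := Set.finite_range _
  refine aemeasurable_of_finite_support _ hFs ?_ u
  rw [M.trajLaw_apply π (MeasurableSet.compl (Set.Finite.measurableSet hFs))]
  refine Finset.sum_eq_zero fun s _ => Finset.sum_eq_zero fun a _ => ?_
  have : ∀ x : Fin (H + 1) → X, ((x, a, M.rewards s a) : Trajectory X A H) ∉ Fsᶜ :=
    fun x hx => hx ⟨(x, s, a), rfl⟩
  simp only [Set.indicator_of_notMem (this _), zero_mul, lintegral_zero, mul_zero]

/-- On observations that are decoded correctly up to the permutations `α`, the decoded trajectories
are distributed as those of the relabelled MDP. -/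
theorem BMDP.lintegral_decode_le [MeasurableSingletonClass A] (M : BMDP S A X H)
    (α : Fin (H + 1) → Equiv.Perm S) (π : Policy S A H) (f : Fin (H + 1) → Decoder S X)
    {G : Set (Fin (H + 1) → X)} (hG : MeasurableSet G)
    (h : ∀ x ∈ G, ∀ l, (f l).1 (x l) = α l (M.f (x l))) (u : Trajectory S A H → ℝ≥0∞) :
    AEMeasurable (fun τ => u (decode f τ)) ((M.trajLaw (π.comp f)).restrict {τ | τ.1 ∈ G}) ∧
    ∫⁻ τ in {τ | τ.1 ∈ G}, u (decode f τ) ∂(M.trajLaw (π.comp f)) ≤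
      ∫⁻ t, u t ∂((M.toMDP.relabel α).toBMDP.trajLaw π) := by
  have hG' : MeasurableSet {τ : Trajectory X A H | τ.1 ∈ G} := measurable_fst hG
  have hu := (M.toMDP.relabel α).toBMDP.aemeasurable_trajLaw π u
  rw [← M.map_decode_trajLaw α π] at hu ⊢
  have hm := measurable_decode (A := A) (M.trueDecoder α)
  rw [M.restrict_trajLaw_congr (π.comp f) (π.comp (M.trueDecoder α)) hG fun x hx l a => by
    simp [Policy.comp, BMDP.trueDecoder, h x hx]]
  have hcongr : (fun τ => u (decode f τ)) =ᵐ[(M.trajLaw (π.comp (M.trueDecoder α))).restrict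
      {τ | τ.1 ∈ G}] fun τ => u (decode (M.trueDecoder α) τ) := by
    filter_upwards [ae_restrict_mem hG'] with τ hτ
    congr 1
    exact Prod.ext (funext fun l => h τ.1 hτ l) rfl
  have hcomp := hu.comp_measurable hm
  refine ⟨(hcomp.mono_measure Measure.restrict_le_self).congr hcongr.symm, ?_⟩
  rw [lintegral_congr_ae hcongr, lintegral_map' hu hm.aemeasurable]
  exact lintegral_mono' Measure.restrict_le_self le_rfl

end Relabel

/-! ### The matching of labels -/

section FixLabel

variable {S X : Type} [Fintype S] [MeasurableSpace S] [DiscreteMeasurableSpace S]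
  [MeasurableSpace X] {B : ℕ}

open Classical in
-- The exact share is immaterial as long as it is at least one half; uniqueness makes the choice in
-- `fixOne` unambiguous.
theorem IsMajority.unique {f : Decoder S X} {D : DataSet X B} {s s' : S}
    (h : IsMajority f D s) (h' : IsMajority f D s') : s = s' := by
  by_contra hne
  unfold IsMajority at h h'
  have hd : Disjoint (D.kept.filter fun j => f.1 (D.points j) = s)
      (D.kept.filter fun j => f.1 (D.points j) = s') :=
    Finset.disjoint_filter.2 fun j _ h1 h2 => hne (h1.symm.trans h2)
  have h1 := Finset.card_le_card (Finset.union_subset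
    (Finset.filter_subset (fun j => f.1 (D.points j) = s) D.kept)
    (Finset.filter_subset (fun j => f.1 (D.points j) = s') D.kept))
  rw [Finset.card_union_of_disjoint hd] at h1
  have h2 : ((D.kept.filter fun j => f.1 (D.points j) = s).card : ℝ) +
      ((D.kept.filter fun j => f.1 (D.points j) = s').card : ℝ) ≤ D.kept.card := by
    exact_mod_cast h1
  have h0 : (0 : ℝ) ≤ D.kept.card := by positivity
  linarith

theorem fixOne_none {Z : S → Option (DataSet X B)} {s : S} (hZ : Z s = none) (f : Decoder S X) :
    fixOne Z f s = f := by
  simp [fixOne, hZ]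

open Classical in
theorem fixOne_some {Z : S → Option (DataSet X B)} {s s' : S} {D : DataSet X B}
    (hZ : Z s = some D) {f : Decoder S X} (h : IsMajority f D s') (x : X) :
    (fixOne Z f s).1 x = Equiv.swap s s' (f.1 x) := by
  have hex : ∃ s', IsMajority f D s' := ⟨s', h⟩
  have e : hex.choose = s' := IsMajority.unique hex.choose_spec h
  simp only [fixOne, hZ]
  rw [dif_pos hex, e]
  rfl

open Classical in
theorem IsMajority.comp_perm {f g : Decoder S X} {D : DataSet X B} {γ : Equiv.Perm S} {s : S}
    (hg : ∀ x, g.1 x = γ (f.1 x)) (h : IsMajority f D s) : IsMajority g D (γ s) := by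
  have e : (D.kept.filter fun j => g.1 (D.points j) = γ s) =
      D.kept.filter fun j => f.1 (D.points j) = s :=
    Finset.filter_congr fun j _ => by rw [hg]; exact γ.injective.eq_iff
  unfold IsMajority at h ⊢
  rwa [e]

/-- The accumulated permutation γ sends the majority label `σ s` to `s` for every confirmed `s`
already processed. The swap of s₀ and γ(σ s₀) does not move such an `s`, because s ≠ s₀ and s = γ(σ
s) ≠ γ(σ s₀) by injectivity. Hence the order of the labels is irrelevant. -/
theorem exists_perm_foldl_fixOne {Z : S → Option (DataSet X B)} (f : Decoder S X) (σ : S → S)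
    (hmaj : ∀ s D, Z s = some D → IsMajority f D (σ s))
    (hinj : ∀ s s', Z s ≠ none → Z s' ≠ none → σ s = σ s' → s = s') :
    ∀ (l : List S) (P : Set S) (g : Decoder S X) (γ : Equiv.Perm S), l.Nodup → (∀ s ∈ l, s ∉ P) →
      (∀ x, g.1 x = γ (f.1 x)) → (∀ s ∈ P, Z s ≠ none → γ (σ s) = s) →
      ∃ γ' : Equiv.Perm S, (∀ x, (l.foldl (fixOne Z) g).1 x = γ' (f.1 x)) ∧
        ∀ s, s ∈ P ∨ s ∈ l → Z s ≠ none → γ' (σ s) = s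
  | [], P, g, γ, _, _, hg, hP => ⟨γ, hg, fun s hs hZ => hP s (by simpa using hs) hZ⟩
  | s₀ :: l, P, g, γ, hl, hlP, hg, hP => by
    classical
    rw [List.foldl_cons]
    have hl' := List.nodup_cons.1 hl
    have hrec : ∀ (g' : Decoder S X) (γ' : Equiv.Perm S), (∀ x, g'.1 x = γ' (f.1 x)) →
        (∀ s ∈ insert s₀ P, Z s ≠ none → γ' (σ s) = s) →
        ∃ γ'' : Equiv.Perm S, (∀ x, (l.foldl (fixOne Z) g').1 x = γ'' (f.1 x)) ∧
          ∀ s, s ∈ P ∨ s ∈ s₀ :: l → Z s ≠ none → γ'' (σ s) = s := by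
      intro g' γ' h1 h2
      obtain ⟨γ'', h3, h4⟩ := exists_perm_foldl_fixOne f σ hmaj hinj l (insert s₀ P) g' γ' hl'.2
        (fun s hs hs' => by
          rcases hs' with rfl | hs'
          · exact hl'.1 hs
          · exact hlP s (List.mem_cons_of_mem _ hs) hs') h1 h2
      refine ⟨γ'', h3, fun s hs => h4 s ?_⟩
      rcases hs with hs | hs
      · exact Or.inl (Or.inr hs)
      · rcases List.mem_cons.1 hs with rfl | hs
        · exact Or.inl (Or.inl rfl)
        · exact Or.inr hs
    rcases hZ : Z s₀ with _ | D
    · rw [fixOne_none hZ]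
      refine hrec g γ hg fun s hs hs' => ?_
      rcases hs with rfl | hs
      · exact absurd hZ hs'
      · exact hP s hs hs'
    · have hm : IsMajority g D (γ (σ s₀)) := (hmaj s₀ D hZ).comp_perm hg
      refine hrec _ (γ.trans (Equiv.swap s₀ (γ (σ s₀)))) (fun x => ?_) fun s hs hs' => ?_
      · rw [fixOne_some hZ hm, hg]
        simp only [Equiv.trans_apply]
      · rcases hs with rfl | hs
        · simp
        · have h1 := hP s hs hs'
          rw [Equiv.trans_apply, h1]
          refine Equiv.swap_apply_of_ne_of_ne ?_ ?_
          · rintro rfl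
            exact hlP s List.mem_cons_self hs
          · intro hc
            have h2 : σ s = σ s₀ := γ.injective (h1.trans hc)
            have h3 := hinj s s₀ hs' (by simp [hZ]) h2
            subst h3
            exact hlP s List.mem_cons_self hs

theorem exists_perm_fixLabel {Z : S → Option (DataSet X B)} (f : Decoder S X) (σ : S → S)
    (hmaj : ∀ s D, Z s = some D → IsMajority f D (σ s))
    (hinj : ∀ s s', Z s ≠ none → Z s' ≠ none → σ s = σ s' → s = s') :
    ∃ γ : Equiv.Perm S, (∀ x, ((Finset.univ : Finset S).toList.foldl (fixOne Z) f).1 x =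
      γ (f.1 x)) ∧ ∀ s, Z s ≠ none → γ (σ s) = s := by
  obtain ⟨γ, h1, h2⟩ := exists_perm_foldl_fixOne f σ hmaj hinj Finset.univ.toList ∅ f
    (Equiv.refl S) (Finset.nodup_toList _) (by simp) (fun x => rfl) (by simp)
  exact ⟨γ, h1, fun s => h2 s (by simp)⟩

end FixLabel

/-! ### The invariant of the trajectory sampling routine -/

section Invariant

variable {S A X : Type} [Fintype S] [MeasurableSpace S] [DiscreteMeasurableSpace S]
  [Fintype A] [MeasurableSpace A] [MeasurableSpace X] {H : ℕ}

/-- The fraction of the test observations that confirms a label. -/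
def Params.threshold (c : Params) : ℝ := 3 * c.ϵ * Real.log (c.δ₁⁻¹)

/-- The probability that the state at level `h` is `t`. -/
def BMDP.occupancy (M : BMDP S A X H) (φ : Policy X A H) (h : Fin (H + 1)) (t : S) : ℝ≥0∞ :=
  M.trajLaw φ {τ | M.f (τ.1 h) = t}

theorem BMDP.sum_occupancy (M : BMDP S A X H) (φ : Policy X A H) (h : Fin (H + 1)) :
    ∑ t, M.occupancy φ h t = 1 := by
  have h1 := M.isMixture_trajLaw φ h Set.univ MeasurableSet.univ
  simpa [BMDP.occupancy] using h1.symm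

open Classical in
/-- The points and seeds for which the learner finds a function that decodes the state `t` as a
constant with high accuracy, and yet mislabels many points in the block of `t`. -/
def staleSet (M : BMDP S A X H) (U : Learner S X) (c : Params) (n : ℕ) (t : S) :
    Set ((Fin c.B → X) × (Seed × (Fin n → X))) :=
  {p | ∃ s', M.q t {x | U.learn c.δ₁ n p.2.1 p.2.2 x ≠ s'} ≤ ENNReal.ofReal (c.threshold / 10) ∧
    c.threshold * c.B / 5 ≤ ((Finset.univ.filter fun j => M.f (p.1 j) = t ∧
      U.learn c.δ₁ n p.2.1 p.2.2 (p.1 j) ≠ s').card : ℝ)}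

/-- The points are unlikely to be mislabelled, in the sense of `staleSet`, whatever the mixture is
from which the learner obtains its sample. -/
def GoodPoints (M : BMDP S A X H) (U : Learner S X) (c : Params) (T : ℕ) (y : Fin c.B → X) :
    Prop :=
  ∀ i < T, ∀ t, ((volume : Measure Seed).prod (universalLaw M.q ((i + 1) * c.B)))
    {z | (y, z) ∈ staleSet M U c ((i + 1) * c.B) t} ≤
      ENNReal.ofReal (Real.exp (-(c.B * c.threshold ^ 2 / 100)))

open Classical in
/-- Most points of the data set belong to the block of `t`. -/
def Anchors (M : BMDP S A X H) (c : Params) (D : DataSet X c.B) (t : S) : Prop :=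
  c.threshold * c.B ≤ (D.kept.card : ℝ) ∧
    ((D.kept.filter fun j => M.f (D.points j) ≠ t).card : ℝ) < c.threshold * c.B / 10

open Classical in
-- If t ≠ t', every point misses one of the two blocks, and two exceptional sets of fewer than θB/10
-- points would have to cover at least θB points.
theorem Anchors.unique {M : BMDP S A X H} {c : Params} {D : DataSet X c.B} {t t' : S}
    (h : Anchors M c D t) (h' : Anchors M c D t') : t = t' := by
  by_contra hne
  unfold Anchors at h h'
  have h1 : D.kept.card ≤ (D.kept.filter fun j => M.f (D.points j) ≠ t).card +
      (D.kept.filter fun j => M.f (D.points j) ≠ t').card := by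
    refine le_trans (Finset.card_le_card fun j hj => ?_) (Finset.card_union_le _ _)
    simp only [Finset.mem_union, Finset.mem_filter, hj, true_and]
    by_contra hc
    push Not at hc
    exact hne (hc.1.symm.trans hc.2)
  have h2 : (D.kept.card : ℝ) ≤ (D.kept.filter fun j => M.f (D.points j) ≠ t).card +
      (D.kept.filter fun j => M.f (D.points j) ≠ t').card := by exact_mod_cast h1
  have h0 : (0 : ℝ) ≤ ((D.kept.filter fun j => M.f (D.points j) ≠ t).card : ℝ) := by positivity
  linarith [h.1, h.2, h'.1, h'.2]

/-- The memory after `n` iterations: each confirmed label belongs to a state that some earlier policy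
visits and that is decoded to this label, up to a small error. -/
structure Invariant (M : BMDP S A X H) (U : Learner S X) (c : Params) (T n : ℕ)
    (m : Memory S A X H c.B) : Prop where
  length : m.policies.length = n
  confirmed : ∀ h s D, m.standard h s = some D → ∃ t, Anchors M c D t ∧
    GoodPoints M U c T D.points ∧
    (∃ φ ∈ m.policies, ENNReal.ofReal (c.threshold / 2) ≤ M.occupancy φ h t) ∧
    M.q t {x | (m.decoders h).1 x ≠ s} ≤ ENNReal.ofReal (c.threshold / 10)

/-- The permutations of the states that match the confirmed labels with their states. -/
def Consistent (M : BMDP S A X H) (c : Params) (Z : Standard S X H c.B)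
    (α : Fin (H + 1) → Equiv.Perm S) : Prop :=
  ∀ h s D, Z h s = some D → Anchors M c D ((α h).symm s)

/-- `Z'` contains the data sets of `Z`. -/
def Extends {B : ℕ} (Z Z' : Standard S X H B) : Prop := ∀ h s D, Z h s = some D → Z' h s = some D

theorem Extends.trans {B : ℕ} {Z Z' Z'' : Standard S X H B} (h : Extends Z Z')
    (h' : Extends Z' Z'') : Extends Z Z'' := fun l s D hD => h' l s D (h l s D hD)

theorem Extends.eq_none {B : ℕ} {Z Z' : Standard S X H B} (h : Extends Z Z') {l : Fin (H + 1)}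
    {s : S} (hs : Z' l s = none) : Z l s = none := by
  rcases hZ : Z l s with _ | D
  · rfl
  · rw [h l s D hZ] at hs
    cases hs

theorem Consistent.anti {M : BMDP S A X H} {c : Params} {Z Z' : Standard S X H c.B}
    (h : Extends Z Z') {α : Fin (H + 1) → Equiv.Perm S} (hα : Consistent M c Z' α) :
    Consistent M c Z α := fun l s D hD => hα l s D (h l s D hD)

/-- The policy `π`, applied to correctly decoded observations, is unlikely to meet a state whose
label is not confirmed. -/
def Safe (M : BMDP S A X H) (c : Params) (π : Policy S A H) (Z : Standard S X H c.B) : Prop :=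
  ∀ α, Consistent M c Z α →
    M.trajLaw (π.comp (M.trueDecoder α)) {τ | ∃ h, Z h (α h (M.f (τ.1 h))) = none} ≤
      ENNReal.ofReal ((H + 1) * (2 * Fintype.card S * c.threshold + c.threshold / 10))

/-- Safety is formulated with the true decoding function, so it survives the replacement of the
learned decoders in later iterations. -/
theorem Safe.mono {M : BMDP S A X H} {c : Params} {π : Policy S A H} {Z Z' : Standard S X H c.B}
    (h : Extends Z Z') (hs : Safe M c π Z) : Safe M c π Z' := by
  refine fun α hα => le_trans (measure_mono ?_) (hs α (hα.anti h))
  rintro τ ⟨l, hl⟩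
  exact ⟨l, h.eq_none hl⟩

theorem Invariant.exists_consistent {M : BMDP S A X H} {U : Learner S X} {c : Params} {T n : ℕ}
    {m : Memory S A X H c.B} (hm : Invariant M U c T n m) (hθ : c.threshold ≤ 1) :
    ∃ α, Consistent M c m.standard α := by
  classical
  have hlevel : ∀ h, ∃ α : Equiv.Perm S, ∀ s D, m.standard h s = some D →
      Anchors M c D (α.symm s) := by
    intro h
    have hex : ∀ s, ∃ t, ∀ D, m.standard h s = some D → Anchors M c D t ∧
        M.q t {x | (m.decoders h).1 x ≠ s} ≤ ENNReal.ofReal (c.threshold / 10) := by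
      intro s
      rcases hs : m.standard h s with _ | D
      · exact ⟨s, by simp⟩
      · obtain ⟨t, h1, _, _, h4⟩ := hm.confirmed h s D hs
        exact ⟨t, fun D' hD' => by cases hD'; exact ⟨h1, h4⟩⟩
    choose σ hσ using hex
    -- Two labels for one state would each be output on its block with probability at least 1 -
    -- θ/10, which is impossible since 2θ/10 < 1.
    have hinj : Set.InjOn σ {s | m.standard h s ≠ none} := by
      intro s hs s' hs' heq
      obtain ⟨D, hD⟩ := Option.ne_none_iff_exists'.1 hs
      obtain ⟨D', hD'⟩ := Option.ne_none_iff_exists'.1 hs'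
      by_contra hne
      have h1 := (hσ s D hD).2
      have h2 := (hσ s' D' hD').2
      rw [← heq] at h2
      have h3 : M.q (σ s) Set.univ ≤ ENNReal.ofReal (c.threshold / 10) +
          ENNReal.ofReal (c.threshold / 10) := by
        refine le_trans (measure_mono fun x _ => ?_) ((measure_union_le _ _).trans
          (add_le_add h1 h2))
        by_contra hc
        simp only [Set.mem_union, Set.mem_ofPred_eq, not_or, not_not] at hc
        exact hne (hc.1.symm.trans hc.2)
      rw [measure_univ] at h3
      have h4 : ENNReal.ofReal (c.threshold / 10) ≤ ENNReal.ofReal (1 / 10) :=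
        ENNReal.ofReal_le_ofReal (by linarith)
      have h5 := h3.trans (add_le_add h4 h4)
      rw [← ENNReal.ofReal_add (by norm_num) (by norm_num), ← ENNReal.ofReal_one,
        ENNReal.ofReal_le_ofReal_iff (by norm_num)] at h5
      norm_num at h5
    -- The injection from confirmed labels to states is extended arbitrarily to the other labels;
    -- this freedom is the reason why several α can be consistent.
    obtain ⟨e, he⟩ := Set.MapsTo.exists_equiv_extend_of_card_eq (α := S) (β := S)
      (t := Finset.univ) Finset.card_univ.symm (fun x _ => Finset.mem_coe.2 (Finset.mem_univ (σ x))) hinj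
    let e' : Equiv.Perm S := e.trans (Equiv.subtypeUnivEquiv fun x => Finset.mem_univ x)
    refine ⟨e'.symm, fun s D hD => ?_⟩
    have : e'.symm.symm s = σ s := he s (by simp [hD])
    rw [this]
    exact (hσ s D hD).1
  choose α hα using hlevel
  exact ⟨α, fun h s D hD => hα h s D hD⟩

/-- The observations at which the states of confirmed labels are decoded correctly up to `α`. -/
def correctSet (M : BMDP S A X H) {B : ℕ} (Z : Standard S X H B) (f : Fin (H + 1) → Decoder S X)
    (α : Fin (H + 1) → Equiv.Perm S) : Set (Fin (H + 1) → X) :=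
  {x | ∀ h, Z h (α h (M.f (x h))) ≠ none ∧ (f h).1 (x h) = α h (M.f (x h))}

theorem measurableSet_correctSet (M : BMDP S A X H) {B : ℕ} (Z : Standard S X H B)
    (f : Fin (H + 1) → Decoder S X) (α : Fin (H + 1) → Equiv.Perm S) :
    MeasurableSet (correctSet M Z f α) := by
  have h1 : correctSet M Z f α = ⋂ h, (fun x : Fin (H + 1) → X => (M.f (x h), (f h).1 (x h))) ⁻¹'
      {p | Z h (α h p.1) ≠ none ∧ p.2 = α h p.1} := by ext; simp [correctSet]
  rw [h1]
  refine MeasurableSet.iInter fun h => ?_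
  exact ((M.measurable_f.comp (measurable_pi_apply h)).prodMk
    ((f h).2.comp (measurable_pi_apply h))) (MeasurableSet.of_discrete)

/-- Consistent permutations agree on states with confirmed labels, by uniqueness of anchors. By
symmetry the set is the same for all of them, so that one event serves all α. -/
theorem Consistent.correctSet_subset {M : BMDP S A X H} {c : Params} {Z : Standard S X H c.B}
    {f : Fin (H + 1) → Decoder S X} {α α' : Fin (H + 1) → Equiv.Perm S}
    (hα : Consistent M c Z α) (hα' : Consistent M c Z α') :
    correctSet M Z f α ⊆ correctSet M Z f α' := by
  intro x hx h
  obtain ⟨h1, h2⟩ := hx h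
  obtain ⟨D, hD⟩ := Option.ne_none_iff_exists'.1 h1
  have h3 := (hα h _ D hD).unique (hα' h _ D hD)
  rw [Equiv.symm_apply_apply] at h3
  have h4 : α' h (M.f (x h)) = α h (M.f (x h)) := by
    nth_rewrite 1 [h3]
    rw [Equiv.apply_symm_apply]
  rw [h4]
  exact ⟨h1, h2⟩

theorem BMDP.trajLaw_compl_congr (M : BMDP S A X H) (φ ψ : Policy X A H)
    {G : Set (Fin (H + 1) → X)} (hG : MeasurableSet G)
    (h : ∀ x ∈ G, ∀ l a, φ.act l (x l.castSucc) a = ψ.act l (x l.castSucc) a) :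
    M.trajLaw φ {τ | τ.1 ∉ G} = M.trajLaw ψ {τ | τ.1 ∉ G} := by
  have hG' : MeasurableSet {τ : Trajectory X A H | τ.1 ∈ G} := measurable_fst hG
  have h1 := M.trajLaw_inter_congr φ ψ hG h MeasurableSet.univ
  rw [Set.univ_inter] at h1
  change M.trajLaw φ {τ | τ.1 ∈ G}ᶜ = M.trajLaw ψ {τ | τ.1 ∈ G}ᶜ
  rw [prob_compl_eq_one_sub hG', prob_compl_eq_one_sub hG', h1]

theorem trajLaw_compl_correctSet (M : BMDP S A X H) {B : ℕ} (Z : Standard S X H B)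
    (f : Fin (H + 1) → Decoder S X) (α : Fin (H + 1) → Equiv.Perm S) (π : Policy S A H) :
    M.trajLaw (π.comp f) {τ | τ.1 ∉ correctSet M Z f α} =
      M.trajLaw (π.comp (M.trueDecoder α)) {τ | τ.1 ∉ correctSet M Z f α} :=
  M.trajLaw_compl_congr _ _ (measurableSet_correctSet M Z f α) fun x hx l a => by
    simp [Policy.comp, BMDP.trueDecoder, (hx l.castSucc).2]

theorem Invariant.misdecode_le {M : BMDP S A X H} {U : Learner S X} {c : Params} {T n : ℕ}
    {m : Memory S A X H c.B} (hm : Invariant M U c T n m) {α : Fin (H + 1) → Equiv.Perm S}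
    (hα : Consistent M c m.standard α) (φ : Policy X A H) (h : Fin (H + 1)) :
    M.trajLaw φ {τ | m.standard h (α h (M.f (τ.1 h))) ≠ none ∧
      (m.decoders h).1 (τ.1 h) ≠ α h (M.f (τ.1 h))} ≤ ENNReal.ofReal (c.threshold / 10) := by
  classical
  have hE : MeasurableSet {x | m.standard h (α h (M.f x)) ≠ none ∧
      (m.decoders h).1 x ≠ α h (M.f x)} :=
    (M.measurable_f.prodMk (m.decoders h).2)
      (MeasurableSet.of_discrete (s := {p : S × S | m.standard h (α h p.1) ≠ none ∧
        p.2 ≠ α h p.1}))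
  refine (M.isMixture_trajLaw φ h _ hE).trans_le ?_
  calc ∑ s, M.trajLaw φ {τ | M.f (τ.1 h) = s} * M.q s {x | m.standard h (α h (M.f x)) ≠ none ∧
          (m.decoders h).1 x ≠ α h (M.f x)}
      ≤ ∑ s, M.occupancy φ h s * ENNReal.ofReal (c.threshold / 10) := by
        refine Finset.sum_le_sum fun s _ => ?_
        refine mul_le_mul_right ?_ _
        rcases hD : m.standard h (α h s) with _ | D
        · refine (measure_mono_null ?_ (ae_iff.1 (M.ae_f_eq s))).trans_le zero_le
          rintro x ⟨h1, _⟩ hx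
          simp only [hx, hD, ne_eq, not_true_eq_false] at h1
        · obtain ⟨t, h1, _, _, h4⟩ := hm.confirmed h _ D hD
          have h5 := (hα h _ D hD).unique h1
          rw [Equiv.symm_apply_apply] at h5
          subst h5
          refine le_trans (measure_mono_ae ?_) h4
          filter_upwards [M.ae_f_eq s] with x hx hx'
          have := hx'.2
          rwa [hx] at this
    _ = ENNReal.ofReal (c.threshold / 10) := by
        rw [← Finset.sum_mul, M.sum_occupancy, one_mul]

/-- Leaving `correctSet` is equally likely under π ∘ f and under π with the true decoder, so it can
be estimated for the policy that was actually tested: at each level 2θ per unconfirmed state, and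
θ/10 for misdecoding. -/
theorem Invariant.safe {M : BMDP S A X H} {U : Learner S X} {c : Params} {T n : ℕ}
    {m : Memory S A X H c.B} (hm : Invariant M U c T n m) (hθ : 0 ≤ c.threshold)
    (π : Policy S A H)
    {α' : Fin (H + 1) → Equiv.Perm S} (hα' : Consistent M c m.standard α')
    (hocc : ∀ h t, m.standard h (α' h t) = none →
      M.occupancy (π.comp m.decoders) h t ≤ ENNReal.ofReal (2 * c.threshold)) :
    Safe M c π m.standard := by
  classical
  intro α hα
  have h0 : M.trajLaw (π.comp (M.trueDecoder α))
      {τ | ∃ h, m.standard h (α h (M.f (τ.1 h))) = none} ≤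
      M.trajLaw (π.comp m.decoders) {τ | τ.1 ∉ correctSet M m.standard m.decoders α} := by
    rw [trajLaw_compl_correctSet]
    refine measure_mono ?_
    rintro τ ⟨h, hh⟩ hc
    exact (hc h).1 hh
  refine h0.trans ?_
  have hnone : ∀ h s, m.standard h (α h s) = none → m.standard h (α' h s) = none := by
    intro h s hs
    by_contra hc
    obtain ⟨D, hD⟩ := Option.ne_none_iff_exists'.1 hc
    have h1 := (hα h _ D hD).unique (hα' h _ D hD)
    rw [Equiv.symm_apply_apply, Equiv.symm_apply_eq] at h1
    rw [← h1, hD] at hs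
    cases hs
  calc M.trajLaw (π.comp m.decoders) {τ | τ.1 ∉ correctSet M m.standard m.decoders α}
      ≤ M.trajLaw (π.comp m.decoders) (⋃ h ∈ (Finset.univ : Finset (Fin (H + 1))),
          ((⋃ t ∈ (Finset.univ.filter fun t => m.standard h (α h t) = none),
            {τ : Trajectory X A H | M.f (τ.1 h) = t}) ∪
          {τ | m.standard h (α h (M.f (τ.1 h))) ≠ none ∧
            (m.decoders h).1 (τ.1 h) ≠ α h (M.f (τ.1 h))})) := by
        refine measure_mono fun τ hτ => ?_
        simp only [correctSet, Set.mem_ofPred_eq, not_forall, not_and_or] at hτ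
        obtain ⟨h, hh⟩ := hτ
        simp only [Set.mem_iUnion, Set.mem_union, Finset.mem_univ, Finset.mem_filter, true_and,
          Set.mem_ofPred_eq, exists_prop]
        refine ⟨h, ?_⟩
        by_cases hn : m.standard h (α h (M.f (τ.1 h))) = none
        · exact Or.inl ⟨_, hn, rfl⟩
        · exact Or.inr ⟨hn, by tauto⟩
    _ ≤ ∑ _h : Fin (H + 1), ((∑ _t : S, ENNReal.ofReal (2 * c.threshold)) +
          ENNReal.ofReal (c.threshold / 10)) := by
        refine (measure_biUnion_finset_le _ _).trans (Finset.sum_le_sum fun h _ => ?_)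
        refine (measure_union_le _ _).trans (add_le_add ?_ (hm.misdecode_le hα _ h))
        refine (measure_biUnion_finset_le _ _).trans ?_
        refine le_trans (Finset.sum_le_sum fun t ht => ?_)
          (Finset.sum_le_sum_of_subset (Finset.subset_univ _))
        exact hocc h t (hnone h t (Finset.mem_filter.1 ht).2)
    _ = ENNReal.ofReal ((H + 1) * (2 * Fintype.card S * c.threshold + c.threshold / 10)) := by
        simp only [Finset.sum_const, Finset.card_univ, Fintype.card_fin, nsmul_eq_mul]
        rw [show ((H : ℝ) + 1) * (2 * Fintype.card S * c.threshold + c.threshold / 10) =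
            ((H + 1 : ℕ) : ℝ) * (Fintype.card S * (2 * c.threshold) + c.threshold / 10) by
          push_cast; ring, ENNReal.ofReal_mul (Nat.cast_nonneg _), ENNReal.ofReal_natCast,
          ENNReal.ofReal_add (by positivity) (by positivity),
          ENNReal.ofReal_mul (p := (Fintype.card S : ℝ)) (Nat.cast_nonneg _),
          ENNReal.ofReal_natCast]

/-- When the sampling routine is safe, the policy `π ∘ f` meets only states that are decoded
correctly, up to a small probability. -/
theorem Invariant.trajLaw_compl_correctSet_le {M : BMDP S A X H} {U : Learner S X} {c : Params}
    {T n : ℕ} {m : Memory S A X H c.B} (hm : Invariant M U c T n m) (hθ : 0 ≤ c.threshold)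
    {π : Policy S A H} (hs : Safe M c π m.standard) {α : Fin (H + 1) → Equiv.Perm S}
    (hα : Consistent M c m.standard α) :
    M.trajLaw (π.comp m.decoders) {τ | τ.1 ∉ correctSet M m.standard m.decoders α} ≤
      ENNReal.ofReal ((H + 1) * (3 * Fintype.card S * c.threshold)) := by
  classical
  have hS : (1 : ℝ) ≤ Fintype.card S := by
    have : Nonempty S := ⟨M.init⟩
    exact_mod_cast Fintype.card_pos
  rw [trajLaw_compl_correctSet]
  calc M.trajLaw (π.comp (M.trueDecoder α)) {τ | τ.1 ∉ correctSet M m.standard m.decoders α}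
      ≤ M.trajLaw (π.comp (M.trueDecoder α))
          ({τ | ∃ h, m.standard h (α h (M.f (τ.1 h))) = none} ∪
            ⋃ h ∈ (Finset.univ : Finset (Fin (H + 1))),
              {τ | m.standard h (α h (M.f (τ.1 h))) ≠ none ∧
                (m.decoders h).1 (τ.1 h) ≠ α h (M.f (τ.1 h))}) := by
        refine measure_mono fun τ hτ => ?_
        simp only [correctSet, Set.mem_ofPred_eq, not_forall, not_and_or] at hτ
        obtain ⟨h, hh⟩ := hτ
        simp only [Set.mem_iUnion, Set.mem_union, Finset.mem_univ, Set.mem_ofPred_eq,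
          exists_prop, true_and]
        by_cases hn : m.standard h (α h (M.f (τ.1 h))) = none
        · exact Or.inl ⟨h, hn⟩
        · exact Or.inr ⟨h, hn, by tauto⟩
    _ ≤ ENNReal.ofReal ((H + 1) * (2 * Fintype.card S * c.threshold + c.threshold / 10)) +
          ∑ _h : Fin (H + 1), ENNReal.ofReal (c.threshold / 10) := by
        refine (measure_union_le _ _).trans (add_le_add (hs α hα) ?_)
        exact (measure_biUnion_finset_le _ _).trans
          (Finset.sum_le_sum fun h _ => hm.misdecode_le hα _ h)
    _ = ENNReal.ofReal ((H + 1) * (2 * Fintype.card S * c.threshold + c.threshold / 10) +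
          (H + 1) * (c.threshold / 10)) := by
        rw [ENNReal.ofReal_add (by positivity) (by positivity)]
        congr 1
        rw [ENNReal.ofReal_mul (by positivity), ENNReal.ofReal_add (by positivity)
          (by positivity)]
        simp
    _ ≤ _ := by
        apply ENNReal.ofReal_le_ofReal
        have : c.threshold ≤ Fintype.card S * c.threshold := le_mul_of_one_le_left hθ hS
        have hH : (0 : ℝ) ≤ H + 1 := by positivity
        nlinarith

end Invariant

/-! ### One iteration of the sampling routine: a new label or a safe policy -/

section Step

variable {S A X : Type} [Fintype S] [MeasurableSpace S] [DiscreteMeasurableSpace S]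
  [Fintype A] [MeasurableSpace A] [MeasurableSpace X] {H : ℕ}

theorem updateStandard_some {c : Params} {f : Fin (H + 1) → Decoder S X}
    {D : Fin c.B → Trajectory X A H} {Z : Standard S X H c.B} {h : Fin (H + 1)} {s : S}
    {D' : DataSet X c.B} (hZ : Z h s = some D') : updateStandard c f D Z h s = some D' := by
  simp [updateStandard, hZ]

open Classical in
theorem updateStandard_none {c : Params} {f : Fin (H + 1) → Decoder S X}
    {D : Fin c.B → Trajectory X A H} {Z : Standard S X H c.B} {h : Fin (H + 1)} {s : S}
    (hZ : Z h s = none) : updateStandard c f D Z h s =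
      if c.threshold * c.B ≤
          ((Finset.univ.filter fun j => (f h).1 ((D j).1 h) = s).card : ℝ) then
        some ⟨fun j => (D j).1 h, Finset.univ.filter fun j => (f h).1 ((D j).1 h) = s⟩
      else none := by
  have e : 3 * c.ϵ * c.B * Real.log (c.δ₁⁻¹) = c.threshold * c.B := by
    rw [Params.threshold]; ring
  simp only [updateStandard, hZ, e]

/-- What a learned decoding function `g` at level `h`, with the permutation `α` for which it is
accurate, and the test observations `y` have to satisfy. -/
structure GoodStep (M : BMDP S A X H) (U : Learner S X) (c : Params) (T : ℕ) (φ : Policy X A H)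
    (m : Memory S A X H c.B) (y : Fin c.B → X) (h : Fin (H + 1)) (g : Decoder S X)
    (α : Equiv.Perm S) : Prop where
  accurate : ∀ ψ ∈ φ :: m.policies, ∀ t, M.occupancy ψ h t * M.q t {x | g.1 x ≠ α t} ≤
    ENNReal.ofReal (c.threshold ^ 2 / 20)
  not_stale : ∀ s D', m.standard h s = some D' → ∀ t s',
    M.q t {x | g.1 x ≠ s'} ≤ ENNReal.ofReal (c.threshold / 10) →
    ({j | M.f (D'.points j) = t ∧ g.1 (D'.points j) ≠ s'}.ncard : ℝ) < c.threshold * c.B / 5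
  test_error : ({j | g.1 (y j) ≠ α (M.f (y j))}.ncard : ℝ) < c.threshold * c.B / 10
  rare : ∀ t, M.occupancy φ h t < ENNReal.ofReal (c.threshold / 2) →
    ({j | M.f (y j) = t}.ncard : ℝ) < 9 / 10 * (c.threshold * c.B)
  frequent : ∀ t, ENNReal.ofReal (2 * c.threshold) < M.occupancy φ h t →
    11 / 10 * (c.threshold * c.B) < ({j | M.f (y j) = t}.ncard : ℝ)
  goodPoints : GoodPoints M U c T y

/-- The accuracy splits as θ²/20 = (θ/2)(θ/10), and the first factor cancels against the occupancy.
-/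
theorem GoodStep.error_le {M : BMDP S A X H} {U : Learner S X} {c : Params} {T : ℕ}
    {φ : Policy X A H} {m : Memory S A X H c.B} {y : Fin c.B → X} {h : Fin (H + 1)}
    {g : Decoder S X} {α : Equiv.Perm S} (hg : GoodStep M U c T φ m y h g α)
    (hθ : 0 < c.threshold) {ψ : Policy X A H} (hψ : ψ ∈ φ :: m.policies) {t : S}
    (ht : ENNReal.ofReal (c.threshold / 2) ≤ M.occupancy ψ h t) :
    M.q t {x | g.1 x ≠ α t} ≤ ENNReal.ofReal (c.threshold / 10) := by
  have h1 := (mul_le_mul_left ht _).trans (hg.accurate ψ hψ t)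
  have h2 : ENNReal.ofReal (c.threshold ^ 2 / 20) =
      ENNReal.ofReal (c.threshold / 2) * ENNReal.ofReal (c.threshold / 10) := by
    rw [← ENNReal.ofReal_mul (by positivity)]; congr 1; ring
  rw [h2] at h1
  exact (ENNReal.mul_le_mul_iff_right (by simpa using hθ) (by simp)).1 h1

theorem card_filter_eq_ncard {n : ℕ} (p : Fin n → Prop) [DecidablePred p] :
    (Finset.univ.filter p).card = {j | p j}.ncard := by
  classical
  rw [Set.ncard_eq_toFinset_card']
  congr 1
  ext; simp

open Classical in
-- Of at least θB kept points, fewer than θB/10 lie off the block and fewer than θB/5 are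
-- mislabelled inside it. So more than 7/10 receive the label `α t`, which exceeds the required 3/5.
theorem GoodStep.isMajority {M : BMDP S A X H} {U : Learner S X} {c : Params} {T : ℕ}
    {φ : Policy X A H} {m : Memory S A X H c.B} {y : Fin c.B → X} {h : Fin (H + 1)}
    {g : Decoder S X} {α : Equiv.Perm S} (hg : GoodStep M U c T φ m y h g α)
    (hθB : 0 < c.threshold * c.B) {s t : S} {D' : DataSet X c.B} (hD' : m.standard h s = some D')
    (ht : Anchors M c D' t)
    (hq : M.q t {x | g.1 x ≠ α t} ≤ ENNReal.ofReal (c.threshold / 10)) :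
    IsMajority g D' (α t) := by
  have h1 := hg.not_stale s D' hD' t (α t) hq
  unfold Anchors at ht
  unfold IsMajority
  have h2 : D'.kept.card ≤ (D'.kept.filter fun j => g.1 (D'.points j) = α t).card +
      ((Finset.univ.filter fun j => M.f (D'.points j) = t ∧ g.1 (D'.points j) ≠ α t).card +
      (D'.kept.filter fun j => M.f (D'.points j) ≠ t).card) := by
    refine le_trans (Finset.card_le_card fun j hj => ?_) ((Finset.card_union_le _ _).trans
      (Nat.add_le_add_left (Finset.card_union_le _ _) _))
    simp only [Finset.mem_union, Finset.mem_filter, hj, true_and, Finset.mem_univ]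
    tauto
  have h3 : (D'.kept.card : ℝ) ≤ (D'.kept.filter fun j => g.1 (D'.points j) = α t).card +
      ((Finset.univ.filter fun j => M.f (D'.points j) = t ∧ g.1 (D'.points j) ≠ α t).card +
      (D'.kept.filter fun j => M.f (D'.points j) ≠ t).card) := by exact_mod_cast h2
  simp only [card_filter_eq_ncard] at h3
  linarith [ht.1, ht.2]

/-- The decoding functions of a good step, after the matching of the labels: they agree with
permutations of the learned functions, and are consistent with the confirmed labels. -/
theorem exists_perm_of_goodStep {M : BMDP S A X H} {U : Learner S X} {c : Params} {T n : ℕ}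
    {φ : Policy X A H} {m : Memory S A X H c.B} (hm : Invariant M U c T n m)
    {D : Fin c.B → Trajectory X A H} {g : Fin (H + 1) → Decoder S X}
    {α : Fin (H + 1) → Equiv.Perm S} (hg : ∀ h, GoodStep M U c T φ m (fun j => (D j).1 h) h (g h) (α h))
    (hθ : 0 < c.threshold) (hθB : 0 < c.threshold * c.B) (h : Fin (H + 1)) :
    ∃ γ : Equiv.Perm S, (∀ x, (fixLabel g m.standard h).1 x = γ ((g h).1 x)) ∧
      ∀ s D' t, m.standard h s = some D' → Anchors M c D' t → γ (α h t) = s := by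
  classical
  have hex : ∀ s, ∃ t, ∀ D', m.standard h s = some D' → Anchors M c D' t ∧
      M.q t {x | (m.decoders h).1 x ≠ s} ≤ ENNReal.ofReal (c.threshold / 10) ∧
      M.q t {x | (g h).1 x ≠ α h t} ≤ ENNReal.ofReal (c.threshold / 10) := by
    intro s
    rcases hs : m.standard h s with _ | D'
    · exact ⟨s, by simp⟩
    · obtain ⟨t, h1, _, ⟨ψ, hψ, h3⟩, h4⟩ := hm.confirmed h s D' hs
      refine ⟨t, fun D'' hD'' => ?_⟩
      cases hD''
      exact ⟨h1, h4, (hg h).error_le hθ (List.mem_cons_of_mem _ hψ) h3⟩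
  choose σ hσ using hex
  obtain ⟨γ, h1, h2⟩ := exists_perm_fixLabel (Z := m.standard h) (g h) (fun s => α h (σ s))
    (fun s D' hD' => (hg h).isMajority hθB hD' (hσ s D' hD').1 (hσ s D' hD').2.2) (by
      intro s s' hs hs' heq
      obtain ⟨D1, hD1⟩ := Option.ne_none_iff_exists'.1 hs
      obtain ⟨D2, hD2⟩ := Option.ne_none_iff_exists'.1 hs'
      -- θ ≤ 1 is not assumed, but it follows from the existence of a data set with θB ≤ |kept| ≤ B.
      obtain ⟨D3, hD3⟩ : ∃ β, Consistent M c m.standard β := by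
        by_cases h1 : c.threshold ≤ 1
        · exact hm.exists_consistent h1
        · exfalso
          have h2 := (hσ s D1 hD1).1.1
          have h3 : (D1.kept.card : ℝ) ≤ c.B := by
            have := D1.kept.card_le_univ
            simp only [Fintype.card_fin] at this
            exact_mod_cast this
          have hB : (0 : ℝ) < c.B := (pos_iff_pos_of_mul_pos hθB).1 hθ
          nlinarith
      have e1 := (hσ s D1 hD1).1.unique (hD3 h s D1 hD1)
      have e2 := (hσ s' D2 hD2).1.unique (hD3 h s' D2 hD2)
      have e3 := (α h).injective heq
      rw [e1, e2] at e3
      exact (D3 h).symm.injective e3)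
  refine ⟨γ, h1, fun s D' t hD' ht => ?_⟩
  rw [ht.unique (hσ s D' hD').1]
  exact h2 s (by simp [hD'])

open Classical in
/-- The number of confirmed labels. -/
def numConfirmed {B : ℕ} (Z : Standard S X H B) : ℕ :=
  (Finset.univ.filter fun p : Fin (H + 1) × S => Z p.1 p.2 ≠ none).card

theorem numConfirmed_lt {B : ℕ} {Z Z' : Standard S X H B} (h : Extends Z Z') {l : Fin (H + 1)}
    {s : S} (hs : Z l s = none) (hs' : Z' l s ≠ none) : numConfirmed Z < numConfirmed Z' := by
  classical
  refine Finset.card_lt_card ⟨fun p hp => ?_, fun hsub => ?_⟩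
  · simp only [Finset.mem_filter, Finset.mem_univ, true_and] at hp ⊢
    exact fun hc => hp (h.eq_none hc)
  · have h1 := @hsub (l, s) (by simpa using hs')
    simp [hs] at h1

theorem numConfirmed_lt_numIter {B : ℕ} (Z : Standard S X H B) : numConfirmed Z < numIter S H := by
  classical
  refine Nat.lt_succ_of_le ((Finset.card_le_univ _).trans ?_)
  simp

/-- A good step preserves the invariant. It confirms a new label, or else the current policy is
safe. -/
theorem Invariant.step {M : BMDP S A X H} {U : Learner S X} {c : Params} {T n : ℕ}
    {π : Policy S A H} {m : Memory S A X H c.B} (hm : Invariant M U c T n m)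
    {D : Fin c.B → Trajectory X A H} {g : Fin (H + 1) → Decoder S X}
    {α : Fin (H + 1) → Equiv.Perm S}
    (hg : ∀ h, GoodStep M U c T (π.comp m.decoders) m (fun j => (D j).1 h) h (g h) (α h))
    (hθ : 0 < c.threshold) (hθB : 0 < c.threshold * c.B) :
    Invariant M U c T (n + 1) ⟨π.comp m.decoders :: m.policies,
      updateStandard c (fixLabel g m.standard) D m.standard, fixLabel g m.standard⟩ ∧
    Extends m.standard (updateStandard c (fixLabel g m.standard) D m.standard) ∧
    (numConfirmed m.standard <
      numConfirmed (updateStandard c (fixLabel g m.standard) D m.standard) ∨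
      Safe M c π (updateStandard c (fixLabel g m.standard) D m.standard)) := by
  classical
  choose γ hγ hγs using exists_perm_of_goodStep hm hg hθ hθB
  set f := fixLabel g m.standard with hf
  set Z' := updateStandard c f D m.standard with hZ'
  have hext : Extends m.standard Z' := fun h s D' hD' => updateStandard_some hD'
  have herr : ∀ h s t, γ h (α h t) = s → {x | (f h).1 x ≠ s} = {x | (g h).1 x ≠ α h t} := by
    intro h s t hs
    ext x
    simp only [Set.mem_ofPred_eq, hγ, ← hs, ne_eq, EmbeddingLike.apply_eq_iff_eq]
  have hcons : Consistent M c m.standard fun h => (α h).trans (γ h) := by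
    intro h s D' hD'
    obtain ⟨t, h1, _⟩ := hm.confirmed h s D' hD'
    have h2 := hγs h s D' t hD' h1
    rw [← h2]
    simpa using h1
  have hsub : ∀ h s, ((Finset.univ.filter fun j => (f h).1 ((D j).1 h) = s).filter fun j =>
      M.f ((D j).1 h) ≠ (α h).symm ((γ h).symm s)).card ≤
      {j | (g h).1 ((D j).1 h) ≠ α h (M.f ((D j).1 h))}.ncard := by
    intro h s
    rw [← card_filter_eq_ncard]
    refine Finset.card_le_card fun j hj => ?_
    simp only [Finset.mem_filter, Finset.mem_univ, true_and] at hj ⊢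
    rintro hc
    rw [hγ, hc] at hj
    exact hj.2 (by rw [← hj.1]; simp)
  refine ⟨⟨by simp [hm.length], fun h s D' hD' => ?_⟩, hext, ?_⟩
  · rcases hZ : m.standard h s with _ | D''
    · change Z' h s = some D' at hD'
      rw [hZ', updateStandard_none hZ] at hD'
      split_ifs at hD' with hcard
      simp only [Option.some.injEq] at hD'
      subst hD'
      -- This is the state whose learned name is turned into `s`. At least θB test points are
      -- decoded to `s` and fewer than θB/10 of them lie off the block of `t`, so the block holds
      -- more than 9θB/10 points and `t` cannot be rare.
      set t := (α h).symm ((γ h).symm s) with ht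
      have hγt : γ h (α h t) = s := by simp [ht]
      have h1 : (((Finset.univ.filter fun j => (f h).1 ((D j).1 h) = s).filter fun j =>
          M.f ((D j).1 h) ≠ t).card : ℝ) < c.threshold * c.B / 10 :=
        lt_of_le_of_lt (by exact_mod_cast hsub h s) (hg h).test_error
      have hocc : ENNReal.ofReal (c.threshold / 2) ≤ M.occupancy (π.comp m.decoders) h t := by
        by_contra hc
        have h2 := (hg h).rare t (not_le.1 hc)
        rw [← card_filter_eq_ncard] at h2
        have h3 : (Finset.univ.filter fun j => (f h).1 ((D j).1 h) = s).card ≤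
            (Finset.univ.filter fun j => M.f ((D j).1 h) = t).card +
            ((Finset.univ.filter fun j => (f h).1 ((D j).1 h) = s).filter fun j =>
              M.f ((D j).1 h) ≠ t).card := by
          refine le_trans (Finset.card_le_card fun j hj => ?_) (Finset.card_union_le _ _)
          simp only [Finset.mem_union, Finset.mem_filter, Finset.mem_univ, true_and] at hj ⊢
          tauto
        have h4 : ((Finset.univ.filter fun j => (f h).1 ((D j).1 h) = s).card : ℝ) ≤
            (Finset.univ.filter fun j => M.f ((D j).1 h) = t).card +
            ((Finset.univ.filter fun j => (f h).1 ((D j).1 h) = s).filter fun j =>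
              M.f ((D j).1 h) ≠ t).card := by exact_mod_cast h3
        linarith
      refine ⟨t, ⟨hcard, h1⟩, (hg h).goodPoints, ⟨_, List.mem_cons_self, hocc⟩, ?_⟩
      change M.q t {x | (f h).1 x ≠ s} ≤ _
      rw [herr h s t hγt]
      exact (hg h).error_le hθ List.mem_cons_self hocc
    · have : D'' = D' := Option.some.inj ((hext h s D'' hZ).symm.trans hD')
      subst this
      obtain ⟨t, h1, h2, ⟨ψ, hψ, h3⟩, _⟩ := hm.confirmed h s D'' hZ
      refine ⟨t, h1, h2, ⟨ψ, List.mem_cons_of_mem _ hψ, h3⟩, ?_⟩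
      change M.q t {x | (f h).1 x ≠ s} ≤ _
      rw [herr h s t (hγs h s D'' t hZ h1)]
      exact (hg h).error_le hθ (List.mem_cons_of_mem _ hψ) h3
  · by_cases hnew : ∃ h s, m.standard h s = none ∧ Z' h s ≠ none
    · obtain ⟨h, s, h1, h2⟩ := hnew
      exact Or.inl (numConfirmed_lt hext h1 h2)
    -- An unconfirmed state of occupancy above 2θ would show more than 11θB/10 test points, of which
    -- fewer than θB/10 are misdecoded, so its label would be confirmed now. The tested policy uses
    -- the old decoders, hence safety is derived from the old memory and then carried over.
    · refine Or.inr ((hm.safe hθ.le π hcons fun h t hnone => ?_).mono hext)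
      by_contra hc
      have h1 := (hg h).frequent t (not_le.1 hc)
      have hterr := (hg h).test_error
      refine hnew ⟨h, _, hnone, ?_⟩
      rw [hZ', updateStandard_none hnone, if_pos]
      · simp
      · have h3 : (Finset.univ.filter fun j => M.f ((D j).1 h) = t).card ≤
            (Finset.univ.filter fun j => (f h).1 ((D j).1 h) =
              ((α h).trans (γ h)) t).card +
            (Finset.univ.filter fun j => (g h).1 ((D j).1 h) ≠ α h (M.f ((D j).1 h))).card := by
          refine le_trans (Finset.card_le_card fun j hj => ?_) (Finset.card_union_le _ _)
          simp only [Finset.mem_union, Finset.mem_filter, Finset.mem_univ, true_and] at hj ⊢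
          by_cases h5 : (g h).1 ((D j).1 h) = α h (M.f ((D j).1 h))
          · left
            rw [hγ, h5, hj]
            rfl
          · exact Or.inr h5
        have h4 : ((Finset.univ.filter fun j => M.f ((D j).1 h) = t).card : ℝ) ≤
            (Finset.univ.filter fun j => (f h).1 ((D j).1 h) =
              ((α h).trans (γ h)) t).card +
            (Finset.univ.filter fun j => (g h).1 ((D j).1 h) ≠ α h (M.f ((D j).1 h))).card := by
          exact_mod_cast h3
        simp only [card_filter_eq_ncard] at h4 ⊢
        linarith

end Step

/-! ### The probability of a good step -/

section Level

variable {S A X : Type} [Fintype S] [MeasurableSpace S] [DiscreteMeasurableSpace S]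
  [Fintype A] [MeasurableSpace A] [MeasurableSpace X] {H : ℕ}

theorem measurable_ncard {Ω : Type*} [MeasurableSpace Ω] {n : ℕ} (P : Fin n → Ω → Prop)
    (hP : ∀ j, MeasurableSet {ω | P j ω}) :
    Measurable fun ω => ({j | P j ω}.ncard : ℝ) := by
  classical
  have h : (fun ω => ({j | P j ω}.ncard : ℝ)) = fun ω => ∑ j, if P j ω then (1 : ℝ) else 0 := by
    funext ω
    rw [← card_filter_eq_ncard, Finset.card_filter]
    push_cast
    rfl
  rw [h]
  exact Finset.measurable_sum _ fun j _ => Measurable.ite (hP j) measurable_const measurable_const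

theorem Learner.measurable_learn_comp (U : Learner S X) (δ : ℝ) (n : ℕ) {Ω : Type*}
    [MeasurableSpace Ω] {a : Ω → Seed × (Fin n → X)} {b : Ω → X} (ha : Measurable a)
    (hb : Measurable b) : Measurable fun ω => U.learn δ n (a ω).1 (a ω).2 (b ω) :=
  (U.measurable_learn δ n).comp
    ((measurable_fst.comp ha).prodMk ((measurable_snd.comp ha).prodMk hb))

theorem Learner.measurable_error (U : Learner S X) (q : S → Measure X)
    [∀ s, IsProbabilityMeasure (q s)] (δ : ℝ) (n : ℕ) (t : S) (E : Set S) :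
    Measurable fun z : Seed × (Fin n → X) => q t {x | U.learn δ n z.1 z.2 x ∈ E} :=
  measurable_measure_prodMk_left (ν := q t)
    (U.measurable_learn_comp δ n (Ω := (Seed × (Fin n → X)) × X) measurable_fst measurable_snd
      (MeasurableSet.of_discrete (s := E)))

theorem measurableSet_staleSet (M : BMDP S A X H) (U : Learner S X) (c : Params) (n : ℕ) (t : S) :
    MeasurableSet (staleSet M U c n t) := by
  have h : staleSet M U c n t = ⋃ s', ({p | M.q t {x | U.learn c.δ₁ n p.2.1 p.2.2 x ∈ ({s'}ᶜ : Set S)} ≤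
      ENNReal.ofReal (c.threshold / 10)} ∩ {p | c.threshold * c.B / 5 ≤
        ({j | M.f (p.1 j) = t ∧ U.learn c.δ₁ n p.2.1 p.2.2 (p.1 j) ≠ s'}.ncard : ℝ)}) := by
    ext p
    simp only [staleSet, card_filter_eq_ncard, Set.mem_iUnion]
    rfl
  rw [h]
  refine MeasurableSet.iUnion fun s' => MeasurableSet.inter ?_ ?_
  · exact measurableSet_le ((U.measurable_error M.q _ _ t _).comp measurable_snd) measurable_const
  · refine measurableSet_le measurable_const (measurable_ncard _ fun j => ?_)
    have hj : Measurable fun p : (Fin c.B → X) × (Seed × (Fin n → X)) => p.1 j :=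
      (measurable_pi_apply j).comp measurable_fst
    exact ((M.measurable_f.comp hj).prodMk (U.measurable_learn_comp c.δ₁ n measurable_snd hj))
      (MeasurableSet.of_discrete (s := {p : S × S | p.1 = t ∧ p.2 ≠ s'}))

/-- The mixture of the emission distributions with the weights `w`. -/
def BMDP.mixture (M : BMDP S A X H) (w : S → ℝ≥0∞) : Measure X := ∑ s, w s • M.q s

theorem BMDP.isProbabilityMeasure_mixture (M : BMDP S A X H) {w : S → ℝ≥0∞} (hw : ∑ s, w s = 1) :
    IsProbabilityMeasure (M.mixture w) := ⟨by simp [BMDP.mixture, hw]⟩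

theorem BMDP.mixture_apply (M : BMDP S A X H) (w : S → ℝ≥0∞) (E : Set X) :
    M.mixture w E = ∑ s, w s * M.q s E := by
  simp [BMDP.mixture]

theorem BMDP.mixture_block (M : BMDP S A X H) (w : S → ℝ≥0∞) (t : S) (E : Set X) :
    M.mixture w ({x | M.f x = t} ∩ E) = w t * M.q t E := by
  classical
  simp [BMDP.mixture_apply, M.q_fiber]

theorem BMDP.measurableSet_block (M : BMDP S A X H) (t : S) : MeasurableSet {x | M.f x = t} :=
  M.measurable_f (measurableSet_singleton t)

theorem hoeffding_ncard_ge {Y : Type*} [MeasurableSpace Y] (ν : Measure Y)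
    [IsProbabilityMeasure ν] {E : Set Y} (hE : MeasurableSet E) (n : ℕ) {p t u b : ℝ}
    (hp : ν E ≤ ENNReal.ofReal p) (ht : 0 ≤ t) (hp0 : 0 ≤ p) (hu : n * (p + t) ≤ u)
    (hb : b ≤ 2 * n * t ^ 2) :
    (Measure.pi fun _ : Fin n => ν) {y | u ≤ ({j | y j ∈ E}.ncard : ℝ)} ≤
      ENNReal.ofReal (Real.exp (-b)) := by
  classical
  refine le_trans (measure_mono fun y hy => ?_) ((hoeffding_card_ge ν hE n (u := p + t) ht hp hp0
    le_rfl).trans (ENNReal.ofReal_le_ofReal (Real.exp_le_exp.2 (neg_le_neg hb))))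
  simp only [Set.mem_ofPred_eq, card_filter_eq_ncard] at hy ⊢
  exact hu.trans hy

theorem hoeffding_ncard_le {Y : Type*} [MeasurableSpace Y] (ν : Measure Y)
    [IsProbabilityMeasure ν] {E : Set Y} (hE : MeasurableSet E) (n : ℕ) {p t u b : ℝ}
    (hp : ENNReal.ofReal p ≤ ν E) (ht : 0 ≤ t) (hu : u ≤ n * (p - t)) (hb : b ≤ 2 * n * t ^ 2) :
    (Measure.pi fun _ : Fin n => ν) {y | ({j | y j ∈ E}.ncard : ℝ) ≤ u} ≤
      ENNReal.ofReal (Real.exp (-b)) := by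
  classical
  refine le_trans (measure_mono fun y hy => ?_) ((hoeffding_card_le ν hE n (u := p - t) ht hp
    le_rfl).trans (ENNReal.ofReal_le_ofReal (Real.exp_le_exp.2 (neg_le_neg hb))))
  simp only [Set.mem_ofPred_eq, card_filter_eq_ncard] at hy ⊢
  exact hy.trans hu

/-- Let β = exp(-Bθ²/100). For a fixed seed and training sample, Hoeffding gives probability at most
β² per label that the points are stale. Tonelli moves this to the universal measure, of mass at most
(n+1)^|S|, and Markov's inequality at level β leaves one factor β. -/
theorem measure_not_goodPoints_le (M : BMDP S A X H) (U : Learner S X) (c : Params) (T : ℕ)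
    {w : S → ℝ≥0∞} (hw : ∑ s, w s = 1) (hθ : 0 ≤ c.threshold) :
    (Measure.pi fun _ : Fin c.B => M.mixture w) {y | ¬ GoodPoints M U c T y} ≤
      T * Fintype.card S * (Fintype.card S * ((T * c.B : ℕ) + 1 : ℝ≥0∞) ^ Fintype.card S) *
        ENNReal.ofReal (Real.exp (-(c.B * c.threshold ^ 2 / 100))) := by
  have hprob := M.isProbabilityMeasure_mixture hw
  set β := ENNReal.ofReal (Real.exp (-(c.B * c.threshold ^ 2 / 100))) with hβ
  have hβ0 : β ≠ 0 := by simp [hβ, Real.exp_pos]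
  have hβt : β ≠ ⊤ := ENNReal.ofReal_ne_top
  have hββ : ENNReal.ofReal (Real.exp (-(c.B * c.threshold ^ 2 / 50))) = β * β := by
    rw [hβ, ← ENNReal.ofReal_mul (Real.exp_nonneg _), ← Real.exp_add]
    congr 2; ring
  have hpiece : ∀ i < T, ∀ t, (Measure.pi fun _ : Fin c.B => M.mixture w)
      {y | β < ((volume : Measure Seed).prod (universalLaw M.q ((i + 1) * c.B)))
        {z | (y, z) ∈ staleSet M U c ((i + 1) * c.B) t}} ≤
      Fintype.card S * ((T * c.B : ℕ) + 1 : ℝ≥0∞) ^ Fintype.card S * β := by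
    intro i hi t
    set n := (i + 1) * c.B with hn
    have hmeas := measurableSet_staleSet M U c n t
    have hF := measurable_measure_prodMk_left
      (ν := (volume : Measure Seed).prod (universalLaw M.q n)) hmeas
    have h1 : ∫⁻ y, ((volume : Measure Seed).prod (universalLaw M.q n))
        (Prod.mk y ⁻¹' staleSet M U c n t) ∂(Measure.pi fun _ : Fin c.B => M.mixture w) ≤
        Fintype.card S * (β * β) * ((T * c.B : ℕ) + 1 : ℝ≥0∞) ^ Fintype.card S := by
      rw [← Measure.prod_apply hmeas, Measure.prod_apply_symm hmeas]
      calc ∫⁻ z, (Measure.pi fun _ : Fin c.B => M.mixture w)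
            ((fun y => (y, z)) ⁻¹' staleSet M U c n t) ∂((volume : Measure Seed).prod
              (universalLaw M.q n))
          ≤ ∫⁻ _z, Fintype.card S * (β * β) ∂((volume : Measure Seed).prod
              (universalLaw M.q n)) := by
            refine lintegral_mono fun z => ?_
            calc (Measure.pi fun _ : Fin c.B => M.mixture w)
                    ((fun y => (y, z)) ⁻¹' staleSet M U c n t)
                ≤ (Measure.pi fun _ : Fin c.B => M.mixture w) (⋃ s' ∈ (Finset.univ : Finset S),
                    {y | M.q t {x | U.learn c.δ₁ n z.1 z.2 x ≠ s'} ≤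
                      ENNReal.ofReal (c.threshold / 10) ∧ c.threshold * c.B / 5 ≤
                      ({j | y j ∈ {x | M.f x = t} ∩
                        {x | U.learn c.δ₁ n z.1 z.2 x ≠ s'}}.ncard : ℝ)}) := by
                  refine measure_mono fun y hy => ?_
                  obtain ⟨s', h1, h2⟩ := hy
                  rw [card_filter_eq_ncard] at h2
                  simp only [Set.mem_iUnion, Finset.mem_univ, exists_prop, true_and]
                  exact ⟨s', h1, h2⟩
              _ ≤ ∑ _s' : S, β * β := by
                  refine (measure_biUnion_finset_le _ _).trans (Finset.sum_le_sum fun s' _ => ?_)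
                  by_cases hs' : M.q t {x | U.learn c.δ₁ n z.1 z.2 x ≠ s'} ≤
                      ENNReal.ofReal (c.threshold / 10)
                  · simp only [hs', true_and]
                    rw [← hββ]
                    -- Mean θ/10 and deviation θ/10 add up to the fraction θ/5 in `staleSet`; the
                    -- exponent is 2B(θ/10)² = Bθ²/50, that is β².
                    refine hoeffding_ncard_ge (M.mixture w) ?_ c.B (p := c.threshold / 10)
                      (t := c.threshold / 10) ?_ (by positivity) (by positivity) (by linarith)
                      (by linarith)
                    · exact (M.measurableSet_block t).inter
                        ((U.decoder c.δ₁ n z.1 z.2).2 (MeasurableSet.of_discrete (s := {s'}ᶜ)))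
                    · rw [M.mixture_block]
                      refine (mul_le_of_le_one_left zero_le ?_).trans hs'
                      rw [← hw]
                      exact Finset.single_le_sum (fun _ _ => zero_le) (Finset.mem_univ t)
                  · simp [hs']
              _ = Fintype.card S * (β * β) := by simp
        _ ≤ Fintype.card S * (β * β) * ((T * c.B : ℕ) + 1 : ℝ≥0∞) ^ Fintype.card S := by
            rw [lintegral_const]
            gcongr
            rw [← Set.univ_prod_univ, Measure.prod_prod, measure_univ, one_mul]
            refine (universalLaw_univ_le M.q n).trans ?_
            gcongr
            exact Nat.mul_le_mul_right _ hi
    calc (Measure.pi fun _ : Fin c.B => M.mixture w)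
            {y | β < ((volume : Measure Seed).prod (universalLaw M.q n))
              {z | (y, z) ∈ staleSet M U c n t}}
        ≤ (Measure.pi fun _ : Fin c.B => M.mixture w)
          {y | β ≤ ((volume : Measure Seed).prod (universalLaw M.q n))
            (Prod.mk y ⁻¹' staleSet M U c n t)} := by
          refine measure_mono fun y hy => ?_
          have hy' : β < ((volume : Measure Seed).prod (universalLaw M.q n))
            {z | (y, z) ∈ staleSet M U c n t} := hy
          exact hy'.le
      _ ≤ _ := (meas_ge_le_lintegral_div hF.aemeasurable hβ0 hβt).trans
          (ENNReal.div_le_div_right h1 _)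
      _ = Fintype.card S * ((T * c.B : ℕ) + 1 : ℝ≥0∞) ^ Fintype.card S * β := by
          rw [show Fintype.card S * (β * β) * ((T * c.B : ℕ) + 1 : ℝ≥0∞) ^ Fintype.card S =
            Fintype.card S * ((T * c.B : ℕ) + 1 : ℝ≥0∞) ^ Fintype.card S * β * β by ring,
            ENNReal.mul_div_cancel_right hβ0 hβt]
  calc _ ≤ (Measure.pi fun _ : Fin c.B => M.mixture w) (⋃ i ∈ Finset.range T,
        ⋃ t ∈ (Finset.univ : Finset S),
          {y | β < ((volume : Measure Seed).prod (universalLaw M.q ((i + 1) * c.B)))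
            {z | (y, z) ∈ staleSet M U c ((i + 1) * c.B) t}}) := by
        refine measure_mono fun y hy => ?_
        simp only [GoodPoints, Set.mem_ofPred_eq, not_forall, not_le] at hy
        obtain ⟨i, hi, t, ht⟩ := hy
        simp only [Set.mem_iUnion, Finset.mem_univ, Finset.mem_range, exists_prop, true_and]
        exact ⟨i, hi, t, ht⟩
    _ ≤ ∑ _i ∈ Finset.range T, ∑ _t : S,
          Fintype.card S * ((T * c.B : ℕ) + 1 : ℝ≥0∞) ^ Fintype.card S * β :=
        (measure_biUnion_finset_le _ _).trans (Finset.sum_le_sum fun i hi =>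
          (measure_biUnion_finset_le _ _).trans (Finset.sum_le_sum fun t _ =>
            hpiece i (Finset.mem_range.1 hi) t))
    _ = _ := by simp; ring

theorem Learner.IsOracle.measure_not_accurate_le {M : BMDP S A X H} {U : Learner S X}
    {g : ℕ → ℝ → ℝ} (hU : U.IsOracle M.q g) {δ : ℝ} (hδ : 0 < δ) (hδ1 : δ < 1) {n : ℕ} {ϵ : ℝ}
    (hg : g n δ < ϵ) {w : S → ℝ≥0∞} (hw : ∑ s, w s = 1) :
    ((volume : Measure Seed).prod (Measure.pi fun _ : Fin n => M.mixture w))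
      {z | ¬ ∃ α : Equiv.Perm S, ∑ s, w s * M.q s {x | U.learn δ n z.1 z.2 x ≠ α s} ≤
        ENNReal.ofReal ϵ} ≤ ENNReal.ofReal δ := by
  have hprob := M.isProbabilityMeasure_mixture hw
  obtain ⟨μ, hμ⟩ : ∃ μ : PMF S, ∀ s, μ s = w s := ⟨PMF.ofFintype w hw, fun s => by simp⟩
  have h1 := (hU δ hδ hδ1).2 n μ
  simp only [hμ] at h1
  set P := (volume : Measure Seed).prod (Measure.pi fun _ : Fin n => M.mixture w) with hP
  set G : Set (Seed × (Fin n → X)) := {z | ∃ α : Equiv.Perm S,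
    ENNReal.ofReal (1 - g n δ) ≤ ∑ s, w s * M.q s {x | U.learn δ n z.1 z.2 x = α s}} with hG
  have h1' : ENNReal.ofReal (1 - δ) ≤ P G := h1
  have hGm : MeasurableSet G := by
    have : G = ⋃ α : Equiv.Perm S, {z | ENNReal.ofReal (1 - g n δ) ≤
        ∑ s, w s * M.q s {x | U.learn δ n z.1 z.2 x ∈ ({α s} : Set S)}} := by
      ext z; simp only [Set.mem_iUnion]; rfl
    rw [this]
    exact MeasurableSet.iUnion fun α => measurableSet_le measurable_const
      (Finset.measurable_sum _ fun s _ => (U.measurable_error M.q δ n s _).const_mul _)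
  have h2 : P Gᶜ ≤ ENNReal.ofReal δ := by
    rw [prob_compl_eq_one_sub hGm, tsub_le_iff_right, ← ENNReal.ofReal_one,
      show (1 : ℝ) = δ + (1 - δ) by ring, ENNReal.ofReal_add hδ.le (by linarith)]
    gcongr
  refine le_trans (measure_mono fun z hz => ?_) h2
  by_contra hzG
  obtain ⟨α, hα⟩ := not_not.1 hzG
  refine hz ?_
  refine ⟨α, ?_⟩
  have h3 : ∑ s, w s * M.q s {x | U.learn δ n z.1 z.2 x ≠ α s} +
      ∑ s, w s * M.q s {x | U.learn δ n z.1 z.2 x = α s} = 1 := by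
    rw [← Finset.sum_add_distrib, ← hw]
    refine Finset.sum_congr rfl fun s _ => ?_
    have hm : MeasurableSet {x | U.learn δ n z.1 z.2 x = α s} :=
      (U.decoder δ n z.1 z.2).2 (measurableSet_singleton _)
    have h4 : M.q s {x | U.learn δ n z.1 z.2 x ≠ α s} +
        M.q s {x | U.learn δ n z.1 z.2 x = α s} = 1 := by
      rw [add_comm]
      have := prob_add_prob_compl (μ := M.q s) hm
      exact this
    rw [← mul_add, h4, mul_one]
  have h5 : (1 : ℝ≥0∞) ≤ ENNReal.ofReal (1 - g n δ) + ENNReal.ofReal ϵ := by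
    rw [← ENNReal.ofReal_one]
    refine le_trans (ENNReal.ofReal_le_ofReal (by linarith)) ENNReal.ofReal_add_le
  have hfin : ∑ s, w s * M.q s {x | U.learn δ n z.1 z.2 x = α s} ≠ ⊤ := by
    intro hc
    rw [hc, add_top] at h3
    exact ENNReal.top_ne_one h3
  rw [← h3, add_comm] at h5
  have h6 := h5.trans (add_le_add_left hα _)
  exact (ENNReal.add_le_add_iff_left hfin).1 h6

end Level

section StepProbability

variable {S A X : Type} [Fintype S] [MeasurableSpace S] [DiscreteMeasurableSpace S]
  [Fintype A] [MeasurableSpace A] [MeasurableSpace X] {H : ℕ}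

/-- The bound for the probability that a step fails at a given level, for `k` states. -/
def Params.levelFailure (c : Params) (T k : ℕ) : ℝ≥0∞ :=
  ENNReal.ofReal c.δ₁ + (k * k + k.factorial + (k + k) +
    T * k * (k * ((T * c.B : ℕ) + 1 : ℝ≥0∞) ^ k)) *
      ENNReal.ofReal (Real.exp (-(c.B * c.threshold ^ 2 / 200)))

/-- The distribution of the state at a level, when a policy is drawn uniformly from a list. -/
def BMDP.levelWeight (M : BMDP S A X H) (Φ : List (Policy X A H)) (h : Fin (H + 1)) (s : S) :
    ℝ≥0∞ := M.unifLaw Φ {τ | M.f (τ.1 h) = s}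

theorem BMDP.sum_levelWeight (M : BMDP S A X H) {Φ : List (Policy X A H)} (hΦ : Φ ≠ [])
    (h : Fin (H + 1)) : ∑ s, M.levelWeight Φ h s = 1 := by
  have := M.isProbabilityMeasure_unifLaw hΦ
  have h1 := M.isMixture_unifLaw Φ h Set.univ MeasurableSet.univ
  simpa [BMDP.levelWeight] using h1.symm

theorem BMDP.map_level_unifLaw (M : BMDP S A X H) (Φ : List (Policy X A H)) (h : Fin (H + 1)) :
    (M.unifLaw Φ).map (fun τ => τ.1 h) = M.mixture (M.levelWeight Φ h) := by
  ext E hE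
  rw [Measure.map_apply (measurable_level h) hE, M.mixture_apply]
  exact M.isMixture_unifLaw Φ h E hE

theorem BMDP.map_level_trajLaw (M : BMDP S A X H) (φ : Policy X A H) (h : Fin (H + 1)) :
    (M.trajLaw φ).map (fun τ => τ.1 h) = M.mixture (M.occupancy φ h) := by
  ext E hE
  rw [Measure.map_apply (measurable_level h) hE, M.mixture_apply]
  exact M.isMixture_trajLaw φ h E hE

theorem BMDP.occupancy_le (M : BMDP S A X H) {Φ : List (Policy X A H)} {φ : Policy X A H}
    (hφ : φ ∈ Φ) (h : Fin (H + 1)) (t : S) :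
    M.occupancy φ h t ≤ Φ.length * M.levelWeight Φ h t :=
  M.trajLaw_le_unifLaw hφ _

theorem BMDP.mixture_error (M : BMDP S A X H) (w : S → ℝ≥0∞) (g : X → S) (α : S → S) :
    M.mixture w {x | g x ≠ α (M.f x)} = ∑ t, w t * M.q t {x | g x ≠ α t} := by
  rw [M.mixture_apply]
  refine Finset.sum_congr rfl fun t _ => ?_
  congr 1
  refine measure_congr ?_
  filter_upwards [M.ae_f_eq t] with x hx
  simp only [eq_iff_iff]
  change g x ≠ α (M.f x) ↔ g x ≠ α t
  rw [hx]

theorem measure_fst_mem_le {Y Z : Type*} [MeasurableSpace Y] [MeasurableSpace Z] (μ : Measure Y)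
    (ν : Measure Z) [SFinite μ] [IsProbabilityMeasure ν] (E : Set Y) :
    (μ.prod ν) {z | z.1 ∈ E} ≤ μ E := by
  have h : {z : Y × Z | z.1 ∈ E} = E ×ˢ Set.univ := by ext; simp
  rw [h, Measure.prod_prod, measure_univ, mul_one]

theorem measure_snd_mem_le {Y Z : Type*} [MeasurableSpace Y] [MeasurableSpace Z] (μ : Measure Y)
    (ν : Measure Z) [IsProbabilityMeasure μ] [SFinite ν] (E : Set Z) :
    (μ.prod ν) {z | z.2 ∈ E} ≤ ν E := by
  have h : {z : Y × Z | z.2 ∈ E} = Set.univ ×ˢ E := by ext; simp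
  rw [h, Measure.prod_prod, measure_univ, one_mul]

/-- The permutation depends on the training sample, so a union bound over all |S|! permutations
precedes Hoeffding for the independent test points. The mean error is at most θ²/20 ≤ θ/20; a
further deviation θ/20 gives the fraction θ/10 and the exponent Bθ²/200. -/
theorem measure_test_error_le (M : BMDP S A X H) (U : Learner S X) (c : Params) (n : ℕ)
    {ν : S → ℝ≥0∞} (hν : ∑ s, ν s = 1) (hθ : 0 ≤ c.threshold) (hθ1 : c.threshold ≤ 1)
    (P : Measure (Seed × (Fin n → X))) [IsProbabilityMeasure P] :
    (P.prod (Measure.pi fun _ : Fin c.B => M.mixture ν)) {z | ∃ α : Equiv.Perm S,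
      ∑ t, ν t * M.q t {x | U.learn c.δ₁ n z.1.1 z.1.2 x ≠ α t} ≤
        ENNReal.ofReal (c.threshold ^ 2 / 20) ∧
      c.threshold * c.B / 10 ≤
        ({j | U.learn c.δ₁ n z.1.1 z.1.2 (z.2 j) ≠ α (M.f (z.2 j))}.ncard : ℝ)} ≤
      (Fintype.card S).factorial *
        ENNReal.ofReal (Real.exp (-(c.B * c.threshold ^ 2 / 200))) := by
  classical
  have hprob := M.isProbabilityMeasure_mixture hν
  set E : Set ((Seed × (Fin n → X)) × (Fin c.B → X)) := {z | ∃ α : Equiv.Perm S,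
      ∑ t, ν t * M.q t {x | U.learn c.δ₁ n z.1.1 z.1.2 x ≠ α t} ≤
        ENNReal.ofReal (c.threshold ^ 2 / 20) ∧
      c.threshold * c.B / 10 ≤
        ({j | U.learn c.δ₁ n z.1.1 z.1.2 (z.2 j) ≠ α (M.f (z.2 j))}.ncard : ℝ)} with hE
  have hm : MeasurableSet E := by
    have : E = ⋃ α : Equiv.Perm S, ({z |
        ∑ t, ν t * M.q t {x | U.learn c.δ₁ n z.1.1 z.1.2 x ∈ ({α t}ᶜ : Set S)} ≤
          ENNReal.ofReal (c.threshold ^ 2 / 20)} ∩ {z | c.threshold * c.B / 10 ≤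
        ({j | U.learn c.δ₁ n z.1.1 z.1.2 (z.2 j) ≠ α (M.f (z.2 j))}.ncard : ℝ)}) := by
      ext z; simp only [Set.mem_iUnion]; rfl
    rw [this]
    refine MeasurableSet.iUnion fun α => MeasurableSet.inter ?_ ?_
    · exact measurableSet_le (Finset.measurable_sum _ fun t _ =>
        ((U.measurable_error M.q c.δ₁ n t _).comp measurable_fst).const_mul _) measurable_const
    · refine measurableSet_le measurable_const (measurable_ncard _ fun j => ?_)
      have hj : Measurable fun z : (Seed × (Fin n → X)) × (Fin c.B → X) => z.2 j :=
        (measurable_pi_apply j).comp measurable_snd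
      exact ((M.measurable_f.comp hj).prodMk (U.measurable_learn_comp c.δ₁ n measurable_fst hj))
        (MeasurableSet.of_discrete (s := {p : S × S | p.2 ≠ α p.1}))
  rw [Measure.prod_apply hm]
  refine (lintegral_mono (g := fun _ => (Fintype.card S).factorial *
        ENNReal.ofReal (Real.exp (-(c.B * c.threshold ^ 2 / 200)))) fun z => ?_).trans (by simp)
  calc (Measure.pi fun _ : Fin c.B => M.mixture ν) (Prod.mk z ⁻¹' E)
      ≤ (Measure.pi fun _ : Fin c.B => M.mixture ν) (⋃ α ∈ (Finset.univ : Finset (Equiv.Perm S)),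
          {y | ∑ t, ν t * M.q t {x | U.learn c.δ₁ n z.1 z.2 x ≠ α t} ≤
            ENNReal.ofReal (c.threshold ^ 2 / 20) ∧ c.threshold * c.B / 10 ≤
            ({j | y j ∈ {x | U.learn c.δ₁ n z.1 z.2 x ≠ α (M.f x)}}.ncard : ℝ)}) := by
        refine measure_mono fun y hy => ?_
        obtain ⟨α, h1, h2⟩ := hy
        simp only [Set.mem_iUnion, Finset.mem_univ, exists_prop, true_and]
        exact ⟨α, h1, h2⟩
    _ ≤ ∑ _α : Equiv.Perm S, ENNReal.ofReal (Real.exp (-(c.B * c.threshold ^ 2 / 200))) := by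
        refine (measure_biUnion_finset_le _ _).trans (Finset.sum_le_sum fun α _ => ?_)
        by_cases hα : ∑ t, ν t * M.q t {x | U.learn c.δ₁ n z.1 z.2 x ≠ α t} ≤
            ENNReal.ofReal (c.threshold ^ 2 / 20)
        · simp only [hα, true_and]
          refine hoeffding_ncard_ge (M.mixture ν) ?_ c.B (p := c.threshold / 20)
            (t := c.threshold / 20) ?_ (by positivity) (by positivity) (by linarith)
            (by linarith)
          · exact ((U.decoder c.δ₁ n z.1 z.2).2.prodMk M.measurable_f)
              (MeasurableSet.of_discrete (s := {p : S × S | p.1 ≠ α p.2}))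
          · rw [M.mixture_error ν _ α]
            exact hα.trans (ENNReal.ofReal_le_ofReal (by nlinarith))
        · simp [hα]
    _ = _ := by simp [Fintype.card_perm]

/-- Occupancy θ/2 plus deviation 2θ/5 gives 9θ/10. This and the bound 2θ - 9θ/10 = 11θ/10 for
frequent states keep a margin of θ/10 around the confirmation threshold θ, which absorbs the test
errors. -/
theorem measure_rare_le (M : BMDP S A X H) (c : Params) {ν : S → ℝ≥0∞} (hν : ∑ s, ν s = 1)
    (hθ : 0 ≤ c.threshold) (t : S) :
    (Measure.pi fun _ : Fin c.B => M.mixture ν) {y | ν t < ENNReal.ofReal (c.threshold / 2) ∧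
      9 / 10 * (c.threshold * c.B) ≤ ({j | M.f (y j) = t}.ncard : ℝ)} ≤
      ENNReal.ofReal (Real.exp (-(c.B * c.threshold ^ 2 / 200))) := by
  have hprob := M.isProbabilityMeasure_mixture hν
  have hνt : M.mixture ν {x | M.f x = t} = ν t := by
    simpa using M.mixture_block ν t Set.univ
  by_cases ht : ν t < ENNReal.ofReal (c.threshold / 2)
  · simp only [ht, true_and]
    refine hoeffding_ncard_ge (M.mixture ν) (M.measurableSet_block t) c.B (p := c.threshold / 2)
      (t := 2 / 5 * c.threshold) (hνt.trans_le ht.le) (by positivity) (by positivity) (by linarith)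
      ?_
    have : (0 : ℝ) ≤ c.B * c.threshold ^ 2 := by positivity
    linarith
  · simp [ht]

theorem measure_frequent_le (M : BMDP S A X H) (c : Params) {ν : S → ℝ≥0∞} (hν : ∑ s, ν s = 1)
    (hθ : 0 ≤ c.threshold) (t : S) :
    (Measure.pi fun _ : Fin c.B => M.mixture ν) {y | ENNReal.ofReal (2 * c.threshold) < ν t ∧
      ({j | M.f (y j) = t}.ncard : ℝ) ≤ 11 / 10 * (c.threshold * c.B)} ≤
      ENNReal.ofReal (Real.exp (-(c.B * c.threshold ^ 2 / 200))) := by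
  have hprob := M.isProbabilityMeasure_mixture hν
  have hνt : M.mixture ν {x | M.f x = t} = ν t := by
    simpa using M.mixture_block ν t Set.univ
  by_cases ht : ENNReal.ofReal (2 * c.threshold) < ν t
  · simp only [ht, true_and]
    refine hoeffding_ncard_le (M.mixture ν) (M.measurableSet_block t) c.B (p := 2 * c.threshold)
      (t := 9 / 10 * c.threshold) (ht.le.trans hνt.ge) (by positivity) (by linarith) ?_
    have : (0 : ℝ) ≤ c.B * c.threshold ^ 2 := by positivity
    linarith
  · refine (measure_mono (t := ∅) fun y hy => ?_).trans (by simp)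
    obtain ⟨h, _⟩ := hy
    exact ht h

/-- The weights `w` may depend on the data sets in `Z`. Domination by the universal law makes this
harmless. -/
theorem measure_stale_le (M : BMDP S A X H) (U : Learner S X) (c : Params) {T n : ℕ} (hn : n < T)
    {w : S → ℝ≥0∞} (hw : ∑ s, w s = 1) (Z : S → Option (DataSet X c.B))
    (hZ : ∀ s D, Z s = some D → GoodPoints M U c T D.points) :
    ((volume : Measure Seed).prod (Measure.pi fun _ : Fin ((n + 1) * c.B) => M.mixture w))
      {z | ∃ s D t, Z s = some D ∧ (D.points, z) ∈ staleSet M U c ((n + 1) * c.B) t} ≤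
      Fintype.card S * Fintype.card S *
        ENNReal.ofReal (Real.exp (-(c.B * c.threshold ^ 2 / 100))) := by
  have hprob := M.isProbabilityMeasure_mixture hw
  calc _ ≤ ((volume : Measure Seed).prod
          (Measure.pi fun _ : Fin ((n + 1) * c.B) => M.mixture w))
          (⋃ s ∈ (Finset.univ : Finset S), ⋃ t ∈ (Finset.univ : Finset S),
            {z | ∃ D, Z s = some D ∧ (D.points, z) ∈ staleSet M U c ((n + 1) * c.B) t}) := by
        refine measure_mono fun z hz => ?_
        obtain ⟨s, D, t, h1, h2⟩ := hz
        simp only [Set.mem_iUnion, Finset.mem_univ, exists_prop, true_and]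
        exact ⟨s, t, D, h1, h2⟩
    _ ≤ ∑ _s : S, ∑ _t : S, ENNReal.ofReal (Real.exp (-(c.B * c.threshold ^ 2 / 100))) := by
        refine (measure_biUnion_finset_le _ _).trans (Finset.sum_le_sum fun s _ =>
          (measure_biUnion_finset_le _ _).trans (Finset.sum_le_sum fun t _ => ?_))
        rcases hs : Z s with _ | D
        · simp
        · simp only [Option.some.injEq, exists_eq_left']
          refine le_trans ?_ (hZ s D hs n hn t)
          exact Measure.prod_mono le_rfl
            (pi_mixture_le_universalLaw M.q ((n + 1) * c.B) w hw) _
    _ = _ := by simp; ring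

/-- The probability that a step fails at a given level. -/
theorem measure_not_goodStep_le {M : BMDP S A X H} {U : Learner S X} {c : Params} {T n : ℕ}
    {g : ℕ → ℝ → ℝ} (hU : U.IsOracle M.q g) (hδ : 0 < c.δ₁) (hδ1 : c.δ₁ < 1) (hn : n < T)
    (hg : g ((n + 1) * c.B) c.δ₁ < c.threshold ^ 2 / (20 * T)) {m : Memory S A X H c.B}
    (hm : Invariant M U c T n m) (φ : Policy X A H) (h : Fin (H + 1)) (hθ : 0 ≤ c.threshold)
    (hθ1 : c.threshold ≤ 1) :
    (((volume : Measure Seed).prod (Measure.pi fun _ : Fin ((n + 1) * c.B) =>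
        M.mixture (M.levelWeight (φ :: m.policies) h))).prod
      (Measure.pi fun _ : Fin c.B => M.mixture (M.occupancy φ h)))
      {z | ¬ ∃ α, GoodStep M U c T φ m z.2 h (U.decoder c.δ₁ _ z.1.1 z.1.2) α} ≤
      c.levelFailure T (Fintype.card S) := by
  classical
  set w := M.levelWeight (φ :: m.policies) h with hw
  set ν := M.occupancy φ h with hν
  have hws : ∑ s, w s = 1 := M.sum_levelWeight (List.cons_ne_nil _ _) h
  have hνs : ∑ s, ν s = 1 := M.sum_occupancy φ h
  have hprobw := M.isProbabilityMeasure_mixture hws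
  have hprobν := M.isProbabilityMeasure_mixture hνs
  set N := (n + 1) * c.B with hN
  set P := (volume : Measure Seed).prod (Measure.pi fun _ : Fin N => M.mixture w) with hP
  set Q := Measure.pi fun _ : Fin c.B => M.mixture ν with hQ
  set b := ENNReal.ofReal (Real.exp (-(c.B * c.threshold ^ 2 / 200))) with hb
  set k := Fintype.card S with hk
  have hβb : ENNReal.ofReal (Real.exp (-(c.B * c.threshold ^ 2 / 100))) ≤ b := by
    refine ENNReal.ofReal_le_ofReal (Real.exp_le_exp.2 ?_)
    have : (0 : ℝ) ≤ c.B * c.threshold ^ 2 := by positivity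
    linarith
  have hT : (0 : ℝ) < T := by exact_mod_cast (Nat.zero_le n).trans_lt hn
  let E₁ : Set (Seed × (Fin N → X)) := {z | ¬ ∃ α : Equiv.Perm S,
    ∑ s, w s * M.q s {x | U.learn c.δ₁ N z.1 z.2 x ≠ α s} ≤
      ENNReal.ofReal (c.threshold ^ 2 / (20 * T))}
  let E₂ : Set (Seed × (Fin N → X)) :=
    {z | ∃ s D t, m.standard h s = some D ∧ (D.points, z) ∈ staleSet M U c N t}
  let E₃ : Set ((Seed × (Fin N → X)) × (Fin c.B → X)) := {z | ∃ α : Equiv.Perm S,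
      ∑ t, ν t * M.q t {x | U.learn c.δ₁ N z.1.1 z.1.2 x ≠ α t} ≤
        ENNReal.ofReal (c.threshold ^ 2 / 20) ∧
      c.threshold * c.B / 10 ≤
        ({j | U.learn c.δ₁ N z.1.1 z.1.2 (z.2 j) ≠ α (M.f (z.2 j))}.ncard : ℝ)}
  let E₄ : S → Set (Fin c.B → X) := fun t => {y | ν t < ENNReal.ofReal (c.threshold / 2) ∧
      9 / 10 * (c.threshold * c.B) ≤ ({j | M.f (y j) = t}.ncard : ℝ)}
  let E₅ : S → Set (Fin c.B → X) := fun t => {y | ENNReal.ofReal (2 * c.threshold) < ν t ∧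
      ({j | M.f (y j) = t}.ncard : ℝ) ≤ 11 / 10 * (c.threshold * c.B)}
  let E₆ : Set (Fin c.B → X) := {y | ¬ GoodPoints M U c T y}
  have h1 : (P.prod Q) {z | z.1 ∈ E₁} ≤ ENNReal.ofReal c.δ₁ :=
    (measure_fst_mem_le P Q E₁).trans (hU.measure_not_accurate_le hδ hδ1 hg hws)
  have h2 : (P.prod Q) {z | z.1 ∈ E₂} ≤ k * k * b := by
    refine (measure_fst_mem_le P Q E₂).trans ((measure_stale_le M U c hn hws (m.standard h)
      fun s D hD => ?_).trans (by gcongr))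
    obtain ⟨_, _, h2, _⟩ := hm.confirmed h s D hD
    exact h2
  have h3 : (P.prod Q) E₃ ≤ k.factorial * b := measure_test_error_le M U c N hνs hθ hθ1 P
  have h4 : (P.prod Q) {z | z.2 ∈ ⋃ t ∈ (Finset.univ : Finset S), E₄ t} ≤ k * b := by
    refine (measure_snd_mem_le P Q _).trans ((measure_biUnion_finset_le _ _).trans
      ((Finset.sum_le_sum fun t _ => measure_rare_le M c hνs hθ t).trans (by simp [hk, hb])))
  have h5 : (P.prod Q) {z | z.2 ∈ ⋃ t ∈ (Finset.univ : Finset S), E₅ t} ≤ k * b := by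
    refine (measure_snd_mem_le P Q _).trans ((measure_biUnion_finset_le _ _).trans
      ((Finset.sum_le_sum fun t _ => measure_frequent_le M c hνs hθ t).trans (by simp [hk, hb])))
  have h6 : (P.prod Q) {z | z.2 ∈ E₆} ≤ T * k * (k * ((T * c.B : ℕ) + 1 : ℝ≥0∞) ^ k) * b :=
    (measure_snd_mem_le P Q _).trans ((measure_not_goodPoints_le M U c T hνs hθ).trans
      (by gcongr))
  have hsub : {z : (Seed × (Fin N → X)) × (Fin c.B → X) |
      ¬ ∃ α, GoodStep M U c T φ m z.2 h (U.decoder c.δ₁ N z.1.1 z.1.2) α} ⊆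
      {z | z.1 ∈ E₁} ∪ ({z | z.1 ∈ E₂} ∪ (E₃ ∪ ({z | z.2 ∈ ⋃ t ∈ (Finset.univ : Finset S), E₄ t} ∪
        ({z | z.2 ∈ ⋃ t ∈ (Finset.univ : Finset S), E₅ t} ∪ {z | z.2 ∈ E₆})))) := by
    intro z hz
    by_contra hc
    simp only [Set.mem_union, not_or, Set.mem_ofPred_eq, Set.mem_iUnion, Finset.mem_univ,
      exists_prop, true_and, not_exists] at hc
    obtain ⟨c1, c2, c3, c4, c5, c6⟩ := hc
    obtain ⟨α, hα⟩ : ∃ α : Equiv.Perm S,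
      ∑ s, w s * M.q s {x | U.learn c.δ₁ N z.1.1 z.1.2 x ≠ α s} ≤
        ENNReal.ofReal (c.threshold ^ 2 / (20 * T)) := not_not.1 c1
    -- The list has n + 1 ≤ T policies; passing from their mixture to one of them costs the factor T
    -- that the oracle's accuracy θ²/(20T) provides for.
    have hsum : ∀ ψ ∈ φ :: m.policies,
        ∑ t, M.occupancy ψ h t * M.q t {x | U.learn c.δ₁ N z.1.1 z.1.2 x ≠ α t} ≤
          ENNReal.ofReal (c.threshold ^ 2 / 20) := by
      intro ψ hψ
      calc ∑ t, M.occupancy ψ h t * M.q t {x | U.learn c.δ₁ N z.1.1 z.1.2 x ≠ α t}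
          ≤ ∑ t, (T : ℝ≥0∞) * (w t * M.q t {x | U.learn c.δ₁ N z.1.1 z.1.2 x ≠ α t}) := by
            refine Finset.sum_le_sum fun t _ => ?_
            rw [← mul_assoc]
            refine mul_le_mul_left ((M.occupancy_le hψ h t).trans ?_) _
            gcongr
            rw [List.length_cons, hm.length]
            exact hn
        _ ≤ T * ENNReal.ofReal (c.threshold ^ 2 / (20 * T)) := by
            rw [← Finset.mul_sum]
            gcongr
        _ = ENNReal.ofReal (c.threshold ^ 2 / 20) := by
            rw [← ENNReal.ofReal_natCast, ← ENNReal.ofReal_mul hT.le]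
            congr 1
            field_simp
    refine hz ⟨α, fun ψ hψ t => ?_, fun s D hD t s' hq => ?_, ?_, fun t ht => ?_, fun t ht => ?_,
      not_not.1 c6⟩
    · exact (Finset.single_le_sum (f := fun t => M.occupancy ψ h t *
        M.q t {x | U.learn c.δ₁ N z.1.1 z.1.2 x ≠ α t}) (fun _ _ => zero_le)
        (Finset.mem_univ t)).trans (hsum ψ hψ)
    · by_contra hlt
      refine c2 ⟨s, D, t, hD, s', hq, ?_⟩
      rw [card_filter_eq_ncard]
      exact not_lt.1 hlt
    · by_contra hlt
      exact c3 ⟨α, hsum φ List.mem_cons_self, not_lt.1 hlt⟩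
    · by_contra hlt
      exact c4 t ⟨ht, not_lt.1 hlt⟩
    · by_contra hlt
      exact c5 t ⟨ht, not_lt.1 hlt⟩
  refine (measure_mono hsub).trans ?_
  refine (measure_union_le _ _).trans ((add_le_add h1 ((measure_union_le _ _).trans
    (add_le_add h2 ((measure_union_le _ _).trans (add_le_add h3 ((measure_union_le _ _).trans
      (add_le_add h4 ((measure_union_le _ _).trans (add_le_add h5 h6))))))))).trans ?_)
  rw [Params.levelFailure]
  apply le_of_eq
  ring

end StepProbability

/-! ### Success probability of the trajectory sampling routine -/

section TrajectorySampling

/-- The bad event need not be measurable. The complement of its measurable hull gives a measurable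
minorant of the success indicator without loss of probability. -/
theorem one_sub_le_lintegral {Y : Type*} [MeasurableSpace Y] (μ : Measure Y)
    [IsProbabilityMeasure μ] {E : Set Y} {b : ℝ≥0∞} (hE : μ E ≤ b) :
    ∃ F : Y → ℝ≥0∞, Measurable F ∧ (∀ y, F y ≤ Eᶜ.indicator 1 y) ∧ 1 - b ≤ ∫⁻ y, F y ∂μ := by
  refine ⟨(toMeasurable μ E)ᶜ.indicator 1,
    measurable_one.indicator (measurableSet_toMeasurable μ E).compl, fun y => ?_, ?_⟩
  · exact Set.indicator_le_indicator_of_subset (Set.compl_subset_compl.2 (subset_toMeasurable μ E))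
      (fun _ => zero_le) y
  · rw [lintegral_indicator_one (measurableSet_toMeasurable μ E).compl,
      prob_compl_eq_one_sub (measurableSet_toMeasurable μ E), measure_toMeasurable]
    exact tsub_le_tsub_left hE 1

theorem one_sub_le_lintegral_lintegral_lintegral {Y Z W : Type*} [MeasurableSpace Y]
    [MeasurableSpace Z] [MeasurableSpace W] (μ : Measure Y) (ν : Measure Z) (ρ : Measure W)
    [IsProbabilityMeasure μ] [IsProbabilityMeasure ν] [IsProbabilityMeasure ρ]
    {E : Set (Y × Z × W)} {b : ℝ≥0∞} (hE : (μ.prod (ν.prod ρ)) E ≤ b) :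
    1 - b ≤ ∫⁻ y, ∫⁻ z, ∫⁻ w, Eᶜ.indicator 1 (y, z, w) ∂ρ ∂ν ∂μ := by
  obtain ⟨F, hF, hle, hb⟩ := one_sub_le_lintegral _ hE
  refine hb.trans ?_
  rw [lintegral_prod _ hF.aemeasurable]
  refine lintegral_mono fun y => ?_
  rw [lintegral_prod (fun z => F (y, z)) (hF.comp measurable_prodMk_left).aemeasurable]
  exact lintegral_mono fun z => lintegral_mono fun w => hle _

theorem measurePreserving_rotate {Y Z W : Type*} [MeasurableSpace Y]
    [MeasurableSpace Z] [MeasurableSpace W] (μ : Measure Y) (ν : Measure Z) (ρ : Measure W)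
    [IsProbabilityMeasure μ] [IsProbabilityMeasure ν] [IsProbabilityMeasure ρ] :
    MeasurePreserving (fun x : Y × Z × W => ((x.2.2, x.1), x.2.1)) (μ.prod (ν.prod ρ))
      ((ρ.prod μ).prod ν) := by
  have h1 : MeasurePreserving (Prod.map id Prod.swap : Y × Z × W → Y × W × Z)
      (μ.prod (ν.prod ρ)) (μ.prod (ρ.prod ν)) :=
    (MeasurePreserving.id μ).prod Measure.measurePreserving_swap
  have h2 := (measurePreserving_prodAssoc μ ρ ν).symm MeasurableEquiv.prodAssoc
  have h3 : MeasurePreserving (Prod.map Prod.swap id : (Y × W) × Z → (W × Y) × Z)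
      ((μ.prod ρ).prod ν) ((ρ.prod μ).prod ν) :=
    Measure.measurePreserving_swap.prod (MeasurePreserving.id ν)
  exact h3.comp (h2.comp h1)

variable {S A X : Type} [Fintype S] [MeasurableSpace S] [DiscreteMeasurableSpace S]
  [Fintype A] [MeasurableSpace A] [MeasurableSpace X] {H : ℕ}

/-- The parameters are such that `T` steps of the trajectory sampling routine are likely to
succeed. -/
structure Adequate (M : BMDP S A X H) (U : Learner S X) (c : Params) (T : ℕ) (g : ℕ → ℝ → ℝ) :
    Prop where
  oracle : U.IsOracle M.q g
  confidence : c.δ₁ ∈ Set.Ioo (0 : ℝ) 1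
  batch : 0 < c.B
  threshold_pos : 0 < c.threshold
  threshold_le : c.threshold ≤ 1
  error_lt : ∀ n < T, g ((n + 1) * c.B) c.δ₁ < c.threshold ^ 2 / (20 * T)

/-- The bound for the probability that a step fails. -/
def Params.stepFailure (c : Params) (T H k : ℕ) : ℝ≥0∞ := (H + 1) * c.levelFailure T k

/-- The results of `j` good steps of the trajectory sampling routine. -/
def progressSet (M : BMDP S A X H) (U : Learner S X) (c : Params) (T n j : ℕ) (π : Policy S A H)
    (m : Memory S A X H c.B) : Set (Memory S A X H c.B) :=
  {m' | Invariant M U c T (n + j) m' ∧ Extends m.standard m'.standard ∧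
    (numConfirmed m.standard + j ≤ numConfirmed m'.standard ∨ Safe M c π m'.standard)}

theorem Adequate.le_prob_tsrStep {M : BMDP S A X H} {U : Learner S X} {c : Params} {T : ℕ}
    {g : ℕ → ℝ → ℝ} (ha : Adequate M U c T g) {k i : ℕ} (hn : k * numIter S H + i < T)
    {m : Memory S A X H c.B} (hm : Invariant M U c T (k * numIter S H + i) m) (π : Policy S A H) :
    1 - c.stepFailure T H (Fintype.card S) ≤ Interaction.prob M
      (progressSet M U c T (k * numIter S H + i) 1 π m) (tsrStep c U k i π m) := by
  classical
  set n := k * numIter S H + i with hn'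
  set φ := π.comp m.decoders with hφ
  set N := (n + 1) * c.B with hN
  have hθB : 0 < c.threshold * c.B := mul_pos ha.threshold_pos (by exact_mod_cast ha.batch)
  have hprobU : IsProbabilityMeasure (M.unifLaw (φ :: m.policies)) :=
    M.isProbabilityMeasure_unifLaw (List.cons_ne_nil _ _)
  let E : Set ((Fin N → Trajectory X A H) × (Fin c.B → Trajectory X A H) × (Fin (H + 1) → Seed)) :=
    {z | ∃ h, ¬ ∃ α, GoodStep M U c T φ m (fun j => (z.2.1 j).1 h) h
      (U.decoder c.δ₁ N (z.2.2 h) fun j => (z.1 j).1 h) α}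
  have hE : ((Measure.pi fun _ : Fin N => M.unifLaw (φ :: m.policies)).prod
      ((Measure.pi fun _ : Fin c.B => M.trajLaw φ).prod
        (volume : Measure (Fin (H + 1) → Seed)))) E ≤ c.stepFailure T H (Fintype.card S) := by
    have hlevel : ∀ h : Fin (H + 1), ((Measure.pi fun _ : Fin N => M.unifLaw (φ :: m.policies)).prod
        ((Measure.pi fun _ : Fin c.B => M.trajLaw φ).prod
        (volume : Measure (Fin (H + 1) → Seed))))
        {z | ¬ ∃ α, GoodStep M U c T φ m (fun j => (z.2.1 j).1 h) h
          (U.decoder c.δ₁ N (z.2.2 h) fun j => (z.1 j).1 h) α} ≤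
          c.levelFailure T (Fintype.card S) := by
      intro h
      have hw := M.isProbabilityMeasure_mixture
        (M.sum_levelWeight (List.cons_ne_nil φ m.policies) h)
      have hν := M.isProbabilityMeasure_mixture (M.sum_occupancy φ h)
      have h1 : MeasurePreserving (fun (D : Fin N → Trajectory X A H) j => (D j).1 h)
          (Measure.pi fun _ : Fin N => M.unifLaw (φ :: m.policies))
          (Measure.pi fun _ : Fin N => M.mixture (M.levelWeight (φ :: m.policies) h)) :=
        measurePreserving_pi _ _ fun _ => ⟨measurable_level h, M.map_level_unifLaw _ h⟩
      have h2 : MeasurePreserving (fun (D : Fin c.B → Trajectory X A H) j => (D j).1 h)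
          (Measure.pi fun _ : Fin c.B => M.trajLaw φ)
          (Measure.pi fun _ : Fin c.B => M.mixture (M.occupancy φ h)) :=
        measurePreserving_pi _ _ fun _ => ⟨measurable_level h, M.map_level_trajLaw _ h⟩
      have h3 : MeasurePreserving (fun ω : Fin (H + 1) → Seed => ω h) volume volume :=
        measurePreserving_eval (fun _ => (volume : Measure Seed)) h
      -- The procedure draws training data, test data and seeds in this order, whereas the level
      -- bound groups the learner's seed with its sample. Only the observations and the seed of
      -- level `h` matter.
      have h4 := (measurePreserving_rotate _ _ _).comp (h1.prod (h2.prod h3))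
      refine le_trans ?_ (measure_not_goodStep_le ha.oracle ha.confidence.1 ha.confidence.2 hn
        (ha.error_lt n hn) hm φ h ha.threshold_pos.le ha.threshold_le)
      rw [← h4.map_eq]
      exact Measure.le_map_apply h4.measurable.aemeasurable _
    calc _ ≤ ((Measure.pi fun _ : Fin N => M.unifLaw (φ :: m.policies)).prod
        ((Measure.pi fun _ : Fin c.B => M.trajLaw φ).prod
        (volume : Measure (Fin (H + 1) → Seed)))) (⋃ h ∈ (Finset.univ : Finset (Fin (H + 1))),
        {z | ¬ ∃ α, GoodStep M U c T φ m (fun j => (z.2.1 j).1 h) h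
          (U.decoder c.δ₁ N (z.2.2 h) fun j => (z.1 j).1 h) α}) := by
          refine measure_mono fun z hz => ?_
          obtain ⟨h, hh⟩ := hz
          simp only [Set.mem_iUnion, Finset.mem_univ, exists_prop, true_and]
          exact ⟨h, hh⟩
      _ ≤ ∑ _h : Fin (H + 1), c.levelFailure T (Fintype.card S) :=
          (measure_biUnion_finset_le _ _).trans (Finset.sum_le_sum fun h _ => hlevel h)
      _ = _ := by simp [Params.stepFailure]
  refine (one_sub_le_lintegral_lintegral_lintegral _ _ _ hE).trans ?_
  rw [Interaction.prob_eq_expect]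
  simp only [tsrStep, Interaction.expect_bind, Interaction.expect_sampleUnif,
    Interaction.expect_sample, Interaction.expect_seeds, Interaction.expect_pure]
  refine lintegral_mono fun D => lintegral_mono fun D'' => lintegral_mono fun ω => ?_
  by_cases hz : (D, D'', ω) ∈ E
  · simp [hz]
  · have hgood : ∀ h, ∃ α, GoodStep M U c T φ m (fun j => (D'' j).1 h) h
        (U.decoder c.δ₁ N (ω h) fun j => (D j).1 h) α := by
      intro h
      by_contra hc
      exact hz ⟨h, hc⟩
    choose α hα using hgood
    have hstep := hm.step hα ha.threshold_pos hθB
    rw [Set.indicator_of_mem (show (D, D'', ω) ∈ Eᶜ from hz), Set.indicator_of_mem]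
    · exact le_rfl
    · exact hstep

/-- Safety persists once it has occurred, and until then every good step confirms at least one
label. -/
theorem Adequate.le_prob_tsrLoop {M : BMDP S A X H} {U : Learner S X} {c : Params} {T : ℕ}
    {g : ℕ → ℝ → ℝ} (ha : Adequate M U c T g) {k : ℕ} {m : Memory S A X H c.B}
    (hm : Invariant M U c T (k * numIter S H) m) (π : Policy S A H) :
    ∀ j, k * numIter S H + j ≤ T → 1 - j * c.stepFailure T H (Fintype.card S) ≤ Interaction.prob M
      (progressSet M U c T (k * numIter S H) j π m) (tsrLoop c U k π m j)
  | 0, _ => by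
    classical
    change _ ≤ if _ then _ else _
    rw [if_pos]
    · simp
    · exact ⟨hm, fun _ _ _ h => h, Or.inl le_rfl⟩
  | j + 1, hj => by
    have ih := ha.le_prob_tsrLoop hm π j (by omega)
    rw [tsrLoop]
    push_cast
    rw [add_mul, one_mul]
    refine Interaction.le_prob_bind M ih fun m' hm' => ?_
    obtain ⟨h1, h2, h3⟩ := hm'
    refine (ha.le_prob_tsrStep (by omega) h1 π).trans (Interaction.prob_mono M ?_ _)
    rintro m'' ⟨h4, h5, h6⟩
    refine ⟨h4, h2.trans h5, ?_⟩
    rcases h3 with h3 | h3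
    · rcases h6 with h6 | h6
      · exact Or.inl (by omega)
      · exact Or.inr h6
    · exact Or.inr (h3.mono h5)

/-- The results of a successful run of the iterations of the trajectory sampling routine. -/
def readySet (M : BMDP S A X H) (U : Learner S X) (c : Params) (T n : ℕ) (π : Policy S A H)
    (m : Memory S A X H c.B) : Set (Memory S A X H c.B) :=
  {m' | Invariant M U c T n m' ∧ Extends m.standard m'.standard ∧ Safe M c π m'.standard}

/-- J exceeds the number of pairs of a level and a label by one, so J steps cannot all confirm a new
label. -/
theorem Adequate.le_prob_tsrLoop_numIter {M : BMDP S A X H} {U : Learner S X} {c : Params} {T : ℕ}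
    {g : ℕ → ℝ → ℝ} (ha : Adequate M U c T g) {k : ℕ} (hk : (k + 1) * numIter S H ≤ T)
    {m : Memory S A X H c.B} (hm : Invariant M U c T (k * numIter S H) m) (π : Policy S A H) :
    1 - numIter S H * c.stepFailure T H (Fintype.card S) ≤ Interaction.prob M
      (readySet M U c T ((k + 1) * numIter S H) π m) (tsrLoop c U k π m (numIter S H)) := by
  refine (ha.le_prob_tsrLoop hm π (numIter S H) (by linarith)).trans (Interaction.prob_mono M ?_ _)
  rintro m' ⟨h1, h2, h3⟩
  refine ⟨by rw [add_mul, one_mul]; exact h1, h2, h3.resolve_left fun h => ?_⟩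
  have := numConfirmed_lt_numIter m'.standard
  omega

end TrajectorySampling

section SingleSample

variable {S A X : Type} [Fintype S] [MeasurableSpace S] [Fintype A] [MeasurableSpace A]
  [MeasurableSpace X] {H : ℕ}

theorem Interaction.expect_sample_one (M : BMDP S A X H) (φ : Policy X A H)
    (F : Trajectory X A H → ℝ≥0∞) :
    Interaction.expect M (fun τ => F (τ 0)) (Interaction.sample φ 1) =
      ∫⁻ τ, F τ ∂(M.trajLaw φ) := by
  rw [Interaction.expect_sample]
  exact (measurePreserving_funUnique (M.trajLaw φ) (Fin 1)).lintegral_comp_emb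
    (MeasurableEquiv.measurableEmbedding _) F

end SingleSample

/-! ### The potential argument for the simulated tabular algorithm -/

section Simulation

variable {S A X : Type} [Fintype S] [MeasurableSpace S] [DiscreteMeasurableSpace S]
  [Fintype A] [MeasurableSpace A] [DiscreteMeasurableSpace A] [MeasurableSpace X] {H : ℕ}

/-- The probability that the output of the algorithm is not `ε`-optimal, if `r` episodes remain
after the given ones. -/
def TabularAlg.failure (𝒜 : TabularAlg S A H) (M : MDP S A H) (ε : ℝ) (ω : Seed) :
    (r k : ℕ) → (Fin k → Trajectory S A H) → ℝ≥0∞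
  | 0, k, past => {π | M.toBMDP.IsEpsOptimal ε π}ᶜ.indicator 1 (𝒜.propose k ω past)
  | r + 1, k, past => ∫⁻ t, 𝒜.failure M ε ω r (k + 1)
      (Fin.snoc (α := fun _ => Trajectory S A H) past t) ∂(M.toBMDP.trajLaw (𝒜.propose k ω past))

theorem TabularAlg.failure_le_one (𝒜 : TabularAlg S A H) (M : MDP S A H) (ε : ℝ) (ω : Seed) :
    ∀ r k past, 𝒜.failure M ε ω r k past ≤ 1
  | 0, k, past => Set.indicator_le_self' (fun _ _ => zero_le) _
  | r + 1, k, past => by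
    rw [failure]
    refine (lintegral_mono fun t => 𝒜.failure_le_one M ε ω r (k + 1) _).trans ?_
    simp

/-- The probability that the output is `ε`-optimal, for a given seed. -/
def TabularAlg.success (𝒜 : TabularAlg S A H) (M : MDP S A H) (ε : ℝ) (ω : Seed) : ℝ≥0∞ :=
  Interaction.expect M.toBMDP (fun past => {π | M.toBMDP.IsEpsOptimal ε π}.indicator 1
    (𝒜.propose 𝒜.K ω past)) (𝒜.episodes ω 𝒜.K)

/-- Along a run in the MDP the expectation of 1 - `failure` does not increase with the number of
episodes played. Unlike the success probability of a complete run, `failure` is a function of an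
arbitrary past, so it can also be followed along trajectories that come from the Block MDP. -/
theorem TabularAlg.success_add_failure_le (𝒜 : TabularAlg S A H) (M : MDP S A H) (ε : ℝ)
    (ω : Seed) : 𝒜.success M ε ω + 𝒜.failure M ε ω 𝒜.K 0 Fin.elim0 ≤ 1 := by
  have hstep : ∀ r k, Interaction.expect M.toBMDP (fun past => 1 - 𝒜.failure M ε ω r (k + 1) past)
      (𝒜.episodes ω (k + 1)) ≤ Interaction.expect M.toBMDP
        (fun past => 1 - 𝒜.failure M ε ω (r + 1) k past) (𝒜.episodes ω k) := by
    intro r k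
    rw [episodes, Interaction.expect_bind]
    refine Interaction.expect_mono _ (fun past => ?_) _
    rw [Interaction.expect_bind]
    simp only [Interaction.expect_pure]
    rw [Interaction.expect_sample_one M.toBMDP (𝒜.propose k ω past)
      (fun t => 1 - 𝒜.failure M ε ω r (k + 1)
        (Fin.snoc (α := fun _ => Trajectory S A H) past t)), failure]
    -- Subtraction under the integral is legitimate because the law of a trajectory of a finite MDP
    -- has finite support.
    rw [lintegral_sub' (BMDP.aemeasurable_trajLaw _ _ _)]
    · simp
    · refine ((lintegral_mono fun t => 𝒜.failure_le_one M ε ω r (k + 1) _).trans_lt ?_).ne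
      simp
    · exact ae_of_all _ fun t => 𝒜.failure_le_one M ε ω r (k + 1) _
  have hiter : ∀ k r, k + r = 𝒜.K → Interaction.expect M.toBMDP
      (fun past => 1 - 𝒜.failure M ε ω r k past) (𝒜.episodes ω k) ≤
        1 - 𝒜.failure M ε ω 𝒜.K 0 Fin.elim0 := by
    intro k
    induction k with
    | zero =>
      intro r hr
      rw [zero_add] at hr
      rw [hr]
      exact le_rfl
    | succ k ih =>
      intro r hr
      exact (hstep r k).trans (ih (r + 1) (by omega))
  have h1 : 𝒜.success M ε ω ≤ 1 - 𝒜.failure M ε ω 𝒜.K 0 Fin.elim0 := by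
    refine le_trans (Interaction.expect_mono _ (fun past => ?_) _) (hiter 𝒜.K 0 rfl)
    rw [failure]
    by_cases h : 𝒜.propose 𝒜.K ω past ∈ {π | M.toBMDP.IsEpsOptimal ε π}
    · simp [h]
    · simp [h]
  calc _ ≤ (1 - 𝒜.failure M ε ω 𝒜.K 0 Fin.elim0) + 𝒜.failure M ε ω 𝒜.K 0 Fin.elim0 := by gcongr
    _ = 1 := tsub_add_cancel_of_le (𝒜.failure_le_one M ε ω _ _ _)

theorem TabularAlg.IsCorrect.le_lintegral_success {𝒜 : TabularAlg S A H} {ε δ : ℝ}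
    (h : 𝒜.IsCorrect ε δ) (M : MDP S A H) :
    ENNReal.ofReal (1 - δ) ≤ ∫⁻ ω, 𝒜.success M ε ω := by
  have h1 := h M
  rw [Interaction.prob_eq_expect, run, Interaction.expect_bind, Interaction.expect_seeds] at h1
  refine h1.trans (le_of_eq ?_)
  have h2 := (volume_preserving_funUnique (Fin 1) Seed).lintegral_comp_emb
    (MeasurableEquiv.measurableEmbedding _) (𝒜.success M ε)
  rw [← h2]
  refine lintegral_congr fun ω => ?_
  rw [Interaction.expect_bind]
  rfl

/-- The bound for the probability that an observed trajectory is decoded incorrectly after a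
successful run of the trajectory sampling routine. -/
def Params.decodeFailure (c : Params) (H k : ℕ) : ℝ≥0∞ :=
  ENNReal.ofReal ((H + 1) * (3 * k * c.threshold))

/-- The bound for the probability that the iterations of the trajectory sampling routine fail. -/
def Params.loopFailure (S : Type) [Fintype S] (c : Params) (T H : ℕ) : ℝ≥0∞ :=
  numIter S H * c.stepFailure T H (Fintype.card S)

open Classical in
/-- A lower bound for the probability that the simulation of the tabular algorithm leads to a good
policy, if `r` episodes remain. -/
def potential (M : BMDP S A X H) (U : Learner S X) (c : Params) (T : ℕ) (𝒜 : TabularAlg S A H)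
    (ε : ℝ) (ω : Seed) (r k : ℕ) (z : (Fin k → Trajectory S A H) × Memory S A X H c.B) : ℝ≥0∞ :=
  if Invariant M U c T (k * numIter S H) z.2 then
    1 - (r * (c.loopFailure S T H + c.decodeFailure H (Fintype.card S)) +
      ∑ α with Consistent M c z.2.standard α, 𝒜.failure (M.toMDP.relabel α) ε ω r k z.1)
  else 0

/-- One episode loses ξ for a failure of the iterations and `a` for leaving the correct set. On that
set the decoded trajectory is dominated, for every consistent α at once, by the law in the
relabelled MDP, so each failure term averages to at most its previous value. New confirmations only
remove terms from the sum. -/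
theorem Adequate.potential_le_expect_tsr {M : BMDP S A X H} {U : Learner S X} {c : Params} {T : ℕ}
    {g : ℕ → ℝ → ℝ} (ha : Adequate M U c T g) (𝒜 : TabularAlg S A H) (ε : ℝ) (ω : Seed) {r k : ℕ}
    (hk : (k + 1) * numIter S H ≤ T)
    (z : (Fin k → Trajectory S A H) × Memory S A X H c.B) :
    potential M U c T 𝒜 ε ω (r + 1) k z ≤ Interaction.expect M
      (fun y => potential M U c T 𝒜 ε ω r (k + 1)
        (Fin.snoc (α := fun _ => Trajectory S A H) z.1 y.1, y.2))
      (tsr c U k (𝒜.propose k ω z.1) z.2) := by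
  classical
  obtain ⟨past, m⟩ := z
  by_cases hm : Invariant M U c T (k * numIter S H) m
  swap
  · simp [potential, hm]
  set π := 𝒜.propose k ω past with hπ
  set ξ := c.loopFailure S T H with hξ
  set a := c.decodeFailure H (Fintype.card S) with ha'
  let u : (Fin (H + 1) → Equiv.Perm S) → Trajectory S A H → ℝ≥0∞ := fun α t =>
    𝒜.failure (M.toMDP.relabel α) ε ω r (k + 1)
      (Fin.snoc (α := fun _ => Trajectory S A H) past t)
  set σ : ℝ≥0∞ := ∑ α with Consistent M c m.standard α,
    𝒜.failure (M.toMDP.relabel α) ε ω (r + 1) k past with hσ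
  have hpot : potential M U c T 𝒜 ε ω (r + 1) k (past, m) = 1 - (ξ + (a + (r * (ξ + a) + σ))) := by
    rw [potential, if_pos hm]
    congr 1
    push_cast
    ring
  rw [hpot, tsr]
  refine Interaction.le_expect_bind M (ha.le_prob_tsrLoop_numIter hk hm π) fun m' hm' => ?_
  obtain ⟨hinv, hext, hsafe⟩ := hm'
  rw [Interaction.expect_bind]
  simp only [Interaction.expect_pure]
  rw [Interaction.expect_sample_one M (π.comp m'.decoders) (fun τ =>
    potential M U c T 𝒜 ε ω r (k + 1) (Fin.snoc (α := fun _ => Trajectory S A H) past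
      (decode m'.decoders τ), m'))]
  have hval : ∀ τ, potential M U c T 𝒜 ε ω r (k + 1)
      (Fin.snoc (α := fun _ => Trajectory S A H) past (decode m'.decoders τ), m') =
      1 - (r * (ξ + a) + ∑ α with Consistent M c m'.standard α, u α (decode m'.decoders τ)) := by
    intro τ
    rw [potential, if_pos hinv]
  simp only [hval]
  obtain ⟨α₀, hα₀⟩ := hinv.exists_consistent ha.threshold_le
  set G := correctSet M m'.standard m'.decoders α₀ with hG
  have hGm : MeasurableSet G := measurableSet_correctSet _ _ _ _
  have hGm' : MeasurableSet {τ : Trajectory X A H | τ.1 ∈ G} := measurable_fst hGm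
  have hG1 : 1 - a ≤ M.trajLaw (π.comp m'.decoders) {τ | τ.1 ∈ G} := by
    have h1 := hinv.trajLaw_compl_correctSet_le ha.threshold_pos.le hsafe hα₀
    have h2 := prob_compl_eq_one_sub (μ := M.trajLaw (π.comp m'.decoders)) hGm'
    have h3 : M.trajLaw (π.comp m'.decoders) {τ | τ.1 ∈ G}ᶜ ≤ a := h1
    rw [h2] at h3
    exact tsub_le_iff_tsub_le.1 h3
  have hdec : ∀ α, Consistent M c m'.standard α → _ := fun α hα =>
    M.lintegral_decode_le α π m'.decoders hGm
      (fun x hx l => (hα₀.correctSet_subset hα hx l).2) (u α)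
  set ν := (M.trajLaw (π.comp m'.decoders)).restrict {τ | τ.1 ∈ G} with hν
  set W : Trajectory X A H → ℝ≥0∞ := fun τ =>
    r * (ξ + a) + ∑ α with Consistent M c m'.standard α, u α (decode m'.decoders τ) with hW
  have hsum : AEMeasurable (fun τ => ∑ α with Consistent M c m'.standard α,
      u α (decode m'.decoders τ)) ν :=
    Finset.aemeasurable_fun_sum _ fun α hα => (hdec α (Finset.mem_filter.1 hα).2).1
  have hWm : AEMeasurable W ν := aemeasurable_const.add hsum
  have hW1 : ∫⁻ τ, W τ ∂ν ≤ r * (ξ + a) + σ := by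
    rw [hW, lintegral_add_left' aemeasurable_const, lintegral_const]
    refine add_le_add ?_ ?_
    · refine mul_le_of_le_one_right zero_le ?_
      rw [hν, Measure.restrict_apply_univ]
      exact prob_le_one
    · rw [lintegral_finsetSum' _ fun α hα => (hdec α (Finset.mem_filter.1 hα).2).1]
      calc _ ≤ ∑ α with Consistent M c m'.standard α,
            𝒜.failure (M.toMDP.relabel α) ε ω (r + 1) k past :=
            Finset.sum_le_sum fun α hα => (hdec α (Finset.mem_filter.1 hα).2).2
        _ ≤ σ := Finset.sum_le_sum_of_subset fun α hα => by
            simp only [Finset.mem_filter, Finset.mem_univ, true_and] at hα ⊢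
            exact hα.anti hext
  calc 1 - (a + (r * (ξ + a) + σ)) = (1 - a) - (r * (ξ + a) + σ) := by rw [tsub_tsub]
    _ ≤ M.trajLaw (π.comp m'.decoders) {τ | τ.1 ∈ G} - ∫⁻ τ, W τ ∂ν := tsub_le_tsub hG1 hW1
    _ ≤ ∫⁻ τ, (1 - W τ) ∂ν := by
        have h1 : ∫⁻ _τ, 1 ∂ν = M.trajLaw (π.comp m'.decoders) {τ | τ.1 ∈ G} := by
          rw [lintegral_one, hν, Measure.restrict_apply_univ]
        rw [← h1]
        exact lintegral_sub_le' _ _ hWm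
    _ ≤ ∫⁻ τ, (1 - W τ) ∂(M.trajLaw (π.comp m'.decoders)) :=
        lintegral_mono' Measure.restrict_le_self le_rfl

theorem Adequate.potential_le_expect_simEpisodes {M : BMDP S A X H} {U : Learner S X} {c : Params}
    {T : ℕ} {g : ℕ → ℝ → ℝ} (ha : Adequate M U c T g) (𝒜 : TabularAlg S A H)
    (f₀ : Fin (H + 1) → Decoder S X) (ε : ℝ) (ω : Seed) : ∀ k r, k * numIter S H ≤ T →
    potential M U c T 𝒜 ε ω (r + k) 0 (Fin.elim0, ⟨[], fun _ _ => none, f₀⟩) ≤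
      Interaction.expect M (potential M U c T 𝒜 ε ω r k) (simEpisodes c U 𝒜 f₀ ω k)
  | 0, r, _ => le_rfl
  | k + 1, r, hk => by
    have ih := ha.potential_le_expect_simEpisodes 𝒜 f₀ ε ω k (r + 1)
      ((Nat.mul_le_mul_right _ (Nat.le_succ k)).trans hk)
    rw [show r + (k + 1) = r + 1 + k by ring]
    refine ih.trans ?_
    rw [simEpisodes, Interaction.expect_bind]
    refine Interaction.expect_mono _ (fun z => ?_) _
    refine (ha.potential_le_expect_tsr 𝒜 ε ω hk z).trans ?_
    obtain ⟨past, m⟩ := z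
    simp only []
    rw [Interaction.expect_bind]
    exact le_rfl

end Simulation

/-! ### Success probability of an outer iteration -/

section OuterIteration

theorem sum_lintegral_le_lintegral_sum {Y ι : Type*} [MeasurableSpace Y] (μ : Measure Y)
    (s : Finset ι) (F : ι → Y → ℝ≥0∞) :
    ∑ i ∈ s, ∫⁻ y, F i y ∂μ ≤ ∫⁻ y, ∑ i ∈ s, F i y ∂μ := by
  classical
  induction s using Finset.induction_on with
  | empty => simp
  | insert i s hi ih =>
    simp only [Finset.sum_insert hi]
    exact (add_le_add le_rfl ih).trans (le_lintegral_add _ _)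

theorem lintegral_seed (F : Seed → ℝ≥0∞) : ∫⁻ ω : Fin 1 → Seed, F (ω 0) = ∫⁻ ω, F ω :=
  (volume_preserving_funUnique (Fin 1) Seed).lintegral_comp_emb
    (MeasurableEquiv.measurableEmbedding _) F

variable {S A X : Type} [Fintype S] [MeasurableSpace S] [DiscreteMeasurableSpace S]
  [Fintype A] [MeasurableSpace A] [DiscreteMeasurableSpace A] [MeasurableSpace X] {H : ℕ}

/-- The accuracy of the policy obtained from an `ε`-optimal policy on the states by decoding. -/
def Params.accuracy (c : Params) (H k : ℕ) (ε : ℝ) : ℝ :=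
  ε + H * ((H + 1) * (3 * k * c.threshold))

theorem Invariant.isEpsOptimal_comp {M : BMDP S A X H} {U : Learner S X} {c : Params} {T n : ℕ}
    {m : Memory S A X H c.B} (hm : Invariant M U c T n m) (hθ : 0 ≤ c.threshold)
    {π : Policy S A H} (hs : Safe M c π m.standard) {α : Fin (H + 1) → Equiv.Perm S}
    (hα : Consistent M c m.standard α) {ε : ℝ}
    (hπ : (M.toMDP.relabel α).toBMDP.IsEpsOptimal ε π) :
    M.IsEpsOptimal (c.accuracy H (Fintype.card S) ε) (π.comp m.decoders) := by
  intro ψ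
  have h1 := M.le_value_comp_trueDecoder α π hπ ψ
  have h2 := hm.trajLaw_compl_correctSet_le hθ hs hα
  rw [trajLaw_compl_correctSet] at h2
  have h3 := M.value_le_of_agree (π.comp m.decoders) (π.comp (M.trueDecoder α))
    (measurableSet_correctSet M m.standard m.decoders α)
    (fun x hx l a => by simp [Policy.comp, BMDP.trueDecoder, (hx l.castSucc).2])
    (by positivity) h2
  rw [Params.accuracy]
  linarith

/-- With no episode left each failure term is 0 or 1. A nonzero potential therefore forces the
proposed policy to be ε-optimal in all relabelled MDPs consistent with the memory, and the last call
of the sampling routine only shrinks this class. -/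
theorem Adequate.mul_potential_le_expect_tsr {M : BMDP S A X H} {U : Learner S X} {c : Params}
    {T : ℕ} {g : ℕ → ℝ → ℝ} (ha : Adequate M U c T g) (𝒜 : TabularAlg S A H) (ε : ℝ) (ω : Seed)
    {k : ℕ} (hk : (k + 1) * numIter S H ≤ T)
    (z : (Fin k → Trajectory S A H) × Memory S A X H c.B) :
    (1 - c.loopFailure S T H) * potential M U c T 𝒜 ε ω 0 k z ≤ Interaction.expect M
      (fun y => {φ | M.IsEpsOptimal (c.accuracy H (Fintype.card S) ε) φ}.indicator 1
        ((𝒜.propose k ω z.1).comp y.2.decoders)) (tsr c U k (𝒜.propose k ω z.1) z.2) := by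
  classical
  obtain ⟨past, m⟩ := z
  set π := 𝒜.propose k ω past with hπ
  rcases eq_or_ne (potential M U c T 𝒜 ε ω 0 k (past, m)) 0 with h0 | h0
  · rw [h0, mul_zero]; exact zero_le
  have hm : Invariant M U c T (k * numIter S H) m := by
    by_contra hc
    exact h0 (by simp [potential, hc])
  have hgood : ∀ α, Consistent M c m.standard α →
      (M.toMDP.relabel α).toBMDP.IsEpsOptimal ε π := by
    intro α hα
    by_contra hc
    refine h0 ?_
    rw [potential, if_pos hm]
    refine tsub_eq_zero_of_le (le_trans ?_ le_add_self)
    have h1 : 𝒜.failure (M.toMDP.relabel α) ε ω 0 k past = 1 := by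
      rw [TabularAlg.failure, Set.indicator_of_mem]
      · rfl
      · exact hc
    rw [← h1]
    exact Finset.single_le_sum
      (f := fun α => 𝒜.failure (M.toMDP.relabel α) ε ω 0 k past) (fun _ _ => zero_le)
      (Finset.mem_filter.2 ⟨Finset.mem_univ α, hα⟩)
  have hle : potential M U c T 𝒜 ε ω 0 k (past, m) ≤ 1 := by
    rw [potential, if_pos hm]
    exact tsub_le_self
  refine (mul_le_of_le_one_right zero_le hle).trans ?_
  rw [tsr, ← add_zero (c.loopFailure S T H)]
  refine Interaction.le_expect_bind M (ha.le_prob_tsrLoop_numIter hk hm π) fun m' hm' => ?_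
  obtain ⟨hinv, hext, hsafe⟩ := hm'
  obtain ⟨α, hα⟩ := hinv.exists_consistent ha.threshold_le
  rw [Interaction.expect_bind]
  refine Interaction.le_expect_of_forall M (fun τ => ?_) _
  rw [Interaction.expect_pure, tsub_zero, Set.indicator_of_mem]
  · exact le_rfl
  · exact hinv.isEpsOptimal_comp ha.threshold_pos.le hsafe hα (hgood α (hα.anti hext))

/-- The bound for the probability that an outer iteration fails. -/
def Params.outerFailure (S : Type) [Fintype S] (c : Params) (T K H : ℕ) : ℝ≥0∞ :=
  (K + 1) * (c.loopFailure S T H + c.decodeFailure H (Fintype.card S)) +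
    (((Fintype.card S).factorial ^ (H + 1) : ℕ) : ℝ≥0∞) * ENNReal.ofReal c.δ₂

/-- At the start every α is consistent, so the union bound runs over all (|S|!)^(H+1) relabelled
MDPs. Measurability in the seed is avoided: success + failure ≤ 1 turns the bound into the pointwise
inequality 1 + ∑ success ≤ v + C + N, whose integration needs only superadditivity of the lower
integral on its left side. -/
theorem Adequate.le_prob_outerIter {M : BMDP S A X H} {U : Learner S X} {c : Params} {T : ℕ}
    {g : ℕ → ℝ → ℝ} (ha : Adequate M U c T g) {𝒜 : TabularAlg S A H} {ε : ℝ}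
    (h𝒜 : 𝒜.IsCorrect ε c.δ₂) (hT : (𝒜.K + 1) * numIter S H ≤ T)
    (f₀ : Fin (H + 1) → Decoder S X) :
    1 - c.outerFailure S T 𝒜.K H ≤ Interaction.prob M
      {φ | M.IsEpsOptimal (c.accuracy H (Fintype.card S) ε) φ} (outerIter c U 𝒜 f₀) := by
  classical
  set E : Set (Policy X A H) := {φ | M.IsEpsOptimal (c.accuracy H (Fintype.card S) ε) φ} with hE
  set ξ := c.loopFailure S T H with hξ
  set a := c.decodeFailure H (Fintype.card S) with ha'
  set N : ℝ≥0∞ := (((Fintype.card S).factorial ^ (H + 1) : ℕ) : ℝ≥0∞) with hN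
  let v : Seed → ℝ≥0∞ := fun ω => Interaction.expect M (fun z => Interaction.expect M
    (fun y => E.indicator 1 ((𝒜.propose 𝒜.K ω z.1).comp y.2.decoders))
    (tsr c U 𝒜.K (𝒜.propose 𝒜.K ω z.1) z.2)) (simEpisodes c U 𝒜 f₀ ω 𝒜.K)
  have hprob : Interaction.prob M E (outerIter c U 𝒜 f₀) = ∫⁻ ω, v ω := by
    rw [Interaction.prob_eq_expect, outerIter, Interaction.expect_bind, Interaction.expect_seeds,
      ← lintegral_seed]
    refine lintegral_congr fun ω => ?_
    rw [Interaction.expect_bind]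
    congr 1
    funext z
    obtain ⟨past, m⟩ := z
    simp only []
    rw [Interaction.expect_bind]
    rfl
  set C := ξ + 𝒜.K * (ξ + a) with hC
  have hv : ∀ ω, 1 ≤ v ω + (C + ∑ α, 𝒜.failure (M.toMDP.relabel α) ε ω 𝒜.K 0 Fin.elim0) := by
    intro ω
    rw [← tsub_le_iff_right, hC, add_assoc]
    refine (Interaction.one_sub_add_le_mul _ _).trans ?_
    have h1 := ha.potential_le_expect_simEpisodes 𝒜 f₀ ε ω 𝒜.K 0
      ((Nat.mul_le_mul_right _ (Nat.le_succ _)).trans hT)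
    have hinit : Invariant M U c T (0 * numIter S H)
        (⟨[], fun _ _ => none, f₀⟩ : Memory S A X H c.B) :=
      ⟨by simp, fun h s D hD => by cases hD⟩
    have h2 : potential M U c T 𝒜 ε ω (0 + 𝒜.K) 0 (Fin.elim0, ⟨[], fun _ _ => none, f₀⟩) =
        1 - (𝒜.K * (ξ + a) + ∑ α, 𝒜.failure (M.toMDP.relabel α) ε ω 𝒜.K 0 Fin.elim0) := by
      rw [potential, if_pos hinit, zero_add]
      congr 2
      refine Finset.sum_congr (Finset.filter_true_of_mem fun α _ => ?_) fun _ _ => rfl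
      intro h s D hD
      cases hD
    rw [h2] at h1
    refine (mul_le_mul_right h1 _).trans ?_
    have h3 := Interaction.add_mul_expect_le M 0 (1 - ξ) (potential M U c T 𝒜 ε ω 0 𝒜.K)
      (simEpisodes c U 𝒜 f₀ ω 𝒜.K)
    simp only [zero_add] at h3
    exact h3.trans (Interaction.expect_mono M
      (fun z => ha.mul_potential_le_expect_tsr 𝒜 ε ω hT z) _)
  have hcard : (Fintype.card (Fin (H + 1) → Equiv.Perm S) : ℝ≥0∞) = N := by
    rw [hN]
    congr 1
    simp [Fintype.card_perm]
  have hpoint : ∀ ω, 1 + ∑ α, 𝒜.success (M.toMDP.relabel α) ε ω ≤ v ω + (C + N) := by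
    intro ω
    calc 1 + ∑ α, 𝒜.success (M.toMDP.relabel α) ε ω
        ≤ (v ω + (C + ∑ α, 𝒜.failure (M.toMDP.relabel α) ε ω 𝒜.K 0 Fin.elim0)) +
          ∑ α, 𝒜.success (M.toMDP.relabel α) ε ω := by gcongr; exact hv ω
      _ = v ω + (C + ∑ α, (𝒜.success (M.toMDP.relabel α) ε ω +
          𝒜.failure (M.toMDP.relabel α) ε ω 𝒜.K 0 Fin.elim0)) := by
        rw [Finset.sum_add_distrib]; ring
      _ ≤ v ω + (C + ∑ _α : Fin (H + 1) → Equiv.Perm S, 1) := by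
        gcongr with α
        exact 𝒜.success_add_failure_le _ ε ω
      _ = v ω + (C + N) := by simp [← hcard]
  have hint : 1 + N * ENNReal.ofReal (1 - c.δ₂) ≤ (∫⁻ ω, v ω) + (C + N) := by
    calc 1 + N * ENNReal.ofReal (1 - c.δ₂)
        = 1 + ∑ _α : Fin (H + 1) → Equiv.Perm S, ENNReal.ofReal (1 - c.δ₂) := by simp [← hcard]
      _ ≤ 1 + ∑ α : Fin (H + 1) → Equiv.Perm S, ∫⁻ ω, 𝒜.success (M.toMDP.relabel α) ε ω := by
        gcongr with α
        exact h𝒜.le_lintegral_success _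
      _ ≤ (∫⁻ _ω : Seed, 1) + ∫⁻ ω : Seed, ∑ α, 𝒜.success (M.toMDP.relabel α) ε ω := by
        gcongr
        · simp
        · exact sum_lintegral_le_lintegral_sum _ _ _
      _ ≤ ∫⁻ ω : Seed, (1 + ∑ α, 𝒜.success (M.toMDP.relabel α) ε ω) := le_lintegral_add _ _
      _ ≤ ∫⁻ ω, (v ω + (C + N)) := lintegral_mono hpoint
      _ = (∫⁻ ω, v ω) + (C + N) := by
        rw [lintegral_add_right _ measurable_const]; simp
  have hNtop : N ≠ ⊤ := ENNReal.natCast_ne_top _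
  have hfin : 1 ≤ (∫⁻ ω, v ω) + (C + N * ENNReal.ofReal c.δ₂) := by
    have h1 : N ≤ N * ENNReal.ofReal (1 - c.δ₂) + N * ENNReal.ofReal c.δ₂ := by
      rw [← mul_add]
      refine le_mul_of_one_le_right zero_le ?_
      refine le_trans ?_ ENNReal.ofReal_add_le
      simp
    have h2 : 1 + N ≤ (∫⁻ ω, v ω) + (C + N * ENNReal.ofReal c.δ₂) + N := by
      calc 1 + N ≤ 1 + (N * ENNReal.ofReal (1 - c.δ₂) + N * ENNReal.ofReal c.δ₂) := by gcongr
        _ = (1 + N * ENNReal.ofReal (1 - c.δ₂)) + N * ENNReal.ofReal c.δ₂ := by ring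
        _ ≤ ((∫⁻ ω, v ω) + (C + N)) + N * ENNReal.ofReal c.δ₂ := by gcongr
        _ = _ := by ring
    exact (ENNReal.add_le_add_iff_right hNtop).1 h2
  rw [hprob, tsub_le_iff_right]
  refine hfin.trans ?_
  gcongr
  rw [Params.outerFailure, hC]
  gcongr
  rw [add_mul, one_mul, add_comm]
  gcongr
  exact le_self_add

end OuterIteration

/-! ### Repetition, evaluation and selection of a policy -/

section Framework

variable {S A X : Type} [Fintype S] [MeasurableSpace S] [DiscreteMeasurableSpace S]
  [Fintype A] [MeasurableSpace A] [DiscreteMeasurableSpace A] [MeasurableSpace X] {H : ℕ}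

theorem le_prob_evaluate (M : BMDP S A X H) (φ : Policy X A H) (L : ℕ) {E : Set ℝ}
    (hE : MeasurableSet E) {b : ℝ≥0∞}
    (hb : (Measure.pi fun _ : Fin L => M.trajLaw φ)
      {τ | (∑ j, ∑ h, (τ j).2.2 h) / (L : ℝ) ∈ Eᶜ} ≤ b) :
    1 - b ≤ Interaction.prob M E (evaluate φ L) := by
  have hm : Measurable fun τ : Fin L → Trajectory X A H => (∑ j, ∑ h, (τ j).2.2 h) / (L : ℝ) :=
    (Finset.measurable_sum _ fun j _ =>
      measurable_totalReward.comp (measurable_pi_apply j)).div_const _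
  have hmE := hm hE
  rw [Interaction.prob_eq_expect, evaluate, Interaction.expect_bind, Interaction.expect_sample]
  simp only [Interaction.expect_pure]
  have h1 : (fun τ : Fin L → Trajectory X A H =>
      E.indicator (1 : ℝ → ℝ≥0∞) ((∑ j, ∑ h, (τ j).2.2 h) / (L : ℝ))) =
      ((fun τ : Fin L → Trajectory X A H => (∑ j, ∑ h, (τ j).2.2 h) / (L : ℝ)) ⁻¹' E).indicator 1 := by
    funext τ
    rfl
  rw [h1, lintegral_indicator_one hmE]
  have h2 := prob_compl_eq_one_sub (μ := Measure.pi fun _ : Fin L => M.trajLaw φ) hmE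
  have h3 : (Measure.pi fun _ : Fin L => M.trajLaw φ)
    ((fun τ : Fin L → Trajectory X A H => (∑ j, ∑ h, (τ j).2.2 h) / (L : ℝ)) ⁻¹' E)ᶜ ≤ b := hb
  rw [h2] at h3
  exact tsub_le_iff_tsub_le.1 h3

theorem BMDP.value_eq_zero (M : BMDP S A X H) (hH : H = 0) (φ : Policy X A H) : M.value φ = 0 := by
  subst hH
  simp [BMDP.value]

theorem le_prob_evaluate_ge (M : BMDP S A X H) (φ : Policy X A H) {L : ℕ} (hL : 0 < H → 0 < L)
    {t : ℝ} (ht : 0 < t) {b : ℝ≥0∞}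
    (hb : ENNReal.ofReal (Real.exp (-(2 * L * t ^ 2 / (H : ℝ) ^ 2))) ≤ b) :
    1 - b ≤ Interaction.prob M {v | M.value φ - t < v} (evaluate φ L) := by
  refine le_prob_evaluate M φ L measurableSet_Ioi ?_
  rcases Nat.eq_zero_or_pos H with hH | hH
  · have h0 := M.value_eq_zero hH φ
    subst hH
    refine le_trans (measure_mono (t := ∅) fun τ hτ => ?_) (by simp)
    refine hτ ?_
    simp [h0, ht]
  · have hL' : (0 : ℝ) < L := by exact_mod_cast hL hH
    refine le_trans (measure_mono fun τ hτ => ?_) ((hoeffding_le (M.trajLaw φ)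
      measurable_totalReward (M.ae_totalReward φ) L ht.le).trans (by simpa using hb))
    have h1 : (∑ j, ∑ h, (τ j).2.2 h) / (L : ℝ) ≤ M.value φ - t := not_lt.1 hτ
    rw [div_le_iff₀ hL'] at h1
    change ∑ j, ∑ h, (τ j).2.2 h ≤ L * M.value φ - L * t
    linarith

theorem le_prob_evaluate_le (M : BMDP S A X H) (φ : Policy X A H) {L : ℕ} (hL : 0 < H → 0 < L)
    {t : ℝ} (ht : 0 < t) {b : ℝ≥0∞}
    (hb : ENNReal.ofReal (Real.exp (-(2 * L * t ^ 2 / (H : ℝ) ^ 2))) ≤ b) :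
    1 - b ≤ Interaction.prob M {v | v < M.value φ + t} (evaluate φ L) := by
  refine le_prob_evaluate M φ L measurableSet_Iio ?_
  rcases Nat.eq_zero_or_pos H with hH | hH
  · have h0 := M.value_eq_zero hH φ
    subst hH
    refine le_trans (measure_mono (t := ∅) fun τ hτ => ?_) (by simp)
    refine hτ ?_
    simp [h0, ht]
  · have hL' : (0 : ℝ) < L := by exact_mod_cast hL hH
    refine le_trans (measure_mono fun τ hτ => ?_) ((hoeffding_ge (M.trajLaw φ)
      measurable_totalReward (M.ae_totalReward φ) L ht.le).trans (by simpa using hb))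
    have h1 : M.value φ + t ≤ (∑ j, ∑ h, (τ j).2.2 h) / (L : ℝ) := not_lt.1 hτ
    rw [le_div_iff₀ hL'] at h1
    change L * M.value φ + L * t ≤ ∑ j, ∑ h, (τ j).2.2 h
    linarith

theorem numOuter_pos {δ : ℝ} (hδ : 0 < δ) (hδ1 : δ < 1) : 0 < numOuter δ := by
  refine Nat.ceil_pos.2 (div_pos (Real.log_pos ?_) two_pos)
  rw [lt_div_iff₀ hδ]
  linarith

theorem one_lt_numOuter_div {δ : ℝ} (hδ : 0 < δ) (hδ1 : δ < 1) : 1 < 2 * numOuter δ / δ := by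
  have h : (1 : ℝ) ≤ numOuter δ := by exact_mod_cast numOuter_pos hδ hδ1
  rw [lt_div_iff₀ hδ]
  linarith

theorem numEval_pos {ε δ : ℝ} (hε : 0 < ε) (hδ : 0 < δ) (hδ1 : δ < 1) (hH : 0 < H) :
    0 < numEval H ε δ := by
  have h := Real.log_pos (one_lt_numOuter_div hδ hδ1)
  have hH' : (0 : ℝ) < H := by exact_mod_cast hH
  exact Nat.ceil_pos.2 (by positivity)

theorem exp_numEval_le {ε δ : ℝ} (hε : 0 < ε) (hδ : 0 < δ) (hδ1 : δ < 1) (hH : 0 < H) :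
    Real.exp (-(2 * numEval H ε δ * (ε / 3) ^ 2 / (H : ℝ) ^ 2)) ≤ δ / (2 * numOuter δ) := by
  have h1 := one_lt_numOuter_div hδ hδ1
  have hH' : (0 : ℝ) < H := by exact_mod_cast hH
  have hN : (0 : ℝ) < numOuter δ := by exact_mod_cast numOuter_pos hδ hδ1
  have h2 : 9 * (H : ℝ) ^ 2 / (2 * ε ^ 2) * Real.log (2 * numOuter δ / δ) ≤ numEval H ε δ :=
    Nat.le_ceil _
  have h3 : Real.log (2 * numOuter δ / δ) ≤ 2 * numEval H ε δ * (ε / 3) ^ 2 / (H : ℝ) ^ 2 := by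
    rw [le_div_iff₀ (by positivity)]
    calc Real.log (2 * numOuter δ / δ) * (H : ℝ) ^ 2
        = (9 * (H : ℝ) ^ 2 / (2 * ε ^ 2) * Real.log (2 * numOuter δ / δ)) *
          (2 * (ε / 3) ^ 2) := by field_simp; ring
      _ ≤ numEval H ε δ * (2 * (ε / 3) ^ 2) := by gcongr
      _ = _ := by ring
  calc _ ≤ Real.exp (-Real.log (2 * numOuter δ / δ)) := Real.exp_le_exp.2 (neg_le_neg h3)
    _ = δ / (2 * numOuter δ) := by
      rw [Real.exp_neg, Real.exp_log (by linarith), inv_div]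

/-- N is chosen for the base e⁻², and 1/10 ≤ e⁻². -/
theorem pow_numOuter_le {δ : ℝ} (hδ : 0 < δ) : (1 / 10 : ℝ) ^ numOuter δ ≤ δ / 2 := by
  have h1 : Real.log (2 / δ) / 2 ≤ numOuter δ := Nat.le_ceil _
  have h2 : (1 / 10 : ℝ) ≤ Real.exp (-2) := by
    have h3 : Real.exp 2 ≤ 10 := by
      have h4 := Real.exp_one_lt_d9
      have h5 : Real.exp 2 = Real.exp 1 * Real.exp 1 := by rw [← Real.exp_add]; norm_num
      have h6 := Real.exp_pos 1
      rw [h5]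
      nlinarith
    rw [Real.exp_neg, one_div]
    exact inv_anti₀ (Real.exp_pos 2) h3
  calc (1 / 10 : ℝ) ^ numOuter δ ≤ Real.exp (-2) ^ numOuter δ := by gcongr
    _ = Real.exp (-(2 * numOuter δ)) := by rw [← Real.exp_nat_mul]; congr 1; ring
    _ ≤ Real.exp (-Real.log (2 / δ)) := Real.exp_le_exp.2 (by linarith)
    _ = δ / 2 := by rw [Real.exp_neg, Real.exp_log (by positivity), inv_div]

/-- Only one one-sided deviation matters per candidate: a good one must not be underestimated, and
the others must not be overestimated, by ε/3. The loss is then ε/3 for the good candidate and twice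
ε/3 for the comparison; the failure probability is δ/2 for the repetition and N · δ/(2N) for the
evaluations. -/
theorem le_prob_framework {M : BMDP S A X H} {U : Learner S X} {c : Params}
    {𝒜 : ℝ → ℝ → TabularAlg S A H} {f₀ : Fin (H + 1) → Decoder S X} {ε δ : ℝ} (hε : 0 < ε)
    (hδ : 0 < δ) (hδ1 : δ < 1)
    (hc : 1 - ENNReal.ofReal (1 / 10) ≤ Interaction.prob M {φ | M.IsEpsOptimal (ε / 3) φ}
      (outerIter c U (𝒜 (ε / 4) c.δ₂) f₀)) :
    ENNReal.ofReal (1 - δ) ≤ (framework c U 𝒜 f₀ ε δ).prob M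
      {Φ | Φ.Nonempty ∧ ∀ φ ∈ Φ, M.IsEpsOptimal ε φ} := by
  classical
  set N := numOuter δ with hN
  have hNpos : 0 < N := numOuter_pos hδ hδ1
  have hN' : (0 : ℝ) < N := by exact_mod_cast hNpos
  have h1 := Interaction.prob_collect_exists M (ρ := ENNReal.ofReal (1 / 10))
    (by rw [ENNReal.ofReal_le_one]; norm_num) _ hc N
  have h2 : ENNReal.ofReal (1 - δ) ≤
      1 - (ENNReal.ofReal (1 / 10) ^ N + (N * ENNReal.ofReal (δ / (2 * N)) + 0)) := by
    rw [add_zero, ← ENNReal.ofReal_pow (by norm_num), ← ENNReal.ofReal_natCast N,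
      ← ENNReal.ofReal_mul hN'.le, ← ENNReal.ofReal_add (by positivity) (by positivity),
      ← ENNReal.ofReal_one, ← ENNReal.ofReal_sub _ (by positivity)]
    refine ENNReal.ofReal_le_ofReal ?_
    have h3 := pow_numOuter_le hδ
    have h4 : (N : ℝ) * (δ / (2 * N)) = δ / 2 := by field_simp
    rw [h4]
    linarith
  refine h2.trans ?_
  rw [framework]
  refine Interaction.le_prob_bind M h1 fun φ hφ => ?_
  obtain ⟨n₀, hn₀⟩ := hφ
  have hn₀' : M.IsEpsOptimal (ε / 3) (φ n₀) := hn₀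
  let E : Fin N → Set ℝ := fun n => if n = n₀ then {v | M.value (φ n) - ε / 3 < v}
    else {v | v < M.value (φ n) + ε / 3}
  have hE : ∀ n, 1 - ENNReal.ofReal (δ / (2 * N)) ≤
      Interaction.prob M (E n) (evaluate (φ n) (numEval H ε δ)) := by
    intro n
    have hH0 : 0 < H → 0 < numEval H ε δ := numEval_pos hε hδ hδ1
    -- For H = 0 there are no evaluation episodes, and all values and averages are 0.
    rcases Nat.eq_zero_or_pos H with hH | hH
    · have hv : ∀ n, M.value (φ n) = 0 := fun n => M.value_eq_zero hH _
      refine tsub_le_self.trans ?_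
      have h5 : 1 - (0 : ℝ≥0∞) ≤ Interaction.prob M (E n) (evaluate (φ n) (numEval H ε δ)) := by
        refine le_prob_evaluate M (φ n) _ ?_ ?_
        · simp only [E]
          split_ifs
          · exact measurableSet_Ioi
          · exact measurableSet_Iio
        · subst hH
          refine le_trans (measure_mono (t := ∅) fun τ hτ => ?_) (by simp)
          refine hτ ?_
          simp only [E, hv]
          split_ifs <;> simp [hε]
      simpa using h5
    · have h6 := ENNReal.ofReal_le_ofReal (exp_numEval_le hε hδ hδ1 hH)
      by_cases hn : n = n₀
      · simp only [E, if_pos hn]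
        exact le_prob_evaluate_ge M (φ n) hH0 (by positivity) h6
      · simp only [E, if_neg hn]
        exact le_prob_evaluate_le M (φ n) hH0 (by positivity) h6
  refine Interaction.le_prob_bind M (Interaction.prob_collect_forall M N
    (fun n => evaluate (φ n) (numEval H ε δ)) E hE) fun V hV => ?_
  rw [Interaction.prob_eq_expect, Interaction.expect_pure, Set.indicator_of_mem]
  · simp
  have hne : Nonempty (Fin N) := ⟨⟨0, hNpos⟩⟩
  refine ⟨?_, ?_⟩
  · obtain ⟨n, hn⟩ := Finite.exists_max V
    exact ⟨φ n, n, rfl, hn⟩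
  · rintro ψ ⟨n, rfl, hn⟩ χ
    have h7 := hn₀' χ
    by_cases hnn : n = n₀
    · rw [hnn]; linarith
    · have h8 : M.value (φ n₀) - ε / 3 < V n₀ := by
        have := hV n₀
        simp only [E, if_true] at this
        exact this
      have h9 : V n < M.value (φ n) + ε / 3 := by
        have := hV n
        simp only [E, if_neg hnn] at this
        exact this
      have h10 := hn n₀
      linarith

end Framework

/-! ### Counting trajectories -/

section SampleComplexity

variable {S A X : Type} [Fintype S] [MeasurableSpace S] [DiscreteMeasurableSpace S]
  [Fintype A] [MeasurableSpace A] [MeasurableSpace X] {H : ℕ}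

/-- At most T batches are used for training and one for testing. -/
theorem usesAtMost_tsrStep (c : Params) (U : Learner S X) {T k i : ℕ}
    (h : k * numIter S H + (i + 1) ≤ T) (π : Policy S A H) (m : Memory S A X H c.B) :
    (tsrStep c U k i π m).UsesAtMost ((T + 1) * c.B) := by
  have h1 : (tsrStep c U k i π m).UsesAtMost
      ((k * numIter S H + (i + 1)) * c.B + (c.B + (0 + 0))) :=
    Interaction.usesAtMost_bind (Interaction.usesAtMost_sampleUnif _ _ _) fun _ =>
      Interaction.usesAtMost_bind (Interaction.usesAtMost_sample _ _) fun _ =>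
        Interaction.usesAtMost_bind (Interaction.usesAtMost_seeds _) fun _ =>
          Interaction.usesAtMost_pure _
  refine h1.mono ?_
  rw [add_mul T, one_mul]
  exact Nat.add_le_add (Nat.mul_le_mul_right _ h) le_rfl

theorem usesAtMost_tsrLoop (c : Params) (U : Learner S X) {T k : ℕ} (π : Policy S A H)
    (m : Memory S A X H c.B) : ∀ j, k * numIter S H + j ≤ T →
      (tsrLoop c U k π m j).UsesAtMost (j * ((T + 1) * c.B))
  | 0, _ => trivial
  | j + 1, h => by
    rw [add_mul j, one_mul]
    exact Interaction.usesAtMost_bind (usesAtMost_tsrLoop c U π m j (by omega)) fun m' =>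
      usesAtMost_tsrStep c U h π m'

theorem usesAtMost_tsr (c : Params) (U : Learner S X) {T k : ℕ} (h : (k + 1) * numIter S H ≤ T)
    (π : Policy S A H) (m : Memory S A X H c.B) :
    (tsr c U k π m).UsesAtMost (numIter S H * ((T + 1) * c.B) + (1 + 0)) :=
  Interaction.usesAtMost_bind (usesAtMost_tsrLoop c U π m _ (by linarith)) fun _ =>
    Interaction.usesAtMost_bind (Interaction.usesAtMost_sample _ _) fun _ =>
      Interaction.usesAtMost_pure _

theorem usesAtMost_simEpisodes (c : Params) (U : Learner S X) (𝒜 : TabularAlg S A H)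
    (f₀ : Fin (H + 1) → Decoder S X) (ω : Seed) {T : ℕ} : ∀ k, k * numIter S H ≤ T →
      (simEpisodes c U 𝒜 f₀ ω k).UsesAtMost (k * (numIter S H * ((T + 1) * c.B) + 1))
  | 0, _ => trivial
  | k + 1, h => by
    rw [add_mul k, one_mul]
    exact Interaction.usesAtMost_bind (usesAtMost_simEpisodes c U 𝒜 f₀ ω k
      ((Nat.mul_le_mul_right _ (Nat.le_succ _)).trans h)) fun z =>
        Interaction.usesAtMost_bind (T₂ := 0) (usesAtMost_tsr c U h _ _) fun _ =>
          Interaction.usesAtMost_pure _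

theorem usesAtMost_outerIter (c : Params) (U : Learner S X) (𝒜 : TabularAlg S A H)
    (f₀ : Fin (H + 1) → Decoder S X) {T : ℕ} (h : (𝒜.K + 1) * numIter S H ≤ T) :
    (outerIter c U 𝒜 f₀).UsesAtMost
      ((𝒜.K + 1) * (numIter S H * ((T + 1) * c.B) + 1)) := by
  rw [← zero_add ((𝒜.K + 1) * _)]
  refine Interaction.usesAtMost_bind (Interaction.usesAtMost_seeds _) fun ω => ?_
  rw [add_mul 𝒜.K, one_mul]
  exact Interaction.usesAtMost_bind (usesAtMost_simEpisodes c U 𝒜 f₀ _ _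
    ((Nat.mul_le_mul_right _ (Nat.le_succ _)).trans h)) fun z =>
      Interaction.usesAtMost_bind (T₂ := 0) (usesAtMost_tsr c U h _ _) fun _ =>
        Interaction.usesAtMost_pure _

theorem usesAtMost_framework (c : Params) (U : Learner S X) (𝒜 : ℝ → ℝ → TabularAlg S A H)
    (f₀ : Fin (H + 1) → Decoder S X) (ε δ : ℝ) {T : ℕ}
    (h : ((𝒜 (ε / 4) c.δ₂).K + 1) * numIter S H ≤ T) :
    (framework c U 𝒜 f₀ ε δ).UsesAtMost (numOuter δ * (((𝒜 (ε / 4) c.δ₂).K + 1) *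
      (numIter S H * ((T + 1) * c.B) + 1)) + (numOuter δ * (numEval H ε δ + 0) + 0)) :=
  Interaction.usesAtMost_bind (Interaction.usesAtMost_collect _ _ fun _ =>
    usesAtMost_outerIter c U _ f₀ h) fun _ =>
      Interaction.usesAtMost_bind (Interaction.usesAtMost_collect _ _ fun _ =>
        Interaction.usesAtMost_bind (Interaction.usesAtMost_sample _ _) fun _ =>
          Interaction.usesAtMost_pure _) fun _ => Interaction.usesAtMost_pure _

end SampleComplexity

/-! ### Numerical estimates for tuned parameters -/

section Numerics

/-- The given polynomials may have negative coefficients. The bound by a monomial in a common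
majorant of the arguments restores monotonicity. -/
theorem exists_abs_eval_le {n : ℕ} (p : MvPolynomial (Fin n) ℝ) :
    ∃ C d : ℕ, ∀ (x : Fin n → ℝ) (y : ℝ), 1 ≤ y → (∀ i, |x i| ≤ y) →
      |MvPolynomial.eval x p| ≤ C * y ^ d := by
  induction p using MvPolynomial.induction_on with
  | C a =>
    refine ⟨⌈|a|⌉₊, 0, fun x y _ _ => ?_⟩
    rw [MvPolynomial.eval_C, pow_zero, mul_one]
    exact Nat.le_ceil _
  | add p q hp hq =>
    obtain ⟨C₁, d₁, h₁⟩ := hp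
    obtain ⟨C₂, d₂, h₂⟩ := hq
    refine ⟨C₁ + C₂, max d₁ d₂, fun x y hy hx => ?_⟩
    rw [map_add]
    refine (abs_add_le _ _).trans ?_
    push_cast
    rw [add_mul]
    refine add_le_add ((h₁ x y hy hx).trans ?_) ((h₂ x y hy hx).trans ?_)
    · gcongr
      exact le_max_left _ _
    · gcongr
      exact le_max_right _ _
  | mul_X p i hp =>
    obtain ⟨C, d, h⟩ := hp
    refine ⟨C, d + 1, fun x y hy hx => ?_⟩
    rw [map_mul, MvPolynomial.eval_X, abs_mul, pow_succ, ← mul_assoc]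
    exact mul_le_mul (h x y hy hx) (hx i) (abs_nonneg _) (by positivity)

theorem cast_count (k T B : ℕ) :
    (k * k + k.factorial + (k + k) + T * k * (k * ((T * B : ℕ) + 1 : ℝ≥0∞) ^ k)) =
      ((k * k + k.factorial + (k + k) + T * k * (k * (T * B + 1) ^ k) : ℕ) : ℝ≥0∞) := by
  push_cast
  rfl

/-- The exponents are 7 for the constant 80, 1 each for T and Q, 2 for the number 4 of summands and
k + 3 for each summand. -/
theorem mul_count_le_pow {k T Q W : ℕ} (hk : k ≤ W) (hT : T ≤ W) (hQ : Q ≤ W) (hW : 2 ≤ W) :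
    80 * T * Q * (k * k + k.factorial + (k + k) + T * k * (k * W ^ k)) ≤ W ^ (k + 14) := by
  have hW1 : 1 ≤ W := by omega
  have h1 : k * k ≤ W ^ (k + 3) := by
    calc k * k ≤ W * W := Nat.mul_le_mul hk hk
      _ = W ^ 2 := by ring
      _ ≤ W ^ (k + 3) := Nat.pow_le_pow_right hW1 (by omega)
  have h2 : k.factorial ≤ W ^ (k + 3) := by
    calc k.factorial ≤ k ^ k := Nat.factorial_le_pow k
      _ ≤ W ^ k := Nat.pow_le_pow_left hk k
      _ ≤ W ^ (k + 3) := Nat.pow_le_pow_right hW1 (by omega)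
  have h3 : k + k ≤ W ^ (k + 3) := by
    calc k + k = 2 * k := by ring
      _ ≤ W * W := Nat.mul_le_mul hW hk
      _ = W ^ 2 := by ring
      _ ≤ W ^ (k + 3) := Nat.pow_le_pow_right hW1 (by omega)
  have h4 : T * k * (k * W ^ k) ≤ W ^ (k + 3) := by
    calc T * k * (k * W ^ k) ≤ W * W * (W * W ^ k) := by gcongr
      _ = W ^ (k + 3) := by ring
  have h5 : 80 ≤ W ^ 7 := by
    calc 80 ≤ 2 ^ 7 := by norm_num
      _ ≤ W ^ 7 := Nat.pow_le_pow_left hW 7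
  have h6 : 4 ≤ W ^ 2 := by nlinarith
  calc 80 * T * Q * (k * k + k.factorial + (k + k) + T * k * (k * W ^ k))
      ≤ W ^ 7 * W * W * (4 * W ^ (k + 3)) := by
        gcongr
        linarith
    _ ≤ W ^ 7 * W * W * (W ^ 2 * W ^ (k + 3)) := by gcongr
    _ = W ^ (k + 14) := by ring

/-- From Tb² + 1 ≤ (2Tb)² ≤ exp(4Tb) and k + 14 ≤ 7Q, the left side has an exponent of at most
28QTb, linear in b, while the right one is quadratic. The constant 5600 is 28 · 200. -/
theorem pow_le_exp_of_batch {k T Q Θ b : ℕ} (hT : 1 ≤ T) (hk : k + 2 ≤ Q) (hΘ : 1 ≤ Θ)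
    (hb : 5600 * Q * T * Θ ^ 2 ≤ b) :
    ((T * b ^ 2 + 1 : ℕ) : ℝ) ^ (k + 14) ≤ Real.exp ((b : ℝ) ^ 2 * (1 / (Θ : ℝ)) ^ 2 / 200) := by
  have hQ : 2 ≤ Q := by omega
  have hb1 : 1 ≤ b := le_trans (by
    have : 0 < Q * T * Θ ^ 2 := by positivity
    nlinarith) hb
  have hT' : (1 : ℝ) ≤ T := by exact_mod_cast hT
  have hb1' : (1 : ℝ) ≤ b := by exact_mod_cast hb1
  have hΘ' : (1 : ℝ) ≤ Θ := by exact_mod_cast hΘ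
  have hQ' : (2 : ℝ) ≤ Q := by exact_mod_cast hQ
  have hb' : 5600 * Q * T * (Θ : ℝ) ^ 2 ≤ b := by exact_mod_cast hb
  have hkQ : ((k + 14 : ℕ) : ℝ) ≤ 7 * Q := by
    have : k + 14 ≤ 7 * Q := by omega
    exact_mod_cast this
  have h1 : ((T * b ^ 2 + 1 : ℕ) : ℝ) ≤ Real.exp (4 * T * b) := by
    have h2 : (2 * T * b : ℝ) ≤ Real.exp (2 * T * b) := by
      linarith [Real.add_one_le_exp (2 * T * b : ℝ)]
    calc ((T * b ^ 2 + 1 : ℕ) : ℝ) = T * (b : ℝ) ^ 2 + 1 := by push_cast; ring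
      _ ≤ (2 * T * b) ^ 2 := by
        have h3 : (1 : ℝ) ≤ (T : ℝ) * (b : ℝ) ^ 2 := one_le_mul_of_one_le_of_one_le hT'
          (one_le_pow₀ hb1')
        have h4 : (T : ℝ) * (b : ℝ) ^ 2 ≤ T * (T * (b : ℝ) ^ 2) :=
          le_mul_of_one_le_left (by positivity) hT'
        nlinarith
      _ ≤ Real.exp (2 * T * b) ^ 2 := by gcongr
      _ = Real.exp (4 * T * b) := by rw [← Real.exp_nat_mul]; congr 1; push_cast; ring
  calc ((T * b ^ 2 + 1 : ℕ) : ℝ) ^ (k + 14) ≤ Real.exp (4 * T * b) ^ (k + 14) := by gcongr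
    _ = Real.exp ((k + 14 : ℕ) * (4 * T * b)) := by rw [← Real.exp_nat_mul]
    _ ≤ _ := by
      refine Real.exp_le_exp.2 ?_
      rw [one_div, inv_pow, ← div_eq_mul_inv, div_div, le_div_iff₀ (by positivity)]
      calc ((k + 14 : ℕ) : ℝ) * (4 * T * b) * ((Θ : ℝ) ^ 2 * 200)
          ≤ (7 * Q) * (4 * T * b) * ((Θ : ℝ) ^ 2 * 200) := by gcongr
        _ = (5600 * Q * T * (Θ : ℝ) ^ 2) * b := by ring
        _ ≤ b * b := by gcongr
        _ = (b : ℝ) ^ 2 := by ring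

/-- The parameters, described by natural numbers: the number `T` of steps, the size `Q` of the
problem, the inverse `Θ` of the threshold, and the square root `b` of the batch size. -/
structure Params.Tuned (c : Params) (k H T Q Θ b : ℕ) : Prop where
  batch : c.B = b ^ 2
  threshold : c.threshold = 1 / Θ
  confidence : c.δ₁ = 1 / (80 * T * Q)
  failure : c.δ₂ = 1 / (20 * (k.factorial : ℝ) ^ (H + 1))
  inv_threshold : Θ = 120 * T * Q ^ 2
  le_root : 5600 * Q * T * Θ ^ 2 ≤ b
  one_le : 1 ≤ T
  size_le : k + H + 2 ≤ Q

namespace Params.Tuned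

variable {c : Params} {k H T Q Θ b : ℕ}

theorem one_le_inv_threshold (h : c.Tuned k H T Q Θ b) : 1 ≤ Θ := by
  have h1 := h.one_le
  have h2 : 1 ≤ Q := by have := h.size_le; omega
  rw [h.inv_threshold]
  exact Nat.one_le_iff_ne_zero.2 (by positivity)

theorem le_root' (h : c.Tuned k H T Q Θ b) : T * Q ≤ b ∧ 1 ≤ b := by
  have h1 := h.one_le
  have h2 : 1 ≤ Q := by have := h.size_le; omega
  have h3 : 1 ≤ Θ ^ 2 := Nat.one_le_pow _ _ h.one_le_inv_threshold
  have h4 : T * Q ≤ b := by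
    calc T * Q ≤ 5600 * (T * Q * 1) := by omega
      _ ≤ 5600 * (T * Q * Θ ^ 2) := by gcongr
      _ = 5600 * Q * T * Θ ^ 2 := by ring
      _ ≤ b := h.le_root
  exact ⟨h4, le_trans (Nat.mul_le_mul h1 h2) h4⟩

/-- The oracle's confidence δ₁ and all concentration errors together contribute 1/(80TQ) each. -/
theorem levelFailure_le (h : c.Tuned k H T Q Θ b) :
    c.levelFailure T k ≤ ENNReal.ofReal (1 / (40 * T * Q)) := by
  have hT := h.one_le
  have hQ : 2 ≤ Q := by have := h.size_le; omega
  have hT' : (0 : ℝ) < T := by exact_mod_cast hT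
  have hQ' : (0 : ℝ) < Q := by exact_mod_cast (by omega : 0 < Q)
  obtain ⟨h1, h2⟩ := h.le_root'
  have hTb : T ≤ b := (Nat.le_mul_of_pos_right T (by omega)).trans h1
  have hQb : Q ≤ b := (Nat.le_mul_of_pos_left Q (by omega)).trans h1
  set W := T * b ^ 2 + 1 with hW
  have hbW : b ≤ W := by
    calc b ≤ b ^ 2 := Nat.le_self_pow (by norm_num) b
      _ ≤ T * b ^ 2 := Nat.le_mul_of_pos_left _ (by omega)
      _ ≤ W := Nat.le_succ _
  have hcount := mul_count_le_pow (k := k) (T := T) (Q := Q) (W := W)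
    (by have := h.size_le; omega) (hTb.trans hbW) (hQb.trans hbW) (by omega)
  have hpow := pow_le_exp_of_batch hT (k := k) (Q := Q) (by have := h.size_le; omega)
    h.one_le_inv_threshold h.le_root
  set m := k * k + k.factorial + (k + k) + T * k * (k * W ^ k) with hm
  have hexp : (c.B : ℝ) * c.threshold ^ 2 / 200 = (b : ℝ) ^ 2 * (1 / (Θ : ℝ)) ^ 2 / 200 := by
    rw [h.batch, h.threshold]; push_cast; ring
  have hreal : (m : ℝ) * Real.exp (-(c.B * c.threshold ^ 2 / 200)) ≤ 1 / (80 * T * Q) := by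
    rw [hexp, Real.exp_neg, ← div_eq_mul_inv, div_le_div_iff₀ (Real.exp_pos _) (by positivity),
      one_mul]
    refine le_trans ?_ hpow
    calc (m : ℝ) * (80 * T * Q) = ((80 * T * Q * m : ℕ) : ℝ) := by push_cast; ring
      _ ≤ ((W ^ (k + 14) : ℕ) : ℝ) := by exact_mod_cast hcount
      _ = _ := Nat.cast_pow _ _
  have hlevel : c.levelFailure T k = ENNReal.ofReal c.δ₁ +
      ENNReal.ofReal ((m : ℝ) * Real.exp (-(c.B * c.threshold ^ 2 / 200))) := by
    rw [Params.levelFailure, cast_count, h.batch, ENNReal.ofReal_mul (Nat.cast_nonneg m),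
      ENNReal.ofReal_natCast]
  rw [hlevel, ← ENNReal.ofReal_add (by rw [h.confidence]; positivity)
    (mul_nonneg (Nat.cast_nonneg m) (Real.exp_pos _).le)]
  refine ENNReal.ofReal_le_ofReal ?_
  calc _ ≤ 1 / (80 * T * Q : ℝ) + 1 / (80 * T * Q) := add_le_add h.confidence.le hreal
    _ = 1 / (40 * T * Q : ℝ) := by field_simp; norm_num

/-- The budget is 1/40 for the iterations, 1/40 for wrongly decoded trajectories and 1/20 for the
tabular algorithm on all relabelled MDPs. -/
theorem outerFailure_le {S : Type} [Fintype S] {K : ℕ}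
    (h : c.Tuned (Fintype.card S) H T Q Θ b) (hK : (K + 1) * numIter S H ≤ T) :
    c.outerFailure S T K H ≤ ENNReal.ofReal (1 / 10) := by
  have hT' : (0 : ℝ) < T := by exact_mod_cast h.one_le
  have hQ : H + 1 ≤ Q := by have := h.size_le; omega
  have hQ1 : (1 : ℝ) ≤ Q := by exact_mod_cast (by omega : 1 ≤ Q)
  have hQ' : ((H + 1 : ℕ) : ℝ) ≤ Q := by exact_mod_cast hQ
  have hK' : ((K + 1) * numIter S H : ℝ) ≤ T := by exact_mod_cast hK
  have hloop : ((K : ℝ≥0∞) + 1) * c.loopFailure S T H ≤ ENNReal.ofReal (1 / 40) := by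
    calc ((K : ℝ≥0∞) + 1) * c.loopFailure S T H
        = (((K + 1) * numIter S H : ℕ) : ℝ≥0∞) *
            ((H + 1 : ℕ) * c.levelFailure T (Fintype.card S)) := by
          rw [Params.loopFailure, Params.stepFailure]; push_cast; ring
      _ ≤ (T : ℝ≥0∞) * ((Q : ℝ≥0∞) * ENNReal.ofReal (1 / (40 * T * Q))) := by
          gcongr
          exact h.levelFailure_le
      _ = ENNReal.ofReal (1 / 40) := by
          rw [← ENNReal.ofReal_natCast T, ← ENNReal.ofReal_natCast Q,
            ← ENNReal.ofReal_mul (by positivity), ← ENNReal.ofReal_mul (by positivity)]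
          congr 1
          field_simp
  have hdec : ((K : ℝ≥0∞) + 1) * c.decodeFailure H (Fintype.card S) ≤ ENNReal.ofReal (1 / 40) := by
    have e : ((K : ℝ≥0∞) + 1) = ENNReal.ofReal (K + 1) := by
      rw [ENNReal.ofReal_add (by positivity) zero_le_one]; simp
    rw [Params.decodeFailure, e, ← ENNReal.ofReal_mul (by positivity)]
    refine ENNReal.ofReal_le_ofReal ?_
    have h1 : ((K : ℝ) + 1) * ((H + 1) * Fintype.card S) ≤ T := by
      refine le_trans ?_ hK'
      gcongr
      rw [numIter]; push_cast; linarith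
    have h2 : (1 : ℝ) ≤ (Q : ℝ) ^ 2 := one_le_pow₀ hQ1
    rw [h.threshold, h.inv_threshold]
    push_cast
    calc ((K : ℝ) + 1) * ((H + 1) * (3 * Fintype.card S * (1 / (120 * T * (Q : ℝ) ^ 2))))
        = (((K : ℝ) + 1) * ((H + 1) * Fintype.card S)) * (3 * (1 / (120 * T * (Q : ℝ) ^ 2))) := by
          ring
      _ ≤ T * (3 * (1 / (120 * T * (Q : ℝ) ^ 2))) := by gcongr
      _ = 1 / 40 * (1 / (Q : ℝ) ^ 2) := by field_simp; norm_num
      _ ≤ 1 / 40 := mul_le_of_le_one_right (by norm_num)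
          (by rw [div_le_one (by positivity)]; exact h2)
  have hfail : (((Fintype.card S).factorial ^ (H + 1) : ℕ) : ℝ≥0∞) * ENNReal.ofReal c.δ₂ =
      ENNReal.ofReal (1 / 20) := by
    have : (0 : ℝ) < (Fintype.card S).factorial := by exact_mod_cast Nat.factorial_pos _
    rw [← ENNReal.ofReal_natCast, ← ENNReal.ofReal_mul (by positivity), h.failure]
    congr 1
    push_cast
    field_simp
  rw [Params.outerFailure, mul_add, hfail]
  refine (add_le_add (add_le_add hloop hdec) le_rfl).trans ?_
  rw [← ENNReal.ofReal_add (by norm_num) (by norm_num),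
    ← ENNReal.ofReal_add (by norm_num) (by norm_num)]
  exact ENNReal.ofReal_le_ofReal (by norm_num)

/-- The decoding error costs at most QT · 3θ = 1/(40Q) ≤ ε/40, and ε/4 + ε/40 ≤ ε/3. -/
theorem accuracy_le (h : c.Tuned k H T Q Θ b) {ε : ℝ} (hε : 0 < ε) (hQε : 1 / ε ≤ Q)
    (hT : (H + 1) * k ≤ T) : c.accuracy H k (ε / 4) ≤ ε / 3 := by
  have hT' : (0 : ℝ) < T := by exact_mod_cast h.one_le
  have hQ : H + 1 ≤ Q := by have := h.size_le; omega
  have hQ1 : (0 : ℝ) < Q := by exact_mod_cast (by omega : 0 < Q)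
  have hQ' : (H : ℝ) ≤ Q := by exact_mod_cast (by omega : H ≤ Q)
  have hTk : ((H + 1) * k : ℝ) ≤ T := by exact_mod_cast hT
  have hQε' : 1 / (Q : ℝ) ≤ ε := by
    rw [div_le_iff₀ hQ1]
    rw [div_le_iff₀ hε] at hQε
    linarith
  rw [Params.accuracy, h.threshold, h.inv_threshold]
  push_cast
  have : (H : ℝ) * ((H + 1) * (3 * k * (1 / (120 * T * (Q : ℝ) ^ 2)))) ≤ ε / 40 := by
    calc (H : ℝ) * ((H + 1) * (3 * k * (1 / (120 * T * (Q : ℝ) ^ 2))))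
        = H * ((H + 1) * k) * (3 * (1 / (120 * T * (Q : ℝ) ^ 2))) := by ring
      _ ≤ Q * T * (3 * (1 / (120 * T * (Q : ℝ) ^ 2))) := by gcongr
      _ = 1 / Q / 40 := by field_simp; norm_num
      _ ≤ ε / 40 := by gcongr
  linarith

end Params.Tuned

end Numerics

/-! ### Explicit choice of the parameters -/

section Choice

variable {R : Type*} [CommSemiring R]

/-- A bound for the number of steps of the trajectory sampling routine. -/
def stepBound (C d : ℕ) (q : R) : R := (C * (20 * q ^ 3) ^ d + 1) * q ^ 2

/-- The inverse of the threshold. -/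
def invThreshold (C d : ℕ) (q : R) : R := 120 * stepBound C d q * q ^ 2

/-- A bound for the sample complexity of the unsupervised learning oracle. -/
def oracleBound (C d C' d' : ℕ) (q : R) : R :=
  C' * (20 * stepBound C d q * invThreshold C d q ^ 2) ^ d' + 1

/-- The square root of the batch size. -/
def batchRoot (C d C' d' : ℕ) (q : R) : R :=
  5600 * q * stepBound C d q * invThreshold C d q ^ 2 + oracleBound C d C' d' q

/-- A bound for the number of trajectories. -/
def sampleBound (C d C' d' : ℕ) (q : R) : R :=
  q * (stepBound C d q * ((stepBound C d q + 1) * batchRoot C d C' d' q ^ 2) + stepBound C d q) +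
    q * (15 * q ^ 5)

/-- The formulas live in any commutative semiring, so that the natural parameters, their real values
and the polynomial bound are instances of the same expression, related by ring homomorphisms. -/
theorem map_sampleBound {R' : Type*} [CommSemiring R'] (φ : R →+* R') (C d C' d' : ℕ) (q : R) :
    φ (sampleBound C d C' d' q) = sampleBound C d C' d' (φ q) := by
  simp [sampleBound, batchRoot, oracleBound, invThreshold, stepBound, map_ofNat φ]

theorem sampleBound_mono (C d C' d' : ℕ) {x y : ℝ} (hx : 0 ≤ x) (hxy : x ≤ y) :
    sampleBound C d C' d' x ≤ sampleBound C d C' d' y := by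
  have hy := hx.trans hxy
  unfold sampleBound batchRoot oracleBound invThreshold stepBound
  gcongr

/-- The size of the problem, up to rounding. -/
def problemSize (k a H : ℕ) (ε δ : ℝ) : ℕ :=
  k + a + H + ⌈1 / ε⌉₊ + ⌈Real.log (δ⁻¹)⌉₊ + 2

/-- The parameters of the algorithm, for given polynomial bounds. -/
def tunedParams (C d C' d' k a H : ℕ) (ε δ : ℝ) : Params where
  B := batchRoot C d C' d' (problemSize k a H ε δ) ^ 2
  -- The solution of 3ϵ log(1/δ₁) = 1/Θ.
  ϵ := 1 / (invThreshold C d (problemSize k a H ε δ) : ℕ) /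
    (3 * Real.log (80 * (stepBound C d (problemSize k a H ε δ) : ℕ) * problemSize k a H ε δ))
  δ₁ := 1 / (80 * (stepBound C d (problemSize k a H ε δ) : ℕ) * problemSize k a H ε δ)
  -- This does not involve T, so K can be bounded before T is chosen.
  δ₂ := 1 / (20 * (k.factorial : ℝ) ^ (H + 1))

section

variable {C d C' d' k a H : ℕ} {ε δ : ℝ}

theorem two_le_problemSize : 2 ≤ problemSize k a H ε δ := Nat.le_add_left _ _

theorem sq_le_stepBound {q : ℕ} : q ^ 2 ≤ stepBound C d q :=
  Nat.le_mul_of_pos_left _ (Nat.succ_pos _)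

theorem one_le_stepBound : 1 ≤ stepBound C d (problemSize k a H ε δ) := by
  have h := two_le_problemSize (k := k) (a := a) (H := H) (ε := ε) (δ := δ)
  exact le_trans (Nat.one_le_pow _ _ (by omega)) sq_le_stepBound

/-- Here 1/δ₁ > e is established; it makes log(1/δ₁) > 1, from which ϵ < 1 follows. -/
theorem exp_one_lt_count : Real.exp 1 < 80 * (stepBound C d (problemSize k a H ε δ) : ℕ) *
    problemSize k a H ε δ := by
  have h1 : (2 : ℝ) ≤ problemSize k a H ε δ := by exact_mod_cast two_le_problemSize
  have h2 : (1 : ℝ) ≤ (stepBound C d (problemSize k a H ε δ) : ℕ) := by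
    exact_mod_cast one_le_stepBound
  have h3 := Real.exp_one_lt_d9
  nlinarith

theorem one_lt_log_count : 1 < Real.log (80 * (stepBound C d (problemSize k a H ε δ) : ℕ) *
    problemSize k a H ε δ) :=
  (Real.lt_log_iff_exp_lt ((Real.exp_pos 1).trans exp_one_lt_count)).2 exp_one_lt_count

theorem tuned_tunedParams : (tunedParams C d C' d' k a H ε δ).Tuned k H
    (stepBound C d (problemSize k a H ε δ)) (problemSize k a H ε δ)
    (invThreshold C d (problemSize k a H ε δ)) (batchRoot C d C' d' (problemSize k a H ε δ)) where
  batch := rfl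
  threshold := by
    have h := one_lt_log_count (C := C) (d := d) (k := k) (a := a) (H := H) (ε := ε) (δ := δ)
    simp only [Params.threshold, tunedParams, one_div, inv_inv]
    rw [mul_assoc, mul_comm (_ / _), ← mul_assoc, mul_div_cancel₀]
    positivity
  confidence := rfl
  failure := rfl
  inv_threshold := rfl
  le_root := Nat.le_add_right _ _
  one_le := one_le_stepBound
  size_le := by unfold problemSize; omega

theorem valid_tunedParams : (tunedParams C d C' d' k a H ε δ).Valid := by
  have ht := tuned_tunedParams (C := C) (d := d) (C' := C') (d' := d') (k := k) (a := a) (H := H)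
    (ε := ε) (δ := δ)
  have h1 := one_lt_log_count (C := C) (d := d) (k := k) (a := a) (H := H) (ε := ε) (δ := δ)
  have h2 := exp_one_lt_count (C := C) (d := d) (k := k) (a := a) (H := H) (ε := ε) (δ := δ)
  have h3 : (1 : ℝ) < Real.exp 1 := Real.one_lt_exp_iff.2 one_pos
  have h4 : (1 : ℝ) ≤ (invThreshold C d (problemSize k a H ε δ) : ℕ) := by
    exact_mod_cast ht.one_le_inv_threshold
  have h5 : (1 : ℝ) ≤ (k.factorial : ℝ) ^ (H + 1) :=
    one_le_pow₀ (by exact_mod_cast Nat.one_le_iff_ne_zero.2 (Nat.factorial_ne_zero k))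
  refine ⟨?_, ⟨?_, ?_⟩, ⟨?_, ?_⟩, ?_, ?_⟩
  · rw [ht.batch]
    exact pow_pos ht.le_root'.2 2
  · simp only [tunedParams]
    positivity
  · simp only [tunedParams]
    rw [div_lt_one (by positivity)]
    refine lt_of_le_of_lt ((div_le_one (by linarith)).2 h4) (by linarith)
  · rw [ht.confidence]
    exact div_pos one_pos (by linarith)
  · rw [ht.confidence, div_lt_one (by linarith)]
    linarith
  · rw [ht.failure]
    positivity
  · rw [ht.failure, div_lt_one (by positivity)]
    linarith

end

end Choice

/-! ### Polynomial bounds and assembly of the hypotheses -/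

section Bounds

/-- Convergence of g to 0 makes the set nonempty, so that its infimum is a member and not the
default value 0. -/
theorem lt_of_gInv_lt {g : ℕ → ℝ → ℝ} {ϵ δ : ℝ} (hg : Tendsto (fun n => g n δ) atTop (𝓝 0))
    (hϵ : 0 < ϵ) {n : ℕ} (hn : gInv g ϵ δ < n) : g n δ < ϵ := by
  have hne : {N : ℕ | ∀ n, N < n → g n δ < ϵ}.Nonempty := by
    obtain ⟨N, hN⟩ := eventually_atTop.1 (hg.eventually_lt_const hϵ)
    exact ⟨N, fun n hn => hN n hn.le⟩
  exact Nat.sInf_mem hne n hn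

/-- The union bound over all permutations is affordable because log (k!)^(H+1) ≤ (H+1)k² is
polynomial. -/
theorem log_inv_failure_le (k H Q : ℕ) (hQ : k + H + 2 ≤ Q) :
    Real.log ((1 / (20 * (k.factorial : ℝ) ^ (H + 1)))⁻¹) ≤ 20 * (Q : ℝ) ^ 3 := by
  have hf : (0 : ℝ) < k.factorial := by exact_mod_cast Nat.factorial_pos k
  have hQ1 : (1 : ℝ) ≤ Q := by exact_mod_cast (by omega : 1 ≤ Q)
  have hkQ : (k : ℝ) ≤ Q := by exact_mod_cast (by omega : k ≤ Q)
  have hHQ : (H : ℝ) + 1 ≤ Q := by exact_mod_cast (by omega : H + 1 ≤ Q)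
  have h1 : Real.log k.factorial ≤ k * k := by
    calc Real.log k.factorial ≤ Real.log ((k : ℝ) ^ k) :=
          Real.log_le_log hf (by exact_mod_cast Nat.factorial_le_pow k)
      _ = k * Real.log k := Real.log_pow _ _
      _ ≤ k * k := by gcongr; exact Real.log_le_self (Nat.cast_nonneg k)
  rw [one_div, inv_inv, Real.log_mul (by norm_num) (by positivity), Real.log_pow]
  push_cast
  have h2 : Real.log 20 ≤ 19 * (Q : ℝ) ^ 3 := by
    have h3 := Real.log_le_sub_one_of_pos (by norm_num : (0 : ℝ) < 20)
    have h4 : (1 : ℝ) ≤ (Q : ℝ) ^ 3 := one_le_pow₀ hQ1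
    linarith
  have h5 : ((H : ℝ) + 1) * Real.log k.factorial ≤ (Q : ℝ) ^ 3 := by
    calc ((H : ℝ) + 1) * Real.log k.factorial ≤ Q * (Q * Q) := by
          have : (k : ℝ) * k ≤ Q * Q := by gcongr
          have h6 : (0 : ℝ) ≤ Real.log k.factorial :=
            Real.log_nonneg (by exact_mod_cast Nat.one_le_iff_ne_zero.2 (Nat.factorial_ne_zero k))
          exact mul_le_mul hHQ (h1.trans this) h6 (by positivity)
      _ = (Q : ℝ) ^ 3 := by ring
  linarith

theorem numOuter_le {δ : ℝ} (hδ : 0 < δ) {Q : ℕ} (hQ : 2 + Real.log (δ⁻¹) ≤ Q)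
    (hδ1 : δ < 1) : numOuter δ ≤ Q := by
  have h0 : 0 ≤ Real.log (δ⁻¹) := Real.log_nonneg ((one_le_inv₀ hδ).2 hδ1.le)
  refine Nat.ceil_le.2 ?_
  have h1 : Real.log (2 / δ) = Real.log 2 + Real.log (δ⁻¹) := by
    rw [div_eq_mul_inv, Real.log_mul two_ne_zero (inv_ne_zero hδ.ne')]
  have h2 := Real.log_le_sub_one_of_pos (by norm_num : (0 : ℝ) < 2)
  rw [h1]
  linarith

theorem numEval_le {H : ℕ} {ε δ : ℝ} (hε : 0 < ε) (hδ : 0 < δ) (hδ1 : δ < 1) {Q : ℕ}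
    (hQ : 2 + Real.log (δ⁻¹) ≤ Q) (hH : H ≤ Q) (hεQ : 1 / ε ≤ Q) (hQ2 : 2 ≤ Q) :
    numEval H ε δ ≤ 15 * Q ^ 5 := by
  have hN := numOuter_le hδ hQ hδ1
  have hNpos := numOuter_pos hδ hδ1
  have hN' : (numOuter δ : ℝ) ≤ Q := by exact_mod_cast hN
  have hNpos' : (0 : ℝ) < numOuter δ := by exact_mod_cast hNpos
  have hH' : (H : ℝ) ≤ Q := by exact_mod_cast hH
  have hlog : Real.log (2 * numOuter δ / δ) ≤ 3 * Q := by
    rw [div_eq_mul_inv, Real.log_mul (by positivity) (by positivity)]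
    have h1 := Real.log_le_self (by positivity : (0 : ℝ) ≤ 2 * numOuter δ)
    linarith
  refine Nat.ceil_le.2 ?_
  have hpos : 0 ≤ Real.log (2 * numOuter δ / δ) := (Real.log_pos (one_lt_numOuter_div hδ hδ1)).le
  calc 9 * (H : ℝ) ^ 2 / (2 * ε ^ 2) * Real.log (2 * numOuter δ / δ)
      = 9 / 2 * (H : ℝ) ^ 2 * (1 / ε) ^ 2 * Real.log (2 * numOuter δ / δ) := by field_simp
    _ ≤ 9 / 2 * (Q : ℝ) ^ 2 * (Q : ℝ) ^ 2 * (3 * Q) := by gcongr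
    _ ≤ ((15 * Q ^ 5 : ℕ) : ℝ) := by
      push_cast
      have : (0 : ℝ) ≤ (Q : ℝ) ^ 5 := by positivity
      linarith

/-- The constant 4 consists of the 2 in `problemSize` and 1 for each of the two roundings. -/
theorem sampleBound_problemSize_le (C d C' d' k a H : ℕ) {ε δ : ℝ} (hε : 0 < ε) (hδ : 0 < δ)
    (hδ1 : δ < 1) : ((sampleBound C d C' d' (problemSize k a H ε δ) : ℕ) : ℝ) ≤
      MvPolynomial.eval ![(k : ℝ), (a : ℝ), (H : ℝ), 1 / ε, Real.log (δ⁻¹)]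
        (sampleBound C d C' d' (∑ i, MvPolynomial.X i + 4)) := by
  rw [map_sampleBound, ← Nat.coe_castRingHom, map_sampleBound]
  refine sampleBound_mono C d C' d' (Nat.cast_nonneg _) ?_
  have h0 : 0 ≤ Real.log (δ⁻¹) := Real.log_nonneg ((one_le_inv₀ hδ).2 hδ1.le)
  have h1 := Nat.ceil_lt_add_one (a := 1 / ε) (by positivity)
  have h2 := Nat.ceil_lt_add_one h0
  simp only [map_add, MvPolynomial.eval_X, map_ofNat, Fin.sum_univ_five]
  simp only [problemSize, Nat.coe_castRingHom]
  push_cast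
  simp
  simp at h1 h2
  linarith

end Bounds

section MainBounds

theorem problemSize_bounds (k a H : ℕ) {ε δ : ℝ} :
    2 + Real.log (δ⁻¹) ≤ problemSize k a H ε δ ∧ 1 / ε ≤ problemSize k a H ε δ ∧
      k + a + H + 2 ≤ problemSize k a H ε δ := by
  have h1 := Nat.le_ceil (1 / ε)
  have h2 := Nat.le_ceil (Real.log (δ⁻¹))
  refine ⟨?_, ?_, by unfold problemSize; omega⟩
  · have : ⌈Real.log (δ⁻¹)⌉₊ + 2 ≤ problemSize k a H ε δ := by unfold problemSize; omega
    have h3 : ((⌈Real.log (δ⁻¹)⌉₊ + 2 : ℕ) : ℝ) ≤ problemSize k a H ε δ := by exact_mod_cast this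
    push_cast at h3
    linarith
  · have : ⌈1 / ε⌉₊ ≤ problemSize k a H ε δ := by unfold problemSize; omega
    exact h1.trans (by exact_mod_cast this)

theorem numIter_le_sq {S : Type} [Fintype S] {H Q : ℕ} (hQ : Fintype.card S + H + 2 ≤ Q) :
    numIter S H ≤ Q ^ 2 := by
  rw [numIter]
  nlinarith

/-- All five arguments of `pK`, including log(1/δ₂), are at most 20Q³, and J ≤ Q². -/
theorem episodes_mul_numIter_le {S : Type} [Fintype S] {pK : MvPolynomial (Fin 5) ℝ} {C d : ℕ}
    (hpK : ∀ (x : Fin 5 → ℝ) (y : ℝ), 1 ≤ y → (∀ i, |x i| ≤ y) →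
      |MvPolynomial.eval x pK| ≤ C * y ^ d) {a H K Q : ℕ} {ε : ℝ} (hε : 0 < ε) (hεQ : 1 / ε ≤ Q)
    (hQ : Fintype.card S + a + H + 2 ≤ Q)
    (hK : (K : ℝ) ≤ MvPolynomial.eval ![(Fintype.card S : ℝ), (a : ℝ), (H : ℝ), 1 / (ε / 4),
      Real.log ((1 / (20 * ((Fintype.card S).factorial : ℝ) ^ (H + 1)))⁻¹)] pK) :
    (K + 1) * numIter S H ≤ stepBound C d Q := by
  set k := Fintype.card S with hk
  have hQ1 : (1 : ℝ) ≤ Q := by exact_mod_cast (by omega : 1 ≤ Q)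
  have hQ3 : (Q : ℝ) ≤ (Q : ℝ) ^ 3 := le_self_pow₀ hQ1 (by norm_num)
  have hnat : ∀ {n : ℕ}, n ≤ Q → |(n : ℝ)| ≤ 20 * (Q : ℝ) ^ 3 := by
    intro n hn
    have : (n : ℝ) ≤ Q := by exact_mod_cast hn
    rw [abs_of_nonneg (Nat.cast_nonneg n)]
    linarith
  have hδ : 0 ≤ Real.log ((1 / (20 * (k.factorial : ℝ) ^ (H + 1)))⁻¹) := by
    rw [one_div, inv_inv]
    refine Real.log_nonneg ?_
    have : (1 : ℝ) ≤ (k.factorial : ℝ) ^ (H + 1) :=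
      one_le_pow₀ (by exact_mod_cast Nat.one_le_iff_ne_zero.2 (Nat.factorial_ne_zero k))
    linarith
  have h1 := hpK ![(k : ℝ), (a : ℝ), (H : ℝ), 1 / (ε / 4),
      Real.log ((1 / (20 * (k.factorial : ℝ) ^ (H + 1)))⁻¹)] (20 * (Q : ℝ) ^ 3) (by linarith) (by
    intro i
    fin_cases i
    · exact hnat (by omega)
    · exact hnat (by omega)
    · exact hnat (by omega)
    · change |1 / (ε / 4)| ≤ _
      have e : 1 / (ε / 4) = 4 * (1 / ε) := by field_simp
      rw [abs_of_pos (by positivity), e]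
      linarith
    · change |Real.log ((1 / (20 * (k.factorial : ℝ) ^ (H + 1)))⁻¹)| ≤ _
      rw [abs_of_nonneg hδ]
      exact log_inv_failure_le k H Q (by omega))
  have h2 : K ≤ C * (20 * Q ^ 3) ^ d := by
    have h3 := hK.trans ((le_abs_self _).trans h1)
    exact_mod_cast h3
  have h4 : (K + 1) * numIter S H ≤ (C * (20 * Q ^ 3) ^ d + 1) * Q ^ 2 :=
    Nat.mul_le_mul (by omega) (numIter_le_sq (by omega))
  simpa [stepBound] using h4

/-- The common majorant of the arguments is 20TΘ²: it equals the inverse accuracy, and exceeds k and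
log(1/δ₁) = log(80TQ). -/
theorem gInv_lt_batch {pg : MvPolynomial (Fin 3) ℝ} {C' d' : ℕ}
    (hpg : ∀ (x : Fin 3 → ℝ) (y : ℝ), 1 ≤ y → (∀ i, |x i| ≤ y) →
      |MvPolynomial.eval x pg| ≤ C' * y ^ d') {c : Params} {k H T Q Θ b : ℕ}
    (hc : c.Tuned k H T Q Θ b) (hb : C' * (20 * T * Θ ^ 2) ^ d' + 1 ≤ b) {N : ℕ}
    (hN : (N : ℝ) ≤ MvPolynomial.eval ![(k : ℝ), 1 / (c.threshold ^ 2 / (20 * T)),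
      Real.log (c.δ₁⁻¹)] pg) : N < c.B := by
  have hT := hc.one_le
  have hQ : 2 ≤ Q := by have := hc.size_le; omega
  have hT' : (1 : ℝ) ≤ T := by exact_mod_cast hT
  have hQ' : (2 : ℝ) ≤ Q := by exact_mod_cast hQ
  have hΘ : Q ≤ Θ := by
    rw [hc.inv_threshold]
    nlinarith [Nat.mul_le_mul hT (Nat.le_self_pow (by norm_num : 2 ≠ 0) Q)]
  have hΘ4 : 4 * Q ≤ Θ := by
    rw [hc.inv_threshold]
    nlinarith [Nat.mul_le_mul hT (Nat.le_self_pow (by norm_num : 2 ≠ 0) Q)]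
  have hΘ1 : (1 : ℝ) ≤ Θ := by exact_mod_cast hc.one_le_inv_threshold
  have hΘ4' : (4 * Q : ℝ) ≤ (Θ : ℝ) ^ 2 := by
    have h1 : (4 * Q : ℝ) ≤ Θ := by exact_mod_cast hΘ4
    exact h1.trans (le_self_pow₀ hΘ1 (by norm_num))
  have hy : 80 * (T : ℝ) * Q ≤ 20 * T * (Θ : ℝ) ^ 2 := by nlinarith
  have h80 : (1 : ℝ) ≤ 80 * (T : ℝ) * Q := by nlinarith
  have hx : 1 / (c.threshold ^ 2 / (20 * T)) = 20 * T * (Θ : ℝ) ^ 2 := by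
    rw [hc.threshold]
    field_simp
  have h1 := hpg ![(k : ℝ), 1 / (c.threshold ^ 2 / (20 * T)), Real.log (c.δ₁⁻¹)]
    (20 * T * (Θ : ℝ) ^ 2) (h80.trans hy) (by
    intro i
    fin_cases i
    · change |(k : ℝ)| ≤ _
      have hk : (k : ℝ) ≤ Q := by
        have := hc.size_le
        exact_mod_cast (by omega : k ≤ Q)
      rw [abs_of_nonneg (Nat.cast_nonneg k)]
      nlinarith
    · change |1 / (c.threshold ^ 2 / (20 * T))| ≤ _
      rw [hx, abs_of_nonneg (by positivity)]
    · change |Real.log (c.δ₁⁻¹)| ≤ _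
      rw [hc.confidence, one_div, inv_inv, abs_of_nonneg (Real.log_nonneg h80)]
      exact (Real.log_le_self (by linarith)).trans hy)
  have h2 : N ≤ C' * (20 * T * Θ ^ 2) ^ d' := by
    have h3 := hN.trans ((le_abs_self _).trans h1)
    exact_mod_cast h3
  rw [hc.batch]
  calc N < b := by omega
    _ ≤ b ^ 2 := Nat.le_self_pow (by norm_num) b

variable {S A X : Type} [Fintype S] [MeasurableSpace S] [DiscreteMeasurableSpace S]
  [Fintype A] [MeasurableSpace A] [MeasurableSpace X] {H : ℕ}

theorem Params.Tuned.adequate {M : BMDP S A X H} {U : Learner S X} {c : Params} {T Q Θ b : ℕ}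
    (hc : c.Tuned (Fintype.card S) H T Q Θ b) (hv : c.Valid) {g : ℕ → ℝ → ℝ}
    (hU : U.IsOracle M.q g) (hg : gInv g (c.threshold ^ 2 / (20 * T)) c.δ₁ < c.B) :
    Adequate M U c T g where
  oracle := hU
  confidence := hv.2.2.1
  batch := hv.1
  threshold_pos := by
    have := hc.one_le_inv_threshold
    rw [hc.threshold]
    positivity
  threshold_le := by
    have h1 : (1 : ℝ) ≤ Θ := by exact_mod_cast hc.one_le_inv_threshold
    rw [hc.threshold, div_le_one (by linarith)]
    exact h1
  error_lt n hn := by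
    have hΘ := hc.one_le_inv_threshold
    have hT := hc.one_le
    -- Every training sample has at least B points, so B exceeding g⁻¹ is enough for all steps.
    refine lt_of_gInv_lt (hU c.δ₁ hv.2.2.1.1 hv.2.2.1.2).1 ?_
      (hg.trans_le (Nat.le_mul_of_pos_left _ n.succ_pos))
    rw [hc.threshold]
    positivity

theorem Params.Tuned.error_mem_Ioo {c : Params} {k H T Q Θ b : ℕ} (hc : c.Tuned k H T Q Θ b) :
    c.threshold ^ 2 / (20 * T) ∈ Set.Ioo (0 : ℝ) 1 := by
  have hΘ : (1 : ℝ) ≤ Θ := by exact_mod_cast hc.one_le_inv_threshold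
  have hT : (1 : ℝ) ≤ T := by exact_mod_cast hc.one_le
  rw [hc.threshold]
  refine ⟨by positivity, ?_⟩
  rw [div_lt_one (by positivity)]
  have : (1 / (Θ : ℝ)) ^ 2 ≤ 1 := pow_le_one₀ (by positivity) (by
    rw [div_le_one (by positivity)]; exact hΘ)
  linarith

theorem total_le_sampleBound {C d C' d' k a H K J : ℕ} {ε δ : ℝ} (hε : 0 < ε) (hδ : 0 < δ)
    (hδ1 : δ < 1) (hJ : 1 ≤ J) (hK : (K + 1) * J ≤ stepBound C d (problemSize k a H ε δ)) :
    numOuter δ * ((K + 1) * (J * ((stepBound C d (problemSize k a H ε δ) + 1) *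
      (tunedParams C d C' d' k a H ε δ).B) + 1)) + (numOuter δ * (numEval H ε δ + 0) + 0) ≤
      sampleBound C d C' d' (problemSize k a H ε δ) := by
  obtain ⟨h1, h2, h3⟩ := problemSize_bounds k a H (ε := ε) (δ := δ)
  set Q := problemSize k a H ε δ with hQ
  have hN : numOuter δ ≤ Q := numOuter_le hδ h1 hδ1
  have hL : numEval H ε δ ≤ 15 * Q ^ 5 := numEval_le hε hδ hδ1 h1 (by omega) h2 (by omega)
  have hK' : K + 1 ≤ stepBound C d Q := (Nat.le_mul_of_pos_right _ hJ).trans hK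
  have hB : (tunedParams C d C' d' k a H ε δ).B = batchRoot C d C' d' Q ^ 2 := rfl
  rw [hB]
  simp only [add_zero]
  set T := stepBound C d Q with hT
  set b := batchRoot C d C' d' Q with hb
  have hS : sampleBound C d C' d' Q = Q * (T * ((T + 1) * b ^ 2) + T) + Q * (15 * Q ^ 5) := rfl
  rw [hS]
  refine Nat.add_le_add (Nat.mul_le_mul hN ?_) (Nat.mul_le_mul hN hL)
  calc (K + 1) * (J * ((T + 1) * b ^ 2) + 1)
      = (K + 1) * J * ((T + 1) * b ^ 2) + (K + 1) := by ring
    _ ≤ T * ((T + 1) * b ^ 2) + T := Nat.add_le_add (Nat.mul_le_mul_right _ hK) hK'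

end MainBounds

end BlockMDP

end

/-! ### The main theorem -/

theorem theorem1 (pg : MvPolynomial (Fin 3) ℝ) (pK : MvPolynomial (Fin 5) ℝ) :
    ∃ (c : ℕ → ℕ → ℕ → ℝ → ℝ → BlockMDP.Params) (P : MvPolynomial (Fin 5) ℝ),
      ∀ (S A X : Type) [Fintype S] [MeasurableSpace S] [DiscreteMeasurableSpace S]
        [Fintype A] [MeasurableSpace A] [DiscreteMeasurableSpace A] [MeasurableSpace X]
        (H : ℕ) (M : BlockMDP.BMDP S A X H)
        (U : BlockMDP.Learner S X) (g : ℕ → ℝ → ℝ)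
        (𝒜 : ℝ → ℝ → BlockMDP.TabularAlg S A H)
        (f₀ : Fin (H + 1) → BlockMDP.Decoder S X),
        U.IsOracle M.q g →
        (∀ ϵ δ₁ : ℝ, 0 < ϵ → ϵ < 1 → 0 < δ₁ → δ₁ < 1 →
          (BlockMDP.gInv g ϵ δ₁ : ℝ) ≤
            MvPolynomial.eval ![(Fintype.card S : ℝ), 1 / ϵ, Real.log (δ₁⁻¹)] pg) →
        (∀ ε δ₂ : ℝ, 0 < ε → ε < 1 → 0 < δ₂ → δ₂ < 1 →
          (𝒜 ε δ₂).IsCorrect ε δ₂ ∧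
          ((𝒜 ε δ₂).K : ℝ) ≤
            MvPolynomial.eval
              ![(Fintype.card S : ℝ), (Fintype.card A : ℝ), (H : ℝ), 1 / ε, Real.log (δ₂⁻¹)]
              pK) →
        ∀ ε δ : ℝ, 0 < ε → ε < 1 → 0 < δ → δ < 1 →
          let params : BlockMDP.Params := c (Fintype.card S) (Fintype.card A) H ε δ
          let algorithm := BlockMDP.framework params U 𝒜 f₀ ε δ
          params.Valid ∧
          ENNReal.ofReal (1 - δ) ≤
            algorithm.prob M {Φ | Φ.Nonempty ∧ ∀ φ ∈ Φ, M.IsEpsOptimal ε φ} ∧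
          ∃ T : ℕ, algorithm.UsesAtMost T ∧
            (T : ℝ) ≤
              MvPolynomial.eval
                ![(Fintype.card S : ℝ), (Fintype.card A : ℝ), (H : ℝ), 1 / ε, Real.log (δ⁻¹)]
                P := by
  obtain ⟨CK, dK, hK⟩ := BlockMDP.exists_abs_eval_le pK
  obtain ⟨Cg, dg, hg⟩ := BlockMDP.exists_abs_eval_le pg
  refine ⟨BlockMDP.tunedParams CK dK Cg dg,
    BlockMDP.sampleBound CK dK Cg dg (∑ i, MvPolynomial.X i + 4), ?_⟩
  intro S A X _ _ _ _ _ _ _ H M U g 𝒜 f₀ hU hgInv h𝒜 ε δ hε hε1 hδ hδ1 params algorithm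
  have hvalid : params.Valid := BlockMDP.valid_tunedParams
  have htuned : params.Tuned _ _ _ _ _ _ := BlockMDP.tuned_tunedParams
  obtain ⟨-, hεQ, hQ⟩ := BlockMDP.problemSize_bounds (Fintype.card S) (Fintype.card A) H
    (ε := ε) (δ := δ)
  obtain ⟨hcorrect, hKle⟩ := h𝒜 (ε / 4) params.δ₂ (by linarith) (by linarith)
    hvalid.2.2.2.1 hvalid.2.2.2.2
  have hT := BlockMDP.episodes_mul_numIter_le hK hε hεQ hQ hKle
  -- This yields (H + 1)|S| ≤ T, which the accuracy estimate at the end requires.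
  have hJ : (H + 1) * Fintype.card S + 1 ≤ BlockMDP.stepBound CK dK
      (BlockMDP.problemSize (Fintype.card S) (Fintype.card A) H ε δ) :=
    (Nat.le_mul_of_pos_left _ (Nat.succ_pos _)).trans hT
  obtain ⟨hϵ, hϵ1⟩ := htuned.error_mem_Ioo
  have hadequate := htuned.adequate (M := M) hvalid hU (BlockMDP.gInv_lt_batch hg htuned
    (Nat.le_add_left _ _) (hgInv _ _ hϵ hϵ1 hvalid.2.2.1.1 hvalid.2.2.1.2))
  refine ⟨hvalid, ?_, _, BlockMDP.usesAtMost_framework params U 𝒜 f₀ ε δ hT,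
    (Nat.cast_le.2 (BlockMDP.total_le_sampleBound hε hδ hδ1 (Nat.succ_pos _) hT)).trans
      (BlockMDP.sampleBound_problemSize_le CK dK Cg dg _ _ H hε hδ hδ1)⟩
  refine BlockMDP.le_prob_framework hε hδ hδ1
    ((tsub_le_tsub_left (htuned.outerFailure_le hT) 1).trans
      ((hadequate.le_prob_outerIter hcorrect hT f₀).trans
        (BlockMDP.Interaction.prob_mono M (fun φ hφ ψ => (hφ ψ).trans ?_) _)))
  exact add_le_add le_rfl (htuned.accuracy_le hε hεQ (by omega))
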